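/- **Separability of the stationary reductions $\mathrm{KdV}_{2g+1}$.** Everything is over $\mathbb C$; let $g\ge 0$ be an integer. *The systems.* For a sequence $(h_l)_{l\ge1}$ put $h=z+\sum_{l\ge1}h_lz^{-l}$, $H^{(0)}=1$, $H^{(1)}=h$ and $H^{(k+2)}=z^2H^{(k)}-H^k_1H^{(1)}-H^k_2$, where $H^k_l$ is the coefficient of $z^{-l}$ in $H^{(k)}$. Thus $H^{(k)}=p_k(z^2)+q_k(z^2)h$ with polynomials $p_k,q_k$. The hierarchy is $$\frac{\partial h}{\partial t_j}=-hH^{(j)}+H^{(j+1)}+\sum_{l=1}^jh_lH^{(j-l)}+H^j_1 ,\qquad j\ge1,$$ and $V^{(j)}(\lambda)$, $\lambda=z^2$, is the $2\times2$ polynomial matrix with $(\partial_{t_j}+H^{(j)})\binom1h=V^{(j)}\binom1h$. The phase space $\mathcal M_{2g+1}$ of $\mathrm{KdV}_{2g+1}$ is the set of zeroes of the $(2g+1)$-st vector field, with coordinates $h_1,\dots,h_{2g+1}$; its flows are those of the times $t_{2i+1}$, $0\le i<g$, restricted to it. *The reduced manifold.* Let $A=\begin{pmatrix}0&0\\1&0\end{pmatrix}$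 and $\mathcal M_A=\{X(\lambda)=\lambda^{g+1}A+\sum_{i=0}^g\lambda^iX_i: X_i\in\mathfrak{sl}(2,\mathbb C)\}$, with covectors $(W_0,\dots,W_g)$ paired with tangent vectors by $\sum_i\mathrm{Tr}(W_iV_i)$, and with the compatible Poisson tensors $$(P_0W)_i=\sum_{j}[X_{i+j+1},W_j],\qquad (P_1W)_0=-[X_0,W_0],\quad (P_1W)_i=\sum_{j\ge1}[X_{i+j},W_j]\ (i\ge1),$$ where $X_{g+1}=A$ and $X_k=0$ for $k>g+1$; $\{F,G\}_k=\langle dF,P_k\,dG\rangle$ and $P_\lambda=P_1-\lambda P_0$. Let $H_i$ be the coefficient of $\lambda^i$ in $\frac12\mathrm{Tr}X(\lambda)^2$, let $\widetilde{\mathcal S}=\{H_{2g+1}=1,\ H_i=0 \text{ for } g+1\le i\le 2g\}$, let $E$ be the distribution spanned by $\dot X=[A,X]$, and $\widetilde{\mathcal N}=\widetilde{\mathcal S}/E$. A prolongation of a local holomorphic function $f$ on $\widetilde{\mathcal N}$ is a local holomorphic function on $\mathcal M_A$ that is invariant along $[A,X]$ and restricts on $\widetilde{\mathcal S}$ to $f$;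 brackets of functions on $\widetilde{\mathcal N}$ are computed with prolongations. *Statement.* 1. The brackets of all combinations of $P_0,P_1$, the vector field $\dot X_0=A$, $\dot X_i=0$ $(i\ge1)$, and the functions $H_i$ reduce to $\widetilde{\mathcal N}$. Let $Z$ be the reduced vector field. The symplectic leaves of the reduced $P_0$ are tangent to the level surfaces of $H_g$ (the tangent spaces coincide); $Z$ is transversal to them (at each point the tangent space of $\widetilde{\mathcal N}$ is the direct sum of that of the leaf and the line of $Z$), and $Z(H_g)=1$. If two local holomorphic functions are invariant along $Z$, so is their bracket with respect to every combination of the reduced $P_0,P_1$. 2. $\Phi: h\mapsto [V^{(2g+1)}(h)]$ is a homeomorphism from $\mathcal M_{2g+1}$ onto $\widetilde{\mathcal N}$ which identifies the holomorphic functions of $\widetilde{\mathcal N}$ with the holomorphic functions of $h_1,\dots,h_{2g+1}$, and which maps the vector field of $t_{2i+1}$, $0\le i<g$, to the reduced bi-Hamiltonian vector field $P_0\,dH_{g-1-i}=P_1\,dH_{g-i}$. 3. On each leaf there are a unique form $\omega$ with $\omega(X_f,X_k)=\{f,k\}_0$, $X_f=P_0\,df$, and a unique tensor $N$ with $\omega(X_f,NX_k)=\{f,k\}_1$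 for $f,k$ invariant along $Z$. 4. $Z(H(\lambda))=\sum_iZ(H_i)\lambda^i$ is the $(1,2)$ entry of $V^{(2g+1)}(\lambda)$. The points at which this polynomial has simple roots are dense. Each of them has an open neighbourhood $W\subset\widetilde{\mathcal N}$ with holomorphic functions $\lambda_1,\dots,\lambda_g,\mu_1,\dots,\mu_g$ on it such that on $W$: - $(\lambda_1,\dots,\lambda_g,\mu_1,\dots,\mu_g,H_g)$ are coordinates, so that the $\lambda_j,\mu_j$ are coordinates on the level surfaces of $H_g$; - $(\lambda_j,\mu_j)$ are Darboux–Nijenhuis coordinates on the leaves: $\omega=\sum_jd\mu_j\wedge d\lambda_j$, $N^*d\lambda_j=\lambda_jd\lambda_j$, $N^*d\mu_j=\lambda_jd\mu_j$; - the $\lambda_j$ are distinct and are the roots of the $(1,2)$ entry of $V^{(2g+1)}(\lambda)$, which is the minimal polynomial of $N$; $\mu_j$ is the value at $\lambda=\lambda_j$ of the $(2,2)$ entry of $V^{(2g+1)}(\lambda)$; hence $(\lambda_j,\mu_j)$ lies on the spectral curve $\det(\mu-V^{(2g+1)}(\lambda))=0$; - the flows are separable in these coordinates: the Stäckel relations $\sum_{i=0}^{g-1}\lambda_j^iH_i=\mu_j^2-\lambda_j^{2g+1}-H_g\lambda_j^g$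 hold, and near every point of $W$ at which all $\mu_j\ne0$ the Hamilton–Jacobi equations of $H_0,\dots,H_{g-1}$, restricted to the level surface of $H_g$ through the point, have a common separated complete integral: functions $S_j(\xi_j;\alpha_0,\dots,\alpha_{g-1})$ such that the points $\lambda_j=\xi_j$, $\mu_j=\partial S_j/\partial\xi_j$ of that surface satisfy $H_i=\alpha_i$, with $\det(\partial^2S_j/\partial\xi_j\partial\alpha_i)\ne0$, the given point being one of them. -/

import Mathlib

open scoped Polynomial Topology

namespace StationaryKdV

noncomputable section

/-! ### The hierarchy `CS₂` and the phase space of `KdV_{2g+1}`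

Laurent series in `z⁻¹` are elements of `LaurentSeries ℂ`, whose variable is `z⁻¹`:
the coefficient of `z ^ (-l)` is `.coeff l`.  A sequence `h : ℕ → ℂ` stands for the point of the
phase space with coordinates `h_{l+1} = h l`. -/

/-- `z ^ 2`. -/
def zSq : LaurentSeries ℂ := HahnSeries.single (-2) 1

/-- The series `h = z + ∑_{l ≥ 1} h_l z ^ (-l)`. -/
def hSeries (h : ℕ → ℂ) : LaurentSeries ℂ :=
  HahnSeries.single (-1) 1 + HahnSeries.single 1 1 * HahnSeries.ofPowerSeries ℤ ℂ (PowerSeries.mk h)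

/-- The series `H^(k)`: `H^(0) = 1`, `H^(1) = h` and
`H^(k+2) = z² H^(k) - H^k_1 H^(1) - H^k_2`, where `H^k_l` is the coefficient of `z ^ (-l)`. -/
def HSer (h : ℕ → ℂ) : ℕ → LaurentSeries ℂ
  | 0 => 1
  | 1 => hSeries h
  | k + 2 => zSq * HSer h k - HahnSeries.C ((HSer h k).coeff 1) * hSeries h
      - HahnSeries.C ((HSer h k).coeff 2)

/-- The right-hand side of the `j`-th equation of the hierarchy,
`∂h/∂t_j = - h H^(j) + H^(j+1) + ∑_{l=1}^{j} h_l H^(j-l) + H^j_1`. -/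
def cs2Series (h : ℕ → ℂ) (j : ℕ) : LaurentSeries ℂ :=
  -(hSeries h * HSer h j) + HSer h (j + 1)
    + ∑ l ∈ Finset.range j, HahnSeries.C (h l) * HSer h (j - (l + 1))
    + HahnSeries.C ((HSer h j).coeff 1)

/-- The `j`-th vector field of the hierarchy, in the coordinates `h_1, h_2, …`. -/
def cs2Field (j : ℕ) (h : ℕ → ℂ) : ℕ → ℂ := fun l => (cs2Series h j).coeff ((l : ℤ) + 1)

/-- The phase space of `KdV_{2g+1}`: the zeroes of the `(2g+1)`-st vector field. -/
def KdVPhase (g : ℕ) : Set (ℕ → ℂ) := {h | cs2Series h (2 * g + 1) = 0}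

/-- The polynomials `p_k` in `H^(k) = p_k(z²) + q_k(z²) h`. -/
def pPoly (h : ℕ → ℂ) : ℕ → ℂ[X]
  | 0 => 1
  | 1 => 0
  | k + 2 => Polynomial.X * pPoly h k - Polynomial.C ((HSer h k).coeff 2)

/-- The polynomials `q_k` in `H^(k) = p_k(z²) + q_k(z²) h`. -/
def qPoly (h : ℕ → ℂ) : ℕ → ℂ[X]
  | 0 => 0
  | 1 => 1
  | k + 2 => Polynomial.X * qPoly h k - Polynomial.C ((HSer h k).coeff 1)

/-- The matrix `V^(j)(λ)`, defined by `(∂/∂t_j + H^(j)) (1, h)ᵀ = V^(j) (1, h)ᵀ` with `λ = z²`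
(see `HSer_eq` and `VMat_spec`). -/
def VMat (h : ℕ → ℂ) (j : ℕ) : Matrix (Fin 2) (Fin 2) ℂ[X] :=
  !![pPoly h j, qPoly h j;
     pPoly h (j + 1) + ∑ l ∈ Finset.range j, Polynomial.C (h l) * pPoly h (j - (l + 1))
        + Polynomial.C ((HSer h j).coeff 1),
     qPoly h (j + 1) + ∑ l ∈ Finset.range j, Polynomial.C (h l) * qPoly h (j - (l + 1))]

/-- First row of the defining relation of `V^(j)`. -/
theorem HSer_eq (h : ℕ → ℂ) (j : ℕ) :
    HSer h j = Polynomial.eval₂ HahnSeries.C zSq (pPoly h j) + Polynomial.eval₂ HahnSeries.C zSq (qPoly h j) * hSeries h := by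
  induction j using Nat.twoStepInduction with
  | zero => simp [HSer, pPoly, qPoly]
  | one => simp [HSer, pPoly, qPoly]
  | more k ih _ =>
    simp only [HSer, pPoly, qPoly, Polynomial.eval₂_sub, Polynomial.eval₂_mul, Polynomial.eval₂_X, Polynomial.eval₂_C]
    conv_lhs => rw [show zSq * HSer h k = zSq * (Polynomial.eval₂ HahnSeries.C zSq (pPoly h k)
      + Polynomial.eval₂ HahnSeries.C zSq (qPoly h k) * hSeries h) by rw [← ih]]
    ring

/-- Second row of the defining relation of `V^(j)`. -/
theorem VMat_spec (h : ℕ → ℂ) (j : ℕ) :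
    cs2Series h j + HSer h j * hSeries h =
      Polynomial.eval₂ HahnSeries.C zSq (VMat h j 1 0) + Polynomial.eval₂ HahnSeries.C zSq (VMat h j 1 1) * hSeries h := by
  have hs : ∑ l ∈ Finset.range j, HahnSeries.C (h l) * HSer h (j - (l + 1))
      = ∑ l ∈ Finset.range j, HahnSeries.C (h l) * Polynomial.eval₂ HahnSeries.C zSq (pPoly h (j - (l + 1)))
        + (∑ l ∈ Finset.range j, HahnSeries.C (h l)
          * Polynomial.eval₂ HahnSeries.C zSq (qPoly h (j - (l + 1)))) * hSeries h := by
    rw [Finset.sum_mul, ← Finset.sum_add_distrib]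
    refine Finset.sum_congr rfl fun l _ => ?_
    rw [HSer_eq h (j - (l + 1))]; ring
  simp only [cs2Series, VMat, Matrix.of_apply, Matrix.cons_val', Matrix.cons_val_zero,
    Matrix.cons_val_one, Matrix.cons_val_fin_one, Polynomial.eval₂_add, Polynomial.eval₂_finsetSum,
    Polynomial.eval₂_mul, Polynomial.eval₂_C]
  rw [hs, HSer_eq h (j + 1)]
  ring

/-! ### The space `M_A` of matrix polynomials and its Poisson pencil -/

/-- The point `X(λ) = λ^(g+1) A + ∑_{i=0}^{g} λ^i X_i` of `M_A`, with `X_i ∈ sl(2)`, is given by the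
coordinates `X i = (p_i, q_i, r_i)` of its coefficients `X_i = [[p_i, r_i], [q_i, -p_i]]`.
The same coordinates are used for tangent vectors and for covectors `(W_0, …, W_g)`. -/
abbrev MA (g : ℕ) := Fin (g + 1) → Fin 3 → ℂ

/-- The matrix in `sl(2)` with given coordinates. -/
def slMat (x : Fin 3 → ℂ) : Matrix (Fin 2) (Fin 2) ℂ := !![x 0, x 2; x 1, -x 0]

/-- The coordinates of a matrix in `sl(2)`. -/
def slCoord (M : Matrix (Fin 2) (Fin 2) ℂ) : Fin 3 → ℂ := ![M 0 0, M 1 0, M 0 1]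

/-- The matrix `A`. -/
def matA : Matrix (Fin 2) (Fin 2) ℂ := !![0, 0; 1, 0]

/-- The coefficient of `λ^k` in `X(λ)`. -/
def coefMat {g : ℕ} (X : MA g) (k : ℕ) : Matrix (Fin 2) (Fin 2) ℂ :=
  if hk : k < g + 1 then slMat (X ⟨k, hk⟩) else if k = g + 1 then matA else 0

/-- The matrix polynomial `X(λ)`. -/
def laxPoly {g : ℕ} (X : MA g) : Matrix (Fin 2) (Fin 2) ℂ[X] :=
  ∑ k ∈ Finset.range (g + 2), (Polynomial.X ^ k : ℂ[X]) • (coefMat X k).map Polynomial.C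

/-- `H_i(X)`, the coefficient of `λ^i` in `½ Tr X(λ)²`. -/
def Hfun {g : ℕ} (i : ℕ) (X : MA g) : ℂ :=
  (1 / 2) * (Matrix.trace (laxPoly X * laxPoly X)).coeff i

/-- The pairing `⟨W, V⟩ = ∑_i Tr (W_i V_i)` of a covector and a tangent vector. -/
def pair {g : ℕ} (W V : MA g) : ℂ := ∑ i, Matrix.trace (slMat (W i) * slMat (V i))

/-- The covector `dF = (∂F/∂X_0, …, ∂F/∂X_g)` at `X`, see `pair_grad`. -/
def grad {g : ℕ} (F : MA g → ℂ) (X : MA g) : MA g := fun i =>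
  ![fderiv ℂ F X (Pi.single i (Pi.single 0 1)) / 2, fderiv ℂ F X (Pi.single i (Pi.single 2 1)),
    fderiv ℂ F X (Pi.single i (Pi.single 1 1))]

theorem pair_grad {g : ℕ} (F : MA g → ℂ) (X V : MA g) : pair (grad F X) V = fderiv ℂ F X V := by
  have hV : V = ∑ i, ∑ j, V i j • (Pi.single i (Pi.single j 1) : MA g) := by
    ext a b
    simp [Finset.sum_apply, Pi.single_apply, Finset.sum_ite_eq, apply_ite, ite_apply]
  conv_rhs => rw [hV]
  simp only [map_sum, Fin.sum_univ_three]
  unfold pair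
  refine Finset.sum_congr rfl fun i _ => ?_
  simp [grad, slMat, Matrix.trace_fin_two, Matrix.mul_apply, Fin.sum_univ_two]
  ring

/-- The Poisson tensor `P_0` at `X`: the `i`-th component of `P_0 W` is
`∑_j [X_{i+j+1}, W_j]`, where `X_{g+1} = A` and `X_k = 0` for `k > g + 1`. -/
def P0 {g : ℕ} (X W : MA g) : MA g := fun i =>
  slCoord (∑ j : Fin (g + 1), ⁅coefMat X (i + j + 1), slMat (W j)⁆)

/-- The Poisson tensor `P_1` at `X`: the component of index `0` of `P_1 W` is `-[X_0, W_0]`, and for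
`i ≥ 1` the component of index `i` is `∑_{j ≥ 1} [X_{i+j}, W_j]`. -/
def P1 {g : ℕ} (X W : MA g) : MA g := fun i =>
  if i = 0 then slCoord (-⁅coefMat X 0, slMat (W 0)⁆)
  else slCoord (∑ j : Fin (g + 1), if j = 0 then 0 else ⁅coefMat X (i + j), slMat (W j)⁆)

/-- The bracket of two functions on `M_A` at `X`, with respect to the tensor `a P_1 + b P_0`.
For `a = 0, b = 1` it is `{F, G}_0`, for `a = 1, b = 0` it is `{F, G}_1`, and for `a = 1, b = -l`
it is the bracket of `P_l = P_1 - l P_0`. -/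
def bracket {g : ℕ} (a b : ℂ) (F G : MA g → ℂ) (X : MA g) : ℂ :=
  pair (grad F X) (a • P1 X (grad G X) + b • P0 X (grad G X))

/-- The generator `Ẋ = [A, X]` of the distribution `D = P_1 (Ker P_0)`. -/
def genD {g : ℕ} (X : MA g) : MA g := fun i => slCoord ⁅matA, slMat (X i)⁆

/-- The vector field `Ẋ_0 = A`, `Ẋ_i = 0` for `i ≥ 1`. -/
def zVec (g : ℕ) : MA g := Pi.single 0 (slCoord matA)

/-! ### The reduced manifold -/

/-- The symplectic leaf `S̃` of `P_0`. -/
def Stil (g : ℕ) : Set (MA g) :=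
  {X | Hfun (2 * g + 1) X = 1 ∧ ∀ i, g + 1 ≤ i → i ≤ 2 * g → Hfun i X = 0}

/-- `exp (t A) = 1 + t A`. -/
def expA (t : ℂ) : Matrix (Fin 2) (Fin 2) ℂ := 1 + t • matA

/-- The flow at time `t` of `Ẋ = [A, X]`: simultaneous conjugation by `exp (t A)`. -/
def flowD {g : ℕ} (t : ℂ) (X : MA g) : MA g := fun i =>
  slCoord (expA t * slMat (X i) * expA (-t))

theorem slMat_flowD {g : ℕ} (t : ℂ) (X : MA g) (i : Fin (g + 1)) :
    slMat (flowD t X i) = expA t * slMat (X i) * expA (-t) := by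
  ext a b
  fin_cases a <;> fin_cases b <;>
    simp [flowD, slMat, slCoord, expA, matA, Matrix.mul_apply, Fin.sum_univ_two] <;> ring

theorem expA_mul (s t : ℂ) : expA s * expA t = expA (s + t) := by
  ext a b
  fin_cases a <;> fin_cases b <;>
    simp [expA, matA, Matrix.mul_apply, Fin.sum_univ_two]

theorem expA_zero : expA 0 = 1 := by simp [expA]

theorem slCoord_slMat (x : Fin 3 → ℂ) : slCoord (slMat x) = x := by
  ext i; fin_cases i <;> simp [slCoord, slMat]

theorem flowD_zero {g : ℕ} (X : MA g) : flowD 0 X = X := by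
  funext i; simp [flowD, expA_zero, slCoord_slMat]

theorem flowD_flowD {g : ℕ} (s t : ℂ) (X : MA g) : flowD s (flowD t X) = flowD (s + t) X := by
  funext i
  show slCoord _ = slCoord _
  rw [slMat_flowD, ← expA_mul, show -(s + t) = -t + -s by ring, ← expA_mul]
  simp only [Matrix.mul_assoc]

/-- Two points of `S̃` are equivalent when they lie on the same integral leaf of `E = D ∩ T S̃ = D`. -/
def leafSetoid (g : ℕ) : Setoid (Stil g) where
  r X Y := ∃ t : ℂ, (Y : MA g) = flowD t X
  iseqv :=
    { refl := fun X => ⟨0, (flowD_zero _).symm⟩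
      symm := by
        rintro X Y ⟨t, h⟩
        exact ⟨-t, by rw [h, flowD_flowD, neg_add_cancel, flowD_zero]⟩
      trans := by
        rintro X Y Z ⟨t, h⟩ ⟨s, h'⟩
        exact ⟨s + t, by rw [h', h, flowD_flowD]⟩ }

/-- The reduced manifold `Ñ = S̃ / E`, with the quotient topology. -/
abbrev Ntil (g : ℕ) := Quotient (leafSetoid g)

/-- The projection `S̃ → Ñ`. -/
def proj {g : ℕ} (X : Stil g) : Ntil g := Quotient.mk (leafSetoid g) X

theorem coefMat_flowD {g : ℕ} (t : ℂ) (X : MA g) (k : ℕ) :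
    coefMat (flowD t X) k = expA t * coefMat X k * expA (-t) := by
  unfold coefMat
  split_ifs with h1 h2
  · exact slMat_flowD t X _
  · ext a b
    fin_cases a <;> fin_cases b <;>
      simp [expA, matA, Matrix.mul_apply, Fin.sum_univ_two]
  · simp

theorem laxPoly_flowD {g : ℕ} (t : ℂ) (X : MA g) :
    laxPoly (flowD t X)
      = (expA t).map Polynomial.C * laxPoly X * (expA (-t)).map Polynomial.C := by
  unfold laxPoly
  rw [Matrix.mul_sum, Matrix.sum_mul]
  refine Finset.sum_congr rfl fun k _ => ?_
  rw [coefMat_flowD, Matrix.map_mul, Matrix.map_mul, Matrix.mul_smul, Matrix.smul_mul]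

theorem Hfun_flowD {g : ℕ} (i : ℕ) (t : ℂ) (X : MA g) : Hfun i (flowD t X) = Hfun i X := by
  have hE : (expA (-t)).map Polynomial.C * (expA t).map Polynomial.C
      = (1 : Matrix (Fin 2) (Fin 2) ℂ[X]) := by
    rw [← Matrix.map_mul, expA_mul, neg_add_cancel, expA_zero,
      Matrix.map_one _ (map_zero _) (map_one _)]
  unfold Hfun
  rw [laxPoly_flowD]
  generalize (expA t).map Polynomial.C = B at *
  generalize (expA (-t)).map Polynomial.C = C at *
  generalize laxPoly X = M
  have : B * M * C * (B * M * C) = B * (M * M * C) := by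
    calc B * M * C * (B * M * C) = B * M * (C * B) * M * C := by simp only [Matrix.mul_assoc]
      _ = _ := by rw [hE, Matrix.mul_one]; simp only [Matrix.mul_assoc]
  rw [this, Matrix.trace_mul_comm, Matrix.mul_assoc, hE, Matrix.mul_one]

/-- The function on `Ñ` induced by `H_i`. -/
def HN {g : ℕ} (i : ℕ) : Ntil g → ℂ :=
  Quotient.lift (fun X : Stil g => Hfun i (X : MA g)) (by
    rintro X Y ⟨t, h⟩
    show Hfun i (X : MA g) = Hfun i (Y : MA g)
    rw [h, Hfun_flowD])

/-- `F` is a prolongation, near `X ∈ S̃`, of the function `f` on `Ñ`: it is holomorphic near `X` on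
`M_A`, it annihilates the distribution `D`, and it coincides on `S̃` with `f` seen as a function
on `S̃`. -/
def IsProlong {g : ℕ} (f : Ntil g → ℂ) (X : Stil g) (F : MA g → ℂ) : Prop :=
  (∀ᶠ Y in 𝓝 (X : MA g), DifferentiableAt ℂ F Y ∧ fderiv ℂ F Y (genD Y) = 0) ∧
    ∀ᶠ Y : Stil g in 𝓝 X, F (Y : MA g) = f (proj Y)

/-- `f` is holomorphic on the subset `W` of `Ñ` (used for open `W`). -/
def HolOn {g : ℕ} (f : Ntil g → ℂ) (W : Set (Ntil g)) : Prop :=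
  ∀ X : Stil g, proj X ∈ W → ∃ F, IsProlong f X F

open Classical in
/-- The reduced bracket on `Ñ` (with respect to the reduction of `a P_1 + b P_0`): the bracket of
prolongations of the two functions. -/
def redBracket {g : ℕ} (a b : ℂ) (f k : Ntil g → ℂ) (n : Ntil g) : ℂ :=
  if hc : ∃ c : ℂ, ∃ (X : Stil g) (F K : MA g → ℂ),
      proj X = n ∧ IsProlong f X F ∧ IsProlong k X K ∧ c = bracket a b F K X
  then hc.choose else 0

open Classical in
/-- The reduced vector field `Z` on `Ñ`, as a derivation: the derivative of a prolongation along
`Ẋ_0 = A`. -/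
def redZ {g : ℕ} (f : Ntil g → ℂ) (n : Ntil g) : ℂ :=
  if hc : ∃ c : ℂ, ∃ (X : Stil g) (F : MA g → ℂ),
      proj X = n ∧ IsProlong f X F ∧ c = fderiv ℂ F X (zVec g)
  then hc.choose else 0

/-! ### Tangent spaces, symplectic form and Nijenhuis tensor -/

/-- `T_X S̃`. -/
def tanS {g : ℕ} (X : MA g) : Submodule ℂ (MA g) :=
  ⨅ i ∈ Finset.Icc (g + 1) (2 * g + 1), LinearMap.ker (fderiv ℂ (Hfun i) X).toLinearMap

/-- The quotient by `E_X`. The tangent space of `Ñ` at the class of `X ∈ S̃` is the image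
of `T_X S̃` in it. -/
abbrev TRed {g : ℕ} (X : MA g) := MA g ⧸ Submodule.span ℂ {genD X}

/-- The class of a vector modulo `E_X`. -/
def cls {g : ℕ} (X : MA g) (v : MA g) : TRed X := Submodule.Quotient.mk v

theorem pair_add_left {g : ℕ} (W W' V : MA g) : pair (W + W') V = pair W V + pair W' V := by
  simp only [pair, ← Finset.sum_add_distrib]
  refine Finset.sum_congr rfl fun i _ => ?_
  simp [slMat, Matrix.trace_fin_two, Matrix.mul_apply, Fin.sum_univ_two]; ring

theorem pair_smul_left {g : ℕ} (c : ℂ) (W V : MA g) : pair (c • W) V = c * pair W V := by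
  simp only [pair, Finset.mul_sum]
  refine Finset.sum_congr rfl fun i _ => ?_
  simp [slMat, Matrix.trace_fin_two, Matrix.mul_apply, Fin.sum_univ_two]; ring

theorem slMat_add (x y : Fin 3 → ℂ) : slMat (x + y) = slMat x + slMat y := by
  ext a b; fin_cases a <;> fin_cases b <;> simp [slMat]; ring

theorem slMat_smul (c : ℂ) (x : Fin 3 → ℂ) : slMat (c • x) = c • slMat x := by
  ext a b; fin_cases a <;> fin_cases b <;> simp [slMat]

theorem slCoord_add (x y : Matrix (Fin 2) (Fin 2) ℂ) :
    slCoord (x + y) = slCoord x + slCoord y := by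
  ext i; fin_cases i <;> simp [slCoord]

theorem slCoord_smul (c : ℂ) (x : Matrix (Fin 2) (Fin 2) ℂ) :
    slCoord (c • x) = c • slCoord x := by
  ext i; fin_cases i <;> simp [slCoord]

/-- The covectors that annihilate `E_X`; on `T_X S̃` they restrict to the differentials of
functions on `Ñ`. -/
def annih {g : ℕ} (X : MA g) : Submodule ℂ (MA g) where
  carrier := {W | pair W (genD X) = 0}
  add_mem' := by
    intro W W' h h'
    simp only [Set.mem_ofPred_eq] at *
    rw [pair_add_left, h, h', add_zero]
  zero_mem' := by simp [pair, slMat, Matrix.trace_fin_two]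
  smul_mem' := by
    intro c W h
    simp only [Set.mem_ofPred_eq] at *
    rw [pair_smul_left, h, mul_zero]

/-- `P_0` at `X` as a linear map. -/
def P0Lin {g : ℕ} (X : MA g) : MA g →ₗ[ℂ] MA g where
  toFun := P0 X
  map_add' := by
    intro W W'
    funext i
    simp only [P0, Pi.add_apply, slMat_add, Ring.lie_def, mul_add, add_mul, add_sub_add_comm,
      Finset.sum_add_distrib, slCoord_add]
  map_smul' := by
    intro c W
    funext i
    simp only [P0, Pi.smul_apply, slMat_smul, Ring.lie_def, mul_smul_comm, smul_mul_assoc,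
      ← smul_sub, ← Finset.smul_sum, slCoord_smul, RingHom.id_apply]

/-- The tangent space at the class of `X` to the symplectic leaf of the reduction of `P_0`:
the values of the Hamiltonian vector fields on `Ñ`. -/
def leafT {g : ℕ} (X : MA g) : Submodule ℂ (TRed X) :=
  ((annih X).map (P0Lin X)).map (Submodule.mkQ _)

/-- The Hamiltonian vector `P_0 W`, as a tangent vector to the symplectic leaf of the reduction
of `P_0`. -/
def ham {g : ℕ} (X : MA g) (W : annih X) : leafT X :=
  ⟨cls X (P0 X W), Submodule.mem_map_of_mem (Submodule.mem_map_of_mem (f := P0Lin X) W.2)⟩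

/-- `ω` is the symplectic form of the leaf, `ω(X_f, X_k) = {f, k}_0` with `X_f = P_0 df`. -/
def IsLeafForm {g : ℕ} (X : MA g) (ω : LinearMap.BilinForm ℂ (leafT X)) : Prop :=
  ∀ W W' : annih X, ω (ham X W) (ham X W') = pair W.1 (P0 X W'.1)

/-- `N` is the Nijenhuis tensor of the leaf, `ω(X_f, N X_k) = {f, k}_1` for `f, k` invariant
along `Z`. -/
def IsNijenhuis {g : ℕ} (X : MA g) (ω : LinearMap.BilinForm ℂ (leafT X))
    (N : Module.End ℂ (leafT X)) : Prop :=
  ∀ W W' : annih X, pair W.1 (zVec g) = 0 → pair W'.1 (zVec g) = 0 →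
    ω (ham X W) (N (ham X W')) = pair W.1 (P1 X W'.1)

/-- The differential at the class of `X` of a function on `Ñ`, restricted to the tangent space of
the symplectic leaf, computed from a prolongation `F`. -/
def dLeaf {g : ℕ} {f : Ntil g → ℂ} {X : Stil g} {F : MA g → ℂ} (hF : IsProlong f X F) :
    leafT (X : MA g) →ₗ[ℂ] ℂ :=
  ((Submodule.span ℂ {genD (X : MA g)}).liftQ (fderiv ℂ F (X : MA g)).toLinearMap (by
    rw [Submodule.span_le, Set.singleton_subset_iff]
    exact hF.1.self_of_nhds.2)).comp (leafT (X : MA g)).subtype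

/-! ### Darboux–Nijenhuis coordinates and separability -/

/-- The local functions `(x_1, …, x_g, y_1, …, y_g)` are Darboux–Nijenhuis at the class of `X`, on
the symplectic leaf through it: `ω` is canonical, `N^* dx_j = x_j dx_j`, `N^* dy_j = x_j dy_j`.
With `{f, k} = ⟨df, P dk⟩` and `ω(X_f, X_k) = {f, k}_0`, the canonical form in which
`P_0 dx_j = ∂/∂y_j` is `ω = ∑_j dy_j ∧ dx_j`. -/
def IsDarbouxNijenhuisAt {g : ℕ} (x y : Fin g → Ntil g → ℂ) (X : Stil g) : Prop :=
  ∀ (F G : Fin g → MA g → ℂ) (hF : ∀ j, IsProlong (x j) X (F j))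
    (hG : ∀ j, IsProlong (y j) X (G j)) (ω : LinearMap.BilinForm ℂ (leafT (X : MA g)))
    (N : Module.End ℂ (leafT (X : MA g))),
    IsLeafForm (X : MA g) ω → IsNijenhuis (X : MA g) ω N →
      (∀ u v, ω u v = ∑ j, (dLeaf (hG j) u * dLeaf (hF j) v - dLeaf (hF j) u * dLeaf (hG j) v)) ∧
      (∀ j u, dLeaf (hF j) (N u) = x j (proj X) * dLeaf (hF j) u) ∧
      (∀ j u, dLeaf (hG j) (N u) = x j (proj X) * dLeaf (hG j) u)

/-- `(x_1, …, x_g, y_1, …, y_g, H_g)` is a system of holomorphic coordinates of `Ñ` on the open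
set `W`; thus the `x_j, y_j` are coordinates on the level surfaces of `H_g` in `W`. -/
def IsCoordSystem {g : ℕ} (x y : Fin g → Ntil g → ℂ) (W : Set (Ntil g)) : Prop :=
  IsOpen W ∧ (∀ j, HolOn (x j) W) ∧ (∀ j, HolOn (y j) W) ∧
    Set.InjOn (fun n => ((fun j => x j n, fun j => y j n, HN g n) :
      (Fin g → ℂ) × (Fin g → ℂ) × ℂ)) W ∧
    IsOpen ((fun n => ((fun j => x j n, fun j => y j n, HN g n) :
      (Fin g → ℂ) × (Fin g → ℂ) × ℂ)) '' W) ∧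
    ∀ X : Stil g, proj X ∈ W → ∀ F G : Fin g → MA g → ℂ,
      (∀ j, IsProlong (x j) X (F j)) → (∀ j, IsProlong (y j) X (G j)) →
      ∀ v ∈ tanS (X : MA g), (∀ j, fderiv ℂ (F j) X v = 0) → (∀ j, fderiv ℂ (G j) X v = 0) →
        fderiv ℂ (Hfun g) (X : MA g) v = 0 → cls (X : MA g) v = 0

/-- The Hamilton–Jacobi equations of `H_0, …, H_{g-1}`, restricted to the level surface of `H_g`
through `n₀`, are collectively separable near `n₀` in the coordinates `(x_j, y_j)` on `W`: they have
a complete integral `S(ξ, α) = ∑_j S_j(ξ_j, α)`, that is, with `s_j = ∂S_j/∂ξ_j`,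
`H_i (ξ, s(ξ, α)) = α_i` for all `i`, with `det (∂s_j/∂α_i) ≠ 0`, passing through `n₀`. -/
def IsHJSeparableAt {g : ℕ} (x y : Fin g → Ntil g → ℂ) (W : Set (Ntil g)) (n₀ : Ntil g) : Prop :=
  ∃ (S s : Fin g → ℂ → (Fin g → ℂ) → ℂ) (O B : Set (Fin g → ℂ)),
    IsOpen O ∧ (fun j => x j n₀) ∈ O ∧ IsOpen B ∧ (fun i : Fin g => HN i n₀) ∈ B ∧
    (∀ j, s j (x j n₀) (fun i : Fin g => HN i n₀) = y j n₀) ∧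
    ∀ ξ ∈ O, ∀ α ∈ B,
      (∀ j, HasDerivAt (fun t => S j t α) (s j (ξ j) α) (ξ j)) ∧
      (∀ j, DifferentiableAt ℂ (s j (ξ j)) α) ∧
      (Matrix.of fun j i : Fin g => fderiv ℂ (s j (ξ j)) α (Pi.single i 1)).det ≠ 0 ∧
      ∃ n ∈ W, HN g n = HN g n₀ ∧
        ∀ j : Fin g, x j n = ξ j ∧ y j n = s j (ξ j) α ∧ HN j n = α j

/-! ### The Lax matrix as a point of `M_A` -/

/-- The coefficients of `V^(2g+1)(λ)`, as a point of `M_A`. -/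
def VMA (g : ℕ) (h : ℕ → ℂ) : MA g := fun i =>
  ![(VMat h (2 * g + 1) 0 0).coeff i, (VMat h (2 * g + 1) 1 0).coeff i,
    (VMat h (2 * g + 1) 0 1).coeff i]

end

end StationaryKdV

open StationaryKdV

/-!
The reduced manifold has a global chart, in which the theorem becomes a statement about polynomials.
Write `p`, `r`, `q` for the `(1,1)`, `(1,2)`, `(2,1)` entries of `X(λ)`, so that `H(λ) = p² + r q`.
On `S̃` the polynomial `r` is monic of degree `g`, and the flow of `E` is the conjugation by
`exp (t A)`, which changes `p` by `- t r`. Each leaf thus has one point with `deg p < g`, and there the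
equations of `S̃` say that `q` is the quotient of `λ^(2g+1) + H_g λ^g - p²` by `r`. Hence the
coefficients of `r` and `p` and the value of `H_g` are coordinates on `Ñ` (`chartN`, with the section
`secS`), and a local function has a prolongation exactly when it is holomorphic in this chart
(`isProlong_hat`, `IsProlong.hat_differentiableAt`).

**Reduction.** The conjugation by `exp (t A)` preserves the pencil, and `P_0`, `P_1` map covectors
that annihilate `E` to vectors tangent to `S̃` (`P0_mem_tanS`, `P1_mem_tanS`); so the brackets do not
depend on the prolongations (`brk_congr`, `redBracket_proj`). The vector
field `Z` is the translation along the coordinate `H_g`, and the pencil is invariant under it on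
covectors that vanish on `Z` (`brk_add_zVec`). The kernel of `P_0` is spanned by the `dH_i` with
`i ≥ g + 1` (`ker_P0`), which gives the leaves, the form `ω` and the tensor `N` by linear algebra
(`leafT_eq`, `existsUnique_leafForm`, `existsUnique_nijenhuis`).

**The phase space.** A zero of the `(2g+1)`-st vector field satisfies `r h² + 2 p h = q` with the
entries of `V^(2g+1)` (`riccati_of_mem`). Conversely, for given polynomials with the right determinant
this Riccati equation determines the `h_l` one after the other, and its solution is a zero of the
vector field with the given Lax matrix (`mem_of_riccati`); so `Φ` is the inverse of a map given by
holomorphic functions in both directions (`phaseChart`). The flows satisfy the Lax equation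
(`lax_equation`), since a series `P(z²) + Q(z²) h = O(z⁻¹)` vanishes (`ev_add_ev_mul_unique`), and the
truncation of `λ^(-m-1) V^(2g+1)` to its polynomial part is `V^(2i+1)` with `i = g - 1 - m`, up to a
multiple of `A`. This is the form of `P_0 dH_m = P_1 dH_{m+1}` modulo `E` (`P0_grad_Hfun`,
`P1_grad_Hfun`, `hasDerivAt_VMA`).

**Separation.** The simple roots `λ_j` of `r` are local holomorphic functions of its coefficients
(`exists_roots_section`). With `μ_j = - p(λ_j)`, the differentials `dλ_j` and `dμ_j` are combinations
of the covectors `covR` and `covP` that evaluate `δr` and `δp` at `λ_j`, and a root of `r` makes the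
brackets of these covectors for `P_1` equal to `λ_j` times those for `P_0` (`brk_covR_covP`): the
coordinates are canonical, and the `dλ_j`, `dμ_j` are eigenvectors of `N*`. They span, so the minimal
polynomial of `N` is `r` (`minpoly_nijenhuis`). Evaluating `H(λ) = p² + r q` at a root gives the
Stäckel relations (`stackel`); solving them for `μ_j` by a branch of the square root gives the
separated complete integral, which is nondegenerate because of a Vandermonde determinant
(`isHJSeparableAt`).
-/

namespace StationaryKdV

noncomputable section

/-! ### Laurent series in `z⁻¹` -/

/-- The Laurent series `S` contains only powers `z ^ (-n)` with `n ≥ N`: the coefficient of index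
`n` is that of `z ^ (-n)`. -/
def LB (N : ℤ) (S : LaurentSeries ℂ) : Prop := ∀ n < N, S.coeff n = 0

theorem LB.mono {N M : ℤ} {S : LaurentSeries ℂ} (h : LB N S) (hM : M ≤ N) : LB M S :=
  fun n hn => h n (hn.trans_le hM)

theorem LB.add {N : ℤ} {S T : LaurentSeries ℂ} (hS : LB N S) (hT : LB N T) : LB N (S + T) :=
  fun n hn => by simp [hS n hn, hT n hn]

theorem LB.neg {N : ℤ} {S : LaurentSeries ℂ} (hS : LB N S) : LB N (-S) :=
  fun n hn => by simp [hS n hn]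

theorem LB.sub {N : ℤ} {S T : LaurentSeries ℂ} (hS : LB N S) (hT : LB N T) : LB N (S - T) :=
  fun n hn => by simp [hS n hn, hT n hn]

/-- The coefficients of a product as sums over an interval that depends only on lower bounds for
the two factors. -/
theorem coeff_mul_of_LB {N M : ℤ} {S T : LaurentSeries ℂ} (hS : LB N S) (hT : LB M T) (n : ℤ) :
    (S * T).coeff n = ∑ i ∈ Finset.Icc N (n - M), S.coeff i * T.coeff (n - i) := by
  rw [HahnSeries.coeff_mul]
  have : ∀ ij ∈ Finset.antidiagonal S.isPWO_support T.isPWO_support n,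
      S.coeff ij.1 * T.coeff ij.2 = (fun i => S.coeff i * T.coeff (n - i)) ij.1 := by
    intro ij h
    have := (Finset.mem_antidiagonal.1 h).2.2
    simp only; rw [← this]; simp
  rw [Finset.sum_congr rfl this]
  have hinj : Set.InjOn Prod.fst
      (Finset.antidiagonal S.isPWO_support T.isPWO_support n : Set (ℤ × ℤ)) := by
    intro a ha b hb hab
    have h1 := (Finset.mem_antidiagonal.1 (Finset.mem_coe.1 ha)).2.2
    have h2 := (Finset.mem_antidiagonal.1 (Finset.mem_coe.1 hb)).2.2
    ext
    · exact hab
    · omega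
  rw [← Finset.sum_image (f := fun i => S.coeff i * T.coeff (n - i)) (g := Prod.fst) hinj]
  refine Finset.sum_subset ?_ ?_
  · intro i hi
    obtain ⟨a, ha, rfl⟩ := Finset.mem_image.1 hi
    obtain ⟨h1, h2, h3⟩ := Finset.mem_antidiagonal.1 ha
    have h4 : N ≤ a.1 := not_lt.1 fun h => h1 (hS _ h)
    have h5 : M ≤ a.2 := not_lt.1 fun h => h2 (hT _ h)
    rw [Finset.mem_Icc]; omega
  · intro i _ hi
    by_contra h
    refine hi (Finset.mem_image.2 ⟨(i, n - i), Finset.mem_antidiagonal.2 ⟨?_, ?_, by simp⟩, rfl⟩)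
    · exact left_ne_zero_of_mul h
    · exact right_ne_zero_of_mul h

theorem LB.mul {N M : ℤ} {S T : LaurentSeries ℂ} (hS : LB N S) (hT : LB M T) :
    LB (N + M) (S * T) := fun n hn => by
  rw [coeff_mul_of_LB hS hT, Finset.Icc_eq_empty (by omega), Finset.sum_empty]

/-- The leading coefficient of a product. -/
theorem coeff_mul_lead {N M : ℤ} {S T : LaurentSeries ℂ} (hS : LB N S) (hT : LB M T) :
    (S * T).coeff (N + M) = S.coeff N * T.coeff M := by
  rw [coeff_mul_of_LB hS hT]; simp

theorem coeff_zSq_mul (S : LaurentSeries ℂ) (n : ℤ) : (zSq * S).coeff n = S.coeff (n + 2) := by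
  rw [zSq, HahnSeries.coeff_single_mul]; simp

theorem coeff_C_mul (c : ℂ) (S : LaurentSeries ℂ) (n : ℤ) :
    (HahnSeries.C c * S).coeff n = c * S.coeff n := by
  rw [HahnSeries.C_apply, HahnSeries.coeff_single_zero_mul]

theorem coeff_C (c : ℂ) (n : ℤ) :
    (HahnSeries.C c : LaurentSeries ℂ).coeff n = if n = 0 then c else 0 := by
  rw [HahnSeries.C_apply, HahnSeries.coeff_single]; split_ifs <;> rfl

theorem coeff_hSeries (h : ℕ → ℂ) (n : ℤ) :
    (hSeries h).coeff n = if n = -1 then 1 else if 1 ≤ n then h (n.toNat - 1) else 0 := by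
  rw [hSeries, HahnSeries.coeff_add, HahnSeries.coeff_single, HahnSeries.coeff_single_mul, one_mul]
  by_cases h2 : 1 ≤ n
  · obtain ⟨m, rfl⟩ : ∃ m : ℕ, n = m + 1 := ⟨n.toNat - 1, by omega⟩
    rw [if_neg (by omega), if_neg (by omega), if_pos (by omega)]
    simp
  · have : ((HahnSeries.ofPowerSeries ℤ ℂ) (PowerSeries.mk h)).coeff (n - 1) = 0 := by
      rw [HahnSeries.ofPowerSeries_apply, HahnSeries.embDomain_of_notMem_range]
      rintro ⟨m, hm⟩
      simp at hm
      omega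
    rw [this, if_neg h2, add_zero]
    split_ifs <;> rfl

/-- The polynomial `P(z²)` as a Laurent series. -/
abbrev ev (P : ℂ[X]) : LaurentSeries ℂ := Polynomial.eval₂ HahnSeries.C zSq P

theorem coeff_ev (P : ℂ[X]) (n : ℤ) :
    (ev P).coeff n = if n ≤ 0 ∧ Even n then P.coeff (-n / 2).toNat else 0 := by
  induction P using Polynomial.induction_on' generalizing n with
  | add p q hp hq =>
    rw [ev, Polynomial.eval₂_add, HahnSeries.coeff_add, hp, hq]; split_ifs <;> simp
  | monomial k a =>
    rw [ev, Polynomial.eval₂_monomial, coeff_C_mul, zSq, HahnSeries.single_pow,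
      HahnSeries.coeff_single,
      Polynomial.coeff_monomial]
    simp only [one_pow, mul_ite, mul_one, mul_zero, nsmul_eq_mul]
    have : (n = k * (-2)) ↔ (n ≤ 0 ∧ Even n) ∧ k = (-n / 2).toNat := by
      rw [Int.even_iff]; omega
    simp only [this, ite_and]

theorem coeff_ev_neg (P : ℂ[X]) (k : ℕ) : (ev P).coeff (-(2 * k : ℤ)) = P.coeff k := by
  rw [coeff_ev, if_pos ⟨by omega, ⟨-k, by ring⟩⟩]; congr 1; omega

theorem coeff_ev_odd (P : ℂ[X]) {n : ℤ} (hn : n % 2 = 1) : (ev P).coeff n = 0 := by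
  rw [coeff_ev, if_neg]; rw [Int.even_iff]; omega

theorem LB_ev {P : ℂ[X]} {d : ℕ} (hd : P.natDegree ≤ d) : LB (-(2 * d : ℤ)) (ev P) := fun n hn => by
  rw [coeff_ev]; split_ifs with h
  · have := Int.even_iff.1 h.2
    exact Polynomial.coeff_eq_zero_of_natDegree_lt (by omega)
  · rfl

theorem ev_eq_zero_of_LB {P : ℂ[X]} (h : LB 1 (ev P)) : P = 0 := by
  ext k; rw [← coeff_ev_neg, h _ (by omega)]; simp

theorem LB_hSeries (h : ℕ → ℂ) : LB (-1) (hSeries h) := fun n hn => by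
  rw [coeff_hSeries, if_neg (by omega), if_neg (by omega)]

/-- A series `P(z²) + Q(z²) h` without non-negative powers of `z` vanishes: the leading term of
`Q(z²) h` is odd. -/
theorem ev_add_ev_mul_unique (h : ℕ → ℂ) {P Q : ℂ[X]} (hL : LB 1 (ev P + ev Q * hSeries h)) :
    P = 0 ∧ Q = 0 := by
  have hQ : Q = 0 := by
    by_contra hQ
    have h1 := hL (-(2 * Q.natDegree : ℤ) + -1) (by omega)
    rw [HahnSeries.coeff_add, coeff_mul_lead (LB_ev le_rfl) (LB_hSeries h),
      coeff_ev_odd _ (by omega),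
      coeff_ev_neg, coeff_hSeries] at h1
    simp at h1
    exact hQ h1
  subst hQ
  refine ⟨ev_eq_zero_of_LB ?_, rfl⟩
  simpa [ev] using hL

theorem LB.of_mul {N M : ℤ} {S T : LaurentSeries ℂ} (hST : LB (N + M) (S * T)) (hT : LB M T)
    (hM : T.coeff M ≠ 0) : LB N S := by
  by_cases hS : S = 0
  · intro n _; simp [hS]
  have h1 : LB S.order S := fun n hn => HahnSeries.coeff_eq_zero_of_lt_order hn
  refine h1.mono (not_lt.1 fun h => ?_)
  have h2 := hST (S.order + M) (by omega)
  rw [coeff_mul_lead h1 hT] at h2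
  exact mul_ne_zero (HahnSeries.coeff_order_eq_zero.not.2 hS) hM h2

/-! ### The series of the hierarchy -/

/-- `H^(k) = z^k + O(z⁻¹)`. -/
theorem coeff_HSer (h : ℕ → ℂ) (k : ℕ) {n : ℤ} (hn : n < 1) :
    (HSer h k).coeff n = if n = -k then 1 else 0 := by
  induction k using Nat.twoStepInduction generalizing n with
  | zero => simp only [HSer, HahnSeries.coeff_one]; simp
  | one =>
    simp only [HSer, coeff_hSeries]
    rw [if_neg (show ¬ 1 ≤ n by omega)]; simp
  | more k ih _ =>
    simp only [HSer, HahnSeries.coeff_sub, coeff_zSq_mul, coeff_C_mul, coeff_C, coeff_hSeries]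
    rw [if_neg (show ¬ 1 ≤ n by omega)]
    obtain h | h | h : n = 0 ∨ n = -1 ∨ n < -1 := by omega
    · subst h
      rw [if_neg (by omega : ¬ (0 : ℤ) = -1),
        if_neg (by push_cast; omega : ¬ (0 : ℤ) = -(k + 2 : ℕ))]
      simp
    · subst h
      rw [if_neg (by push_cast; omega : ¬ (-1 : ℤ) = -(k + 2 : ℕ))]
      simp
    · rw [ih (by omega), if_neg (by omega : ¬ n = -1), if_neg (by omega : ¬ n = 0)]
      simp only [mul_zero, sub_zero]
      congr 1
      simp only [eq_iff_iff]; push_cast; omega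

theorem LB_HSer_sub (h : ℕ → ℂ) (k : ℕ) : LB 1 (HSer h k - HahnSeries.single (-k : ℤ) 1) :=
  fun n hn => by
    rw [HahnSeries.coeff_sub, coeff_HSer h k hn, HahnSeries.coeff_single]
    split_ifs <;> simp

theorem LB_HSer (h : ℕ → ℂ) (k : ℕ) : LB (-k) (HSer h k) := fun n hn => by
  rw [coeff_HSer h k (by omega), if_neg (by omega)]

/-- The polynomial part of `h H^(j)`. -/
theorem coeff_hSeries_mul_HSer (h : ℕ → ℂ) (j : ℕ) {n : ℤ} (hn : n < 1) :
    (hSeries h * HSer h j).coeff n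
      = (hSeries h).coeff (n + j) + if n = 0 then (HSer h j).coeff 1 else 0 := by
  have h1 : HSer h j = HahnSeries.single (-j : ℤ) 1
    + (HSer h j - HahnSeries.single (-j : ℤ) 1) := by
    ring
  conv_lhs => rw [h1]
  rw [mul_add, HahnSeries.coeff_add, HahnSeries.coeff_mul_single, mul_one, sub_neg_eq_add]
  congr 1
  split_ifs with h0
  · subst h0
    rw [show (0 : ℤ) = -1 + 1 by norm_num, coeff_mul_lead (LB_hSeries h) (LB_HSer_sub h j),
      coeff_hSeries,
      HahnSeries.coeff_sub, HahnSeries.coeff_single]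
    rw [if_neg (show ¬ (1 : ℤ) = -j by omega)]; simp
  · exact (LB_hSeries h).mul (LB_HSer_sub h j) n (by omega)

/-- The right-hand sides of the hierarchy are series in `z⁻¹` without constant term. -/
theorem LB_cs2Series (h : ℕ → ℂ) (j : ℕ) : LB 1 (cs2Series h j) := fun n hn => by
  simp only [cs2Series, HahnSeries.coeff_add, HahnSeries.coeff_neg, HahnSeries.coeff_sum,
    coeff_C_mul,
    coeff_C, coeff_hSeries_mul_HSer h j hn, coeff_HSer h _ hn, coeff_hSeries]
  have : ∑ x ∈ Finset.range j, h x * (if n = -((j - (x + 1) : ℕ) : ℤ) then 1 else 0)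
      = if 1 ≤ n + j then h ((n + j).toNat - 1) else 0 := by
    split_ifs with h1
    · rw [Finset.sum_eq_single ((n + j).toNat - 1)]
      · rw [if_pos (by omega), mul_one]
      · intro b hb hne
        rw [Finset.mem_range] at hb
        rw [if_neg (by omega), mul_zero]
      · intro hb
        rw [Finset.mem_range] at hb
        omega
    · refine Finset.sum_eq_zero fun x hx => ?_
      rw [Finset.mem_range] at hx
      rw [if_neg (by omega), mul_zero]
  rw [this]
  have e : (n = -((j + 1 : ℕ) : ℤ)) ↔ (n + j = -1) := by push_cast; omega
  simp only [e]
  split_ifs <;> first | omega | simp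

theorem HSer_even (h : ℕ → ℂ) (k : ℕ) : HSer h (2 * k) = HahnSeries.single (-(2 * k : ℤ)) 1 := by
  induction k with
  | zero => simp [HSer]
  | succ k ih =>
    rw [show 2 * (k + 1) = 2 * k + 2 by ring, HSer, ih, HahnSeries.coeff_single_of_ne (by omega),
      HahnSeries.coeff_single_of_ne (by omega), zSq, HahnSeries.single_mul_single]
    simp; ring_nf

theorem pPoly_even (h : ℕ → ℂ) (k : ℕ) : pPoly h (2 * k) = Polynomial.X ^ k := by
  induction k with
  | zero => simp [pPoly]
  | succ k ih =>
    rw [show 2 * (k + 1) = 2 * k + 2 by ring, pPoly, ih, HSer_even,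
      HahnSeries.coeff_single_of_ne (by omega)]
    simp [pow_succ']

theorem coeff_X_mul_sub_C (P : ℂ[X]) (c : ℂ) (k : ℕ) :
    (Polynomial.X * P - Polynomial.C c).coeff (k + 1) = P.coeff k := by
  rw [Polynomial.coeff_sub, Polynomial.coeff_X_mul, Polynomial.coeff_C_succ, sub_zero]

theorem coeff_qPoly_odd (h : ℕ → ℂ) (k m : ℕ) (hm : k ≤ m) :
    (qPoly h (2 * k + 1)).coeff m = if m = k then 1 else 0 := by
  induction k generalizing m with
  | zero => simp [qPoly, Polynomial.coeff_one]
  | succ k ih =>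
    obtain ⟨m, rfl⟩ : ∃ m', m = m' + 1 := ⟨m - 1, by omega⟩
    rw [show 2 * (k + 1) + 1 = 2 * k + 1 + 2 by ring, qPoly, coeff_X_mul_sub_C, ih m (by omega)]
    simp

theorem coeff_pPoly_odd (h : ℕ → ℂ) (k m : ℕ) (hm : k ≤ m) :
    (pPoly h (2 * k + 1)).coeff m = 0 := by
  induction k generalizing m with
  | zero => simp [pPoly]
  | succ k ih =>
    obtain ⟨m, rfl⟩ : ∃ m', m = m' + 1 := ⟨m - 1, by omega⟩
    rw [show 2 * (k + 1) + 1 = 2 * k + 1 + 2 by ring, pPoly, coeff_X_mul_sub_C, ih m (by omega)]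

theorem coeff_pPoly (h : ℕ → ℂ) (k m : ℕ) (hm : k < 2 * m) : (pPoly h k).coeff m = 0 := by
  obtain ⟨j, rfl | rfl⟩ : ∃ j, k = 2 * j ∨ k = 2 * j + 1 := ⟨k / 2, by omega⟩
  · rw [pPoly_even, Polynomial.coeff_X_pow, if_neg (by omega)]
  · exact coeff_pPoly_odd h j m (by omega)

theorem VMat_00 (h : ℕ → ℂ) (j : ℕ) : VMat h j 0 0 = pPoly h j := rfl
theorem VMat_01 (h : ℕ → ℂ) (j : ℕ) : VMat h j 0 1 = qPoly h j := rfl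
theorem VMat_10 (h : ℕ → ℂ) (j : ℕ) : VMat h j 1 0 =
  pPoly h (j + 1) + ∑ l ∈ Finset.range j, Polynomial.C (h l) * pPoly h (j - (l + 1))
        + Polynomial.C ((HSer h j).coeff 1) := rfl

theorem coeff_VMat_10 (h : ℕ → ℂ) (g m : ℕ) (hm : g + 1 ≤ m) :
    (VMat h (2 * g + 1) 1 0).coeff m = if m = g + 1 then 1 else 0 := by
  rw [VMat_10, Polynomial.coeff_add, Polynomial.coeff_add, Polynomial.coeff_C_of_ne_zero (by omega),
    show 2 * g + 1 + 1 = 2 * (g + 1) by ring, pPoly_even, Polynomial.coeff_X_pow,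
    Polynomial.finsetSum_coeff, Finset.sum_eq_zero, add_zero, add_zero]
  intro l _
  rw [Polynomial.coeff_C_mul, coeff_pPoly _ _ _ (by omega), mul_zero]

theorem natDegree_qPoly_odd (h : ℕ → ℂ) (k : ℕ) : (qPoly h (2 * k + 1)).natDegree ≤ k :=
  Polynomial.natDegree_le_iff_coeff_eq_zero.2 fun m hm => by
    rw [coeff_qPoly_odd h k m (by omega), if_neg (by omega)]

/-- The square of `H^(j)` satisfies the characteristic equation of `V^(j)`, up to a correction that
vanishes on the zeroes of the `j`-th vector field. -/
theorem HSer_sq (h : ℕ → ℂ) (j : ℕ) :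
    HSer h j * HSer h j = ev (VMat h j 0 0 + VMat h j 1 1) * HSer h j
      + ev (VMat h j 0 1 * VMat h j 1 0 - VMat h j 1 1 * VMat h j 0 0)
      - ev (VMat h j 0 1) * cs2Series h j := by
  have h1 := HSer_eq h j
  have h2 := VMat_spec h j
  rw [← VMat_00, ← VMat_01] at h1
  simp only [ev, Polynomial.eval₂_add, Polynomial.eval₂_sub, Polynomial.eval₂_mul]
  linear_combination (HSer h j - Polynomial.eval₂ HahnSeries.C zSq (VMat h j 1 1)) * h1
    + Polynomial.eval₂ HahnSeries.C zSq (VMat h j 0 1) * h2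

/-- `(H^(j))² = z^(2j) + O(z^(j-1))`. -/
theorem coeff_HSer_sq (h : ℕ → ℂ) (j : ℕ) {n : ℤ} (hn : n < 1 - j) :
    (HSer h j * HSer h j).coeff n = if n = -(2 * j : ℤ) then 1 else 0 := by
  have h1 := LB_HSer_sub h j
  set η := HSer h j - HahnSeries.single (-j : ℤ) 1
  have h2 : HSer h j = HahnSeries.single (-j : ℤ) 1 + η := by simp [η]
  have h3 : HSer h j * HSer h j = HahnSeries.single (-(2 * j) : ℤ) 1
      + HahnSeries.single (-j : ℤ) 1 * η + η * HSer h j := by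
    conv_lhs => rw [h2]
    rw [h2, show (-(2 * j) : ℤ) = -j + -j by ring,
      show (HahnSeries.single (-j + -j : ℤ) (1 : ℂ)) = HahnSeries.single (-j : ℤ) 1
        * HahnSeries.single (-j : ℤ) 1 by
        rw [HahnSeries.single_mul_single, one_mul]]
    ring
  rw [h3, HahnSeries.coeff_add, HahnSeries.coeff_add, HahnSeries.coeff_single,
    HahnSeries.coeff_single_mul,
    h1 _ (by omega), (h1.mul (LB_HSer h j)) n (by omega)]
  simp

/-- `V^(j)` is traceless for odd `j`. -/
theorem VMat_trace (h : ℕ → ℂ) (g : ℕ) :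
    VMat h (2 * g + 1) 1 1 = -VMat h (2 * g + 1) 0 0 := by
  rw [eq_neg_iff_add_eq_zero, add_comm]
  by_contra hP
  set P := VMat h (2 * g + 1) 0 0 + VMat h (2 * g + 1) 1 1 with hPdef
  have h1 := congrArg (fun S => HahnSeries.coeff S (-(2 * P.natDegree : ℤ) + -((2 * g + 1 : ℕ) : ℤ)))
    (HSer_sq h (2 * g + 1))
  simp only [HahnSeries.coeff_sub, HahnSeries.coeff_add] at h1
  rw [coeff_HSer_sq _ _ (by omega), ← hPdef, coeff_mul_lead (LB_ev le_rfl) (LB_HSer h _),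
    coeff_ev_neg,
    coeff_ev_odd _ (by omega), coeff_HSer _ _ (by omega), if_pos rfl, if_neg (by omega), VMat_01,
    ((LB_ev (natDegree_qPoly_odd h g)).mul (LB_cs2Series h _)) _ (by omega)] at h1
  simp at h1
  exact hP (Polynomial.leadingCoeff_eq_zero.1 h1.symm)

/-- On the zeroes of the `(2g+1)`-st vector field `H^(2g+1)` is the square root of `-det V^(2g+1)`.
-/
theorem HSer_sq_of_mem {g : ℕ} {h : ℕ → ℂ} (hh : h ∈ KdVPhase g) :
    HSer h (2 * g + 1) * HSer h (2 * g + 1) =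
      ev (pPoly h (2 * g + 1) ^ 2 + qPoly h (2 * g + 1) * VMat h (2 * g + 1) 1 0) := by
  have h0 : cs2Series h (2 * g + 1) = 0 := hh
  rw [HSer_sq, h0, VMat_trace, VMat_00, VMat_01]
  simp only [ev, Polynomial.eval₂_add, Polynomial.eval₂_sub, Polynomial.eval₂_mul,
    Polynomial.eval₂_neg,
    Polynomial.eval₂_pow]
  ring

theorem coeff_det_of_mem {g : ℕ} {h : ℕ → ℂ} (hh : h ∈ KdVPhase g) {k : ℕ} (hk : g < k) :
    (pPoly h (2 * g + 1) ^ 2 + qPoly h (2 * g + 1) * VMat h (2 * g + 1) 1 0).coeff k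
      = if k = 2 * g + 1 then 1 else 0 := by
  rw [← coeff_ev_neg, ← HSer_sq_of_mem hh, coeff_HSer_sq _ _ (by push_cast; omega)]
  congr 1
  simp only [eq_iff_iff]; push_cast; omega

/-- The Riccati equation satisfied by `h` on the phase space. -/
theorem riccati_of_mem {g : ℕ} {h : ℕ → ℂ} (hh : h ∈ KdVPhase g) :
    ev (qPoly h (2 * g + 1)) * hSeries h ^ 2 + 2 * ev (pPoly h (2 * g + 1)) * hSeries h
      = ev (VMat h (2 * g + 1) 1 0) := by
  have h0 : cs2Series h (2 * g + 1) = 0 := hh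
  have h1 := VMat_spec h (2 * g + 1)
  have h2 := HSer_eq h (2 * g + 1)
  rw [h0, VMat_trace, VMat_00, Polynomial.eval₂_neg] at h1
  simp only [ev]
  linear_combination h1 - h2 * hSeries h

/-- A solution `h` of a Riccati equation whose discriminant is `z^(2(2g+1)) + O(z^(2g))` is a point
of the phase space, and the coefficients of the equation are the entries of `V^(2g+1)`. -/
theorem mem_of_riccati {g : ℕ} {h : ℕ → ℂ} {p q r : ℂ[X]} (hr : r.natDegree ≤ g)
    (hr1 : r.coeff g = 1)
    (hp : p.natDegree ≤ g)
    (hd : ∀ k, g < k → (p ^ 2 + r * q).coeff k = if k = 2 * g + 1 then 1 else 0)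
    (hric : ev r * hSeries h ^ 2 + 2 * ev p * hSeries h = ev q) :
    h ∈ KdVPhase g ∧ pPoly h (2 * g + 1) = p ∧ qPoly h (2 * g + 1) = r
      ∧ VMat h (2 * g + 1) 1 0 = q := by
  -- `w` is a square root of the discriminant; it has the expansion of `H^(2g+1)`
  set w := ev p + ev r * hSeries h with hw
  have hw2 : w * w = ev (p ^ 2 + r * q) := by
    simp only [ev, Polynomial.eval₂_add, Polynomial.eval₂_mul, Polynomial.eval₂_pow] at *
    rw [hw]; linear_combination Polynomial.eval₂ HahnSeries.C zSq r * hric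
  set Z : LaurentSeries ℂ := HahnSeries.single (-(2 * g + 1) : ℤ) 1 with hZ
  have hwL : LB (-(2 * g + 1)) w := by
    refine ((LB_ev hp).mono (by omega)).add (((LB_ev hr).mul (LB_hSeries h)).mono (by omega))
  have hw1 : w.coeff (-(2 * g + 1)) = 1 := by
    rw [hw, HahnSeries.coeff_add, coeff_ev_odd _ (by omega),
      show (-(2 * g + 1) : ℤ) = -(2 * g) + -1 by ring, coeff_mul_lead (LB_ev hr) (LB_hSeries h),
      coeff_ev_neg, hr1, coeff_hSeries]
    simp
  have hZL : LB (-(2 * g + 1)) Z := fun n hn => by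
    rw [hZ, HahnSeries.coeff_single_of_ne (by omega)]
  -- `(w - Z) (w + Z) = w² - Z²` is `O(z^(2g))`, and `w + Z` has the leading term `2 z^(2g+1)`
  have hE : LB 1 (w - Z) := by
    refine LB.of_mul (M := -(2 * g + 1)) (T := w + Z) ?_ (hwL.add hZL) ?_
    · intro n hn
      rw [show (w - Z) * (w + Z) = w * w - Z * Z by ring, hw2, HahnSeries.coeff_sub, hZ,
        HahnSeries.single_mul_single, HahnSeries.coeff_single, coeff_ev]
      split_ifs with h1 h2 h2
      · rw [hd _ (by omega), if_pos (by omega)]; simp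
      · rw [hd _ (by have := Int.even_iff.1 h1.2; omega),
          if_neg (by have := Int.even_iff.1 h1.2; omega)]; simp
      · exfalso; apply h1; rw [Int.even_iff]; omega
      · simp
    · rw [HahnSeries.coeff_add, hw1, hZ, HahnSeries.coeff_single_same]; norm_num
  -- both `w` and `H^(2g+1)` are `z^(2g+1) + O(z⁻¹)`, so their coefficients agree
  have hu : LB 1 (ev (pPoly h (2 * g + 1) - p) + ev (qPoly h (2 * g + 1) - r) * hSeries h) := by
    have h1 := (LB_HSer_sub h (2 * g + 1)).sub hE
    rw [HSer_eq] at h1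
    convert h1 using 1
    simp only [ev, Polynomial.eval₂_sub, hw, hZ]; push_cast; ring
  obtain ⟨h1, h2⟩ := ev_add_ev_mul_unique h hu
  rw [sub_eq_zero] at h1 h2
  -- the vector field is a polynomial in `z²` and a series in `z⁻¹`, hence it vanishes
  have hc : cs2Series h (2 * g + 1) = ev (VMat h (2 * g + 1) 1 0 - q) := by
    have h3 := VMat_spec h (2 * g + 1)
    rw [VMat_trace, VMat_00, HSer_eq, h1, h2, Polynomial.eval₂_neg] at h3
    simp only [ev, Polynomial.eval₂_sub] at hric ⊢
    linear_combination h3 - hric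
  have h4 := ev_eq_zero_of_LB (hc ▸ LB_cs2Series h (2 * g + 1))
  refine ⟨?_, h1, h2, sub_eq_zero.1 h4⟩
  show cs2Series h (2 * g + 1) = 0
  rw [hc, h4]; simp [ev]

/-! ### Dependence on finitely many coordinates, and truncation in `λ` -/

theorem coeff_HSer_congr {h h' : ℕ → ℂ} {m : ℕ} (hh : ∀ i < m, h i = h' i) (k : ℕ) {l : ℤ}
    (hl : 1 ≤ l) (hkl : k + l ≤ m + 1) : (HSer h k).coeff l = (HSer h' k).coeff l := by
  induction k using Nat.twoStepInduction generalizing l with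
  | zero => simp [HSer]
  | one =>
    simp only [HSer, coeff_hSeries, if_pos hl]
    rw [hh _ (by omega)]
  | more k ih _ =>
    simp only [HSer, HahnSeries.coeff_sub, coeff_zSq_mul, coeff_C_mul, coeff_C,
      coeff_hSeries, if_pos hl]
    rw [ih (by omega) (by push_cast at hkl; omega), ih (by omega) (by push_cast at hkl; omega),
      ih (by omega) (by push_cast at hkl; omega), hh _ (by omega)]

theorem pPoly_congr {h h' : ℕ → ℂ} {m : ℕ} (hh : ∀ i < m, h i = h' i) (k : ℕ) (hk : k ≤ m + 1) :
    pPoly h k = pPoly h' k := by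
  induction k using Nat.twoStepInduction with
  | zero => rfl
  | one => rfl
  | more k ih _ => simp only [pPoly]; rw [ih (by omega),
    coeff_HSer_congr hh k (by omega) (by omega)]

theorem qPoly_congr {h h' : ℕ → ℂ} {m : ℕ} (hh : ∀ i < m, h i = h' i) (k : ℕ) (hk : k ≤ m + 1) :
    qPoly h k = qPoly h' k := by
  induction k using Nat.twoStepInduction with
  | zero => rfl
  | one => rfl
  | more k ih _ => simp only [qPoly]; rw [ih (by omega),
    coeff_HSer_congr hh k (by omega) (by omega)]

theorem VMA_congr {g : ℕ} {h h' : ℕ → ℂ} (hh : ∀ i < 2 * g + 1, h i = h' i) :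
    VMA g h = VMA g h' := by
  funext i
  simp only [VMA, VMat_00, VMat_01, VMat_10]
  rw [pPoly_congr hh _ (by omega), qPoly_congr hh _ (by omega), pPoly_congr hh _ (by omega),
    coeff_HSer_congr hh _ (by omega) (by push_cast; omega),
    Finset.sum_congr rfl fun l hl => by
      rw [hh l (Finset.mem_range.1 hl), pPoly_congr hh (2 * g + 1 - (l + 1)) (by omega)]]

theorem coeff_pPoly_add (h : ℕ → ℂ) (j n k : ℕ) :
    (pPoly h (j + 2 * n)).coeff (k + n) = (pPoly h j).coeff k := by
  induction n with
  | zero => rfl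
  | succ n ih =>
    rw [show j + 2 * (n + 1) = j + 2 * n + 2 by ring, pPoly, ← add_assoc, coeff_X_mul_sub_C, ih]

theorem coeff_qPoly_add (h : ℕ → ℂ) (j n k : ℕ) :
    (qPoly h (j + 2 * n)).coeff (k + n) = (qPoly h j).coeff k := by
  induction n with
  | zero => rfl
  | succ n ih =>
    rw [show j + 2 * (n + 1) = j + 2 * n + 2 by ring, qPoly, ← add_assoc, coeff_X_mul_sub_C, ih]

theorem coeff_VMat_10_succ (h : ℕ → ℂ) (j k : ℕ) :
    (VMat h (j + 2) 1 0).coeff (k + 1)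
      = (VMat h j 1 0).coeff k - if k = 0 then (HSer h j).coeff 1 else 0 := by
  have h1 : ∀ l ∈ Finset.range j, (Polynomial.C (h l) * pPoly h (j + 2 - (l + 1))).coeff (k + 1)
      = (Polynomial.C (h l) * pPoly h (j - (l + 1))).coeff k := by
    intro l hl
    rw [Finset.mem_range] at hl
    rw [show j + 2 - (l + 1) = j - (l + 1) + 2 by omega, pPoly, Polynomial.coeff_C_mul,
      coeff_X_mul_sub_C, Polynomial.coeff_C_mul]
  rw [VMat_10, VMat_10, Finset.sum_range_succ, Finset.sum_range_succ,
    show j + 2 + 1 = (j + 1) + 2 by ring,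
    pPoly]
  simp only [Polynomial.coeff_add, coeff_X_mul_sub_C, Polynomial.finsetSum_coeff,
    Polynomial.coeff_C_succ]
  rw [Finset.sum_congr rfl h1, show j + 2 - (j + 1) = 1 by omega,
    show j + 2 - (j + 1 + 1) = 0 by omega, pPoly, pPoly, Polynomial.coeff_C]
  simp

theorem coeff_VMat_10_add (h : ℕ → ℂ) (j n k : ℕ) :
    (VMat h (j + 2 * (n + 1)) 1 0).coeff (k + (n + 1))
      = (VMat h j 1 0).coeff k - if k = 0 then (HSer h j).coeff 1 else 0 := by
  induction n with
  | zero => exact coeff_VMat_10_succ h j k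
  | succ n ih =>
    rw [show j + 2 * (n + 1 + 1) = j + 2 * (n + 1) + 2 by ring, ← add_assoc k,
      coeff_VMat_10_succ, ih,
      if_neg (show ¬ k + (n + 1) = 0 by omega), sub_zero]

section Families
variable {E : Type*} [NormedAddCommGroup E] [NormedSpace ℂ E]

/-! ### Families of Laurent series with differentiable coefficients -/

/-- A family of Laurent series whose orders are bounded below uniformly and whose coefficients are
differentiable at `y₀`. -/
def CoeffDiffAt (F : E → LaurentSeries ℂ) (y₀ : E) : Prop :=
  (∃ N, ∀ y, LB N (F y)) ∧ ∀ n, DifferentiableAt ℂ (fun y => (F y).coeff n) y₀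

theorem CoeffDiffAt.add {F G : E → LaurentSeries ℂ} {y₀ : E} (hF : CoeffDiffAt F y₀)
    (hG : CoeffDiffAt G y₀) : CoeffDiffAt (fun y => F y + G y) y₀ := by
  obtain ⟨⟨N, hN⟩, hF⟩ := hF
  obtain ⟨⟨M, hM⟩, hG⟩ := hG
  exact ⟨⟨min N M, fun y => ((hN y).mono (min_le_left _ _)).add ((hM y).mono (min_le_right _ _))⟩,
    fun n => by
      simp only [HahnSeries.coeff_add]; exact (hF n).add (hG n)⟩

theorem CoeffDiffAt.neg {F : E → LaurentSeries ℂ} {y₀ : E} (hF : CoeffDiffAt F y₀) :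
    CoeffDiffAt (fun y => -F y) y₀ := by
  obtain ⟨⟨N, hN⟩, hF⟩ := hF
  exact ⟨⟨N, fun y => (hN y).neg⟩, fun n => by
      simp only [HahnSeries.coeff_neg]; exact (hF n).neg⟩

theorem CoeffDiffAt.mul {F G : E → LaurentSeries ℂ} {y₀ : E} (hF : CoeffDiffAt F y₀)
    (hG : CoeffDiffAt G y₀) : CoeffDiffAt (fun y => F y * G y) y₀ := by
  obtain ⟨⟨N, hN⟩, hF⟩ := hF
  obtain ⟨⟨M, hM⟩, hG⟩ := hG
  refine ⟨⟨N + M, fun y => (hN y).mul (hM y)⟩, fun n => ?_⟩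
  simp only [fun y => coeff_mul_of_LB (hN y) (hM y) n]
  exact DifferentiableAt.fun_sum fun i _ => (hF i).mul (hG _)

theorem CoeffDiffAt.ev {P : E → ℂ[X]} {y₀ : E} {d : ℕ} (hd : ∀ y, (P y).natDegree ≤ d)
    (hP : ∀ k, DifferentiableAt ℂ (fun y => (P y).coeff k) y₀) :
      CoeffDiffAt (fun y => ev (P y)) y₀ := by
  refine ⟨⟨_, fun y => LB_ev (hd y)⟩, fun n => ?_⟩
  simp only [coeff_ev]
  split_ifs
  · exact hP _
  · exact differentiableAt_const _

theorem CoeffDiffAt.hSeries {h : E → ℕ → ℂ} {y₀ : E}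
    (hh : ∀ i, DifferentiableAt ℂ (fun y => h y i) y₀) :
    CoeffDiffAt (fun y => hSeries (h y)) y₀ := by
  refine ⟨⟨_, fun y => LB_hSeries (h y)⟩, fun n => ?_⟩
  simp only [coeff_hSeries]
  split_ifs
  · exact differentiableAt_const _
  · exact hh _
  · exact differentiableAt_const _

theorem differentiableAt_coeff_HSer {h : E → ℕ → ℂ} {y₀ : E}
    (hh : ∀ i, DifferentiableAt ℂ (fun y => h y i) y₀) (k : ℕ) (n : ℤ) :
    DifferentiableAt ℂ (fun y => (HSer (h y) k).coeff n) y₀ := by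
  induction k using Nat.twoStepInduction generalizing n with
  | zero => simp [HSer]
  | one => exact (CoeffDiffAt.hSeries hh).2 n
  | more k ih _ =>
    simp only [HSer, HahnSeries.coeff_sub, coeff_zSq_mul, coeff_C_mul, coeff_C]
    refine ((ih _).sub ((ih _).mul ((CoeffDiffAt.hSeries hh).2 n))).sub ?_
    split_ifs
    · exact ih _
    · exact differentiableAt_const _

theorem differentiableAt_coeff_C {c : E → ℂ} {y₀ : E} (hc : DifferentiableAt ℂ c y₀) (n : ℕ) :
    DifferentiableAt ℂ (fun y => (Polynomial.C (c y)).coeff n) y₀ := by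
  simp only [Polynomial.coeff_C]
  split_ifs
  · exact hc
  · exact differentiableAt_const _

theorem differentiableAt_coeff_pPoly {h : E → ℕ → ℂ} {y₀ : E}
    (hh : ∀ i, DifferentiableAt ℂ (fun y => h y i) y₀) (k n : ℕ) :
    DifferentiableAt ℂ (fun y => (pPoly (h y) k).coeff n) y₀ := by
  induction k using Nat.twoStepInduction generalizing n with
  | zero => simp [pPoly]
  | one => simp [pPoly]
  | more k ih _ =>
    simp only [pPoly, Polynomial.coeff_sub]
    refine DifferentiableAt.sub ?_ (differentiableAt_coeff_C (differentiableAt_coeff_HSer hh _ _) _)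
    cases n with
    | zero => simp
    | succ n => simpa using ih n

theorem differentiableAt_coeff_qPoly {h : E → ℕ → ℂ} {y₀ : E}
    (hh : ∀ i, DifferentiableAt ℂ (fun y => h y i) y₀) (k n : ℕ) :
    DifferentiableAt ℂ (fun y => (qPoly (h y) k).coeff n) y₀ := by
  induction k using Nat.twoStepInduction generalizing n with
  | zero => simp [qPoly]
  | one => simp [qPoly]
  | more k ih _ =>
    simp only [qPoly, Polynomial.coeff_sub]
    refine DifferentiableAt.sub ?_ (differentiableAt_coeff_C (differentiableAt_coeff_HSer hh _ _) _)
    cases n with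
    | zero => simp
    | succ n => simpa using ih n

theorem differentiableAt_coeff_VMat_10 {h : E → ℕ → ℂ} {y₀ : E}
    (hh : ∀ i, DifferentiableAt ℂ (fun y => h y i) y₀) (k n : ℕ) :
    DifferentiableAt ℂ (fun y => (VMat (h y) k 1 0).coeff n) y₀ := by
  simp only [VMat_10, Polynomial.coeff_add, Polynomial.finsetSum_coeff, Polynomial.coeff_C_mul]
  exact ((differentiableAt_coeff_pPoly hh _ _).add
    (DifferentiableAt.fun_sum fun i _ => (hh i).mul (differentiableAt_coeff_pPoly hh _ _))).add
    (differentiableAt_coeff_C (differentiableAt_coeff_HSer hh _ _) _)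

theorem differentiableAt_VMA (g : ℕ) {h : E → ℕ → ℂ} {y₀ : E}
    (hh : ∀ i, DifferentiableAt ℂ (fun y => h y i) y₀) :
    DifferentiableAt ℂ (fun y => VMA g (h y)) y₀ := by
  rw [differentiableAt_pi]; intro i
  rw [differentiableAt_pi]; intro a
  fin_cases a
  · exact differentiableAt_coeff_pPoly hh _ _
  · exact differentiableAt_coeff_VMat_10 hh _ _
  · exact differentiableAt_coeff_qPoly hh _ _

theorem add_divByMonic' {a a' b : ℂ[X]} (hb : b.Monic) : (a + a') /ₘ b = a /ₘ b + a' /ₘ b :=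
  (Polynomial.div_modByMonic_unique (a /ₘ b + a' /ₘ b) (a %ₘ b + a' %ₘ b) hb ⟨by
    linear_combination Polynomial.modByMonic_add_div a b + Polynomial.modByMonic_add_div a' b,
    (Polynomial.degree_add_le _ _).trans_lt (max_lt (Polynomial.degree_modByMonic_lt _ hb)
      (Polynomial.degree_modByMonic_lt _ hb))⟩).1

/-- The coefficients of the quotient of a division by a monic polynomial depend differentiably on
the coefficients of the dividend and of the divisor. -/
theorem differentiableAt_coeff_divByMonic {a b : E → ℂ[X]} {y₀ : E} {g : ℕ} (N : ℕ)
    (ha : ∀ y, (a y).degree < N) (hb : ∀ y, (b y).Monic) (hbg : ∀ y, (b y).natDegree = g)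
    (hac : ∀ k, DifferentiableAt ℂ (fun y => (a y).coeff k) y₀)
    (hbc : ∀ k, DifferentiableAt ℂ (fun y => (b y).coeff k) y₀) (k : ℕ) :
    DifferentiableAt ℂ (fun y => (a y /ₘ b y).coeff k) y₀ := by
  induction N generalizing a with
  | zero =>
    have : ∀ y, a y = 0 := fun y => Polynomial.degree_eq_bot.1 (by
      have := ha y; rwa [Nat.cast_zero, Nat.WithBot.lt_zero_iff] at this)
    simp [this]
  | succ N ih =>
    by_cases hN : N < g
    · have : ∀ y, a y /ₘ b y = 0 := fun y => (Polynomial.divByMonic_eq_zero_iff (hb y)).2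
        ((ha y).trans_le (by
          rw [Polynomial.degree_eq_natDegree (hb y).ne_zero, hbg]; exact_mod_cast hN))
      simp [this]
    · rw [not_lt] at hN
      -- one step of the division algorithm
      set T : E → ℂ[X] := fun y => Polynomial.C ((a y).coeff N) * Polynomial.X ^ (N - g) with hT
      have hTc : ∀ k, DifferentiableAt ℂ (fun y => (T y).coeff k) y₀ := fun k => by
        simp only [hT, Polynomial.coeff_C_mul]
        exact (hac N).mul (differentiableAt_const _)
      have hTb : ∀ y k, (b y * T y).coeff k
          = (a y).coeff N * if N - g ≤ k then (b y).coeff (k - (N - g)) else 0 := fun y k => by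
        rw [hT]
        simp only
        rw [mul_left_comm, Polynomial.coeff_C_mul, Polynomial.coeff_mul_X_pow']
      have key : ∀ y, a y /ₘ b y = T y + (a y - b y * T y) /ₘ b y := fun y => by
        conv_lhs => rw [show a y = b y * T y + (a y - b y * T y) by ring]
        rw [add_divByMonic' (hb y), Polynomial.mul_divByMonic_cancel_left _ (hb y)]
      simp only [key, Polynomial.coeff_add]
      refine (hTc k).add (ih (fun y => ?_) (fun k => ?_))
      · rw [Polynomial.degree_lt_iff_coeff_zero]
        intro m hm
        have hm : N ≤ m := by exact_mod_cast hm
        rw [Polynomial.coeff_sub, hTb, if_pos (by omega)]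
        rcases hm.eq_or_lt with rfl | hm
        · have : (b y).coeff (N - (N - g)) = 1 := by
            rw [show N - (N - g) = g by omega, ← hbg y]; exact hb y
          rw [this]; ring
        · rw [(Polynomial.degree_lt_iff_coeff_zero _ _).1 (ha y) m (by exact_mod_cast hm),
            Polynomial.coeff_eq_zero_of_natDegree_lt (p := b y) (by rw [hbg y]; omega)]; ring
      · simp only [Polynomial.coeff_sub, hTb]
        refine (hac k).sub ((hac N).mul ?_)
        split_ifs
        · exact hbc _
        · exact differentiableAt_const _

/-! ### The Riccati equation -/

/-- The left-hand side of the Riccati equation `r h² + 2 p h - q = 0`. -/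
def riccati (p q r : ℂ[X]) (h : ℕ → ℂ) : LaurentSeries ℂ :=
  ev r * (hSeries h * hSeries h) + (ev p + ev p) * hSeries h + -ev q

/-- The coefficient of index `l - 2g` of the Riccati equation is `2 h_{l+1}` up to terms in the
previous coefficients of `h` (`h l` stands for `h_{l+1}`). -/
theorem coeff_riccati_trunc {g : ℕ} {p q r : ℂ[X]} (hr : r.natDegree ≤ g) (hr1 : r.coeff g = 1)
    (hp : ∀ k, g ≤ k → p.coeff k = 0) (h : ℕ → ℂ) (l : ℕ) :
    (riccati p q r h).coeff (l - 2 * g)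
      = 2 * h l + (riccati p q r (fun i => if i < l then h i else 0)).coeff (l - 2 * g) := by
  set h' : ℕ → ℂ := fun i => if i < l then h i else 0 with hh'
  set R := hSeries h - hSeries h' with hR
  have hRL : LB (l + 1) R := fun n hn => by
    rw [hR, HahnSeries.coeff_sub, coeff_hSeries, coeff_hSeries, hh']
    by_cases h1 : 1 ≤ n
    · simp only [if_pos h1, if_pos (show n.toNat - 1 < l by omega), sub_self]
    · simp only [if_neg h1, sub_self]
  have hRl : R.coeff (l + 1) = h l := by
    rw [hR, HahnSeries.coeff_sub, coeff_hSeries, coeff_hSeries, hh']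
    simp only [if_neg (show ¬ (l + 1 : ℤ) = -1 by omega), if_pos (show (1 : ℤ) ≤ l + 1 by omega),
      show ((l : ℤ) + 1).toNat - 1 = l by omega, lt_irrefl, if_false, sub_zero]
  have hpL : LB (-(2 * g) + 2) (ev p) := fun n hn => by
    rw [coeff_ev]; split_ifs with h
    · have := Int.even_iff.1 h.2
      exact hp _ (by omega)
    · rfl
  have hS : LB (-1) (hSeries h + hSeries h') := (LB_hSeries _).add (LB_hSeries _)
  have e : riccati p q r h = riccati p q r h' + ev r * (R * (hSeries h + hSeries h'))
      + (ev p + ev p) * R := by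
    rw [riccati, riccati, hR]; ring
  rw [e, HahnSeries.coeff_add, HahnSeries.coeff_add, ((hpL.add hpL).mul hRL) _ (by omega),
    show ((l : ℤ) - 2 * g) = -(2 * g) + ((l + 1) + -1) by ring,
    coeff_mul_lead (LB_ev hr) (hRL.mul hS), coeff_mul_lead hRL hS, hRl, coeff_ev_neg, hr1,
    HahnSeries.coeff_add, coeff_hSeries, coeff_hSeries]
  simp; ring

/-- The Riccati equation has no terms of order above `z^(2g)`: the leading terms of `r h²` and `q`
cancel, and neither `r h²` nor `q` has a term of degree `2g + 1`. -/
theorem coeff_riccati_low {g : ℕ} {p q r : ℂ[X]} (hr : r.natDegree ≤ g) (hr1 : r.coeff g = 1)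
    (hp : ∀ k, g ≤ k → p.coeff k = 0) (hq : ∀ k, g + 1 ≤ k → q.coeff k = if k = g + 1 then 1 else 0)
    (h : ℕ → ℂ) {n : ℤ} (hn : n < -(2 * g)) : (riccati p q r h).coeff n = 0 := by
  have hpL : LB (-(2 * g) + 2) (ev p) := fun n hn => by
    rw [coeff_ev]; split_ifs with h
    · have := Int.even_iff.1 h.2
      exact hp _ (by omega)
    · rfl
  have hS := LB_hSeries h
  rw [riccati, HahnSeries.coeff_add, HahnSeries.coeff_add,
    ((hpL.add hpL).mul hS) _ (by omega), add_zero,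
    HahnSeries.coeff_neg]
  have hSS := hS.mul hS
  by_cases h1 : n < -(2 * g) + (-1 + -1)
  · rw [((LB_ev hr).mul hSS) _ h1, coeff_ev]
    split_ifs with h2
    · have := Int.even_iff.1 h2.2
      rw [hq _ (by omega), if_neg (by omega)]; simp
    · simp
  by_cases h2 : n = -(2 * g) + (-1 + -1)
  · rw [h2, coeff_mul_lead (LB_ev hr) hSS, coeff_mul_lead hS hS, coeff_ev_neg, hr1, coeff_hSeries,
      show (-(2 * g) + (-1 + -1) : ℤ) = -(2 * (g + 1 : ℕ)) by push_cast; ring, coeff_ev_neg,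
        hq _ le_rfl]
    simp
  · obtain rfl : n = -(2 * g) - 1 := by omega
    rw [coeff_ev_odd q (by omega), coeff_mul_of_LB (LB_ev hr) hSS, neg_zero, add_zero]
    refine Finset.sum_eq_zero fun i hi => ?_
    rw [Finset.mem_Icc] at hi
    obtain rfl | rfl : i = -(2 * g) ∨ i = -(2 * g) + 1 := by omega
    · rw [coeff_mul_of_LB hS hS, Finset.sum_eq_zero, mul_zero]
      intro j hj
      rw [Finset.mem_Icc] at hj
      obtain rfl | rfl : j = -1 ∨ j = 0 := by omega
      · rw [show (-(2 * g) - 1 - -(2 * g) - -1 : ℤ) = 0 by ring, coeff_hSeries h 0]; simp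
      · rw [coeff_hSeries h 0]; simp
    · rw [coeff_ev_odd r (by omega), zero_mul]

/-- The coefficients of the solution of the Riccati equation, which determines them recursively. -/
def riccSol (g : ℕ) (p q r : ℂ[X]) (l : ℕ) : ℂ :=
  -(1 / 2) * (riccati p q r (fun i => if _hi : i < l then riccSol g p q r i else 0)).coeff (l - 2
    * g)
termination_by l

theorem riccati_riccSol {g : ℕ} {p q r : ℂ[X]} (hr : r.natDegree ≤ g) (hr1 : r.coeff g = 1)
    (hp : ∀ k, g ≤ k → p.coeff k = 0)
      (hq : ∀ k, g + 1 ≤ k → q.coeff k = if k = g + 1 then 1 else 0) :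
    riccati p q r (riccSol g p q r) = 0 := by
  ext n
  rw [HahnSeries.coeff_zero]
  by_cases hn : n < -(2 * g)
  · exact coeff_riccati_low hr hr1 hp hq _ hn
  · obtain ⟨l, rfl⟩ : ∃ l : ℕ, n = l - 2 * g := ⟨(n + 2 * g).toNat, by omega⟩
    rw [coeff_riccati_trunc hr hr1 hp, riccSol]
    simp only [dite_eq_ite]
    ring

theorem eq_riccSol {g : ℕ} {p q r : ℂ[X]} (hr : r.natDegree ≤ g) (hr1 : r.coeff g = 1)
    (hp : ∀ k, g ≤ k → p.coeff k = 0) {h : ℕ → ℂ} (hh : riccati p q r h = 0) :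
    h = riccSol g p q r := by
  funext l
  induction l using Nat.strong_induction_on with
  | _ l ih =>
    have h1 := coeff_riccati_trunc (q := q) hr hr1 hp h l
    rw [hh, HahnSeries.coeff_zero] at h1
    rw [riccSol]
    have : (fun i => if _hi : i < l then riccSol g p q r i else 0) = fun i =>
      if i < l then h i else 0 := by
      funext i
      split_ifs with hi
      · exact (ih i hi).symm
      · rfl
    rw [this]
    linear_combination (-1 / 2) * h1

theorem differentiableAt_riccSol {g d : ℕ} {p q r : E → ℂ[X]} {y₀ : E}
    (hpd : ∀ y, (p y).natDegree ≤ d) (hqd : ∀ y, (q y).natDegree ≤ d)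
      (hrd : ∀ y, (r y).natDegree ≤ d)
    (hp : ∀ k, DifferentiableAt ℂ (fun y => (p y).coeff k) y₀)
    (hq : ∀ k, DifferentiableAt ℂ (fun y => (q y).coeff k) y₀)
    (hr : ∀ k, DifferentiableAt ℂ (fun y => (r y).coeff k) y₀) (l : ℕ) :
    DifferentiableAt ℂ (fun y => riccSol g (p y) (q y) (r y) l) y₀ := by
  induction l using Nat.strong_induction_on with
  | _ l ih =>
    have h1 : CoeffDiffAt
        (fun y => hSeries (fun i => if _hi : i < l then riccSol g (p y) (q y) (r y) i else 0)) y₀ := by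
      refine CoeffDiffAt.hSeries fun i => ?_
      split_ifs with hi
      · exact ih i hi
      · exact differentiableAt_const _
    have hP := CoeffDiffAt.ev hpd hp
    simp only [fun y => riccSol.eq_1 g (p y) (q y) (r y) l]
    refine DifferentiableAt.const_mul ?_ _
    exact ((((CoeffDiffAt.ev hrd hr).mul (h1.mul h1)).add ((hP.add hP).mul h1)).add
      (CoeffDiffAt.ev hqd hq).neg).2 _

end Families

/-! ### The Lax equation for the stationary flows -/

/-- The curve `F` of Laurent series, of uniformly bounded order, has the coefficientwise
derivative `F'` at `0`. -/
def CoeffDeriv (F : ℂ → LaurentSeries ℂ) (F' : LaurentSeries ℂ) : Prop :=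
  (∃ N, ∀ t, LB N (F t)) ∧ ∀ n, HasDerivAt (fun t => (F t).coeff n) (F'.coeff n) 0

theorem CoeffDeriv.lowerBound {F : ℂ → LaurentSeries ℂ} {F' : LaurentSeries ℂ}
    (h : CoeffDeriv F F') {N : ℤ}
    (hN : ∀ n < N, ∀ t, (F t).coeff n = (F 0).coeff n) : LB N F' := fun n hn => by
  have h1 := h.2 n
  simp only [hN n hn] at h1
  exact h1.unique (hasDerivAt_const _ _)

theorem CoeffDeriv.add {F G : ℂ → LaurentSeries ℂ} {F' G' : LaurentSeries ℂ} (hF : CoeffDeriv F F')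
    (hG : CoeffDeriv G G') : CoeffDeriv (fun t => F t + G t) (F' + G') := by
  obtain ⟨⟨N, hN⟩, hF⟩ := hF
  obtain ⟨⟨M, hM⟩, hG⟩ := hG
  refine ⟨⟨min N M, fun y => ((hN y).mono (min_le_left _ _)).add ((hM y).mono (min_le_right _ _))⟩,
    fun n => ?_⟩
  simp only [HahnSeries.coeff_add]
  exact (hF n).add (hG n)

theorem CoeffDeriv.sub {F G : ℂ → LaurentSeries ℂ} {F' G' : LaurentSeries ℂ} (hF : CoeffDeriv F F')
    (hG : CoeffDeriv G G') : CoeffDeriv (fun t => F t - G t) (F' - G') := by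
  obtain ⟨⟨N, hN⟩, hF⟩ := hF
  obtain ⟨⟨M, hM⟩, hG⟩ := hG
  refine ⟨⟨min N M, fun y => ((hN y).mono (min_le_left _ _)).sub ((hM y).mono (min_le_right _ _))⟩,
    fun n => ?_⟩
  simp only [HahnSeries.coeff_sub]
  exact (hF n).sub (hG n)

theorem CoeffDeriv.mul {F G : ℂ → LaurentSeries ℂ} {F' G' : LaurentSeries ℂ} (hF : CoeffDeriv F F')
    (hG : CoeffDeriv G G') : CoeffDeriv (fun t => F t * G t) (F' * G 0 + F 0 * G') := by
  obtain ⟨N, hN⟩ := hF.1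
  obtain ⟨M, hM⟩ := hG.1
  have hN' : LB N F' := hF.lowerBound fun n hn t => by rw [hN t n hn, hN 0 n hn]
  have hM' : LB M G' := hG.lowerBound fun n hn t => by rw [hM t n hn, hM 0 n hn]
  refine ⟨⟨N + M, fun y => (hN y).mul (hM y)⟩, fun n => ?_⟩
  simp only [fun y => coeff_mul_of_LB (hN y) (hM y) n]
  rw [HahnSeries.coeff_add, coeff_mul_of_LB hN' (hM 0), coeff_mul_of_LB (hN 0) hM',
    ← Finset.sum_add_distrib]
  exact HasDerivAt.fun_sum fun i _ => (hF.2 i).mul (hG.2 _)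

theorem CoeffDeriv.ofPoly {P : ℂ → ℂ[X]} {P' : ℂ[X]} {d : ℕ} (hd : ∀ t, (P t).natDegree ≤ d)
    (hP : ∀ k, HasDerivAt (fun t => (P t).coeff k) (P'.coeff k) 0) :
    CoeffDeriv (fun t => ev (P t)) (ev P') := by
  refine ⟨⟨_, fun t => LB_ev (hd t)⟩, fun n => ?_⟩
  simp only [coeff_ev]
  split_ifs
  · exact hP _
  · exact hasDerivAt_const _ _

/-- A polynomial of bounded degree with differentiable coefficients has a derivative. -/
theorem exists_coeff_hasDerivAt {P : ℂ → ℂ[X]} {d : ℕ} (hd : ∀ t, (P t).natDegree ≤ d)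
    (hP : ∀ k, DifferentiableAt ℂ (fun t => (P t).coeff k) 0) :
    ∃ P' : ℂ[X], ∀ k, HasDerivAt (fun t => (P t).coeff k) (P'.coeff k) 0 := by
  refine ⟨∑ k ∈ Finset.range (d + 1), Polynomial.C (deriv (fun t => (P t).coeff k) 0)
    * Polynomial.X ^ k,
    fun k => ?_⟩
  have h0 : d < k → deriv (fun t => (P t).coeff k) 0 = 0 := fun hk => by
    have : (fun t => (P t).coeff k) = fun _ => 0 := funext fun t =>
      Polynomial.coeff_eq_zero_of_natDegree_lt ((hd t).trans_lt hk)
    rw [this]; simp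
  rw [Polynomial.finsetSum_coeff]
  simp only [Polynomial.coeff_C_mul, Polynomial.coeff_X_pow, mul_ite, mul_one, mul_zero]
  rw [Finset.sum_ite_eq]
  split_ifs with hk
  · exact (hP k).hasDerivAt
  · have h1 := (hP k).hasDerivAt
    rwa [h0 (by simpa using hk)] at h1

theorem natDegree_pPoly_le (h : ℕ → ℂ) (k : ℕ) : (pPoly h k).natDegree ≤ k :=
  Polynomial.natDegree_le_iff_coeff_eq_zero.2 fun m hm => coeff_pPoly h k m (by omega)

theorem natDegree_VMat_10_le (h : ℕ → ℂ) (g : ℕ) : (VMat h (2 * g + 1) 1 0).natDegree ≤ g + 1 :=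
  Polynomial.natDegree_le_iff_coeff_eq_zero.2 fun m hm => by
    rw [coeff_VMat_10 h g m (by omega), if_neg (by omega)]

theorem hSeries_coeffDeriv (h D : ℕ → ℂ) {S : LaurentSeries ℂ} (hS : LB 1 S)
    (hD : ∀ l : ℕ, S.coeff (l + 1) = D l) : CoeffDeriv (fun t => hSeries (h + t • D)) S := by
  refine ⟨⟨_, fun t => LB_hSeries _⟩, fun n => ?_⟩
  simp only [coeff_hSeries]
  split_ifs with h1 h2
  · rw [hS _ (by omega)]; exact hasDerivAt_const _ _
  · have h3 := hD (n.toNat - 1)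
    rw [show (((n.toNat - 1 : ℕ) : ℤ) + 1) = n by omega] at h3
    rw [h3]
    simp only [Pi.add_apply, Pi.smul_apply, smul_eq_mul]
    simpa using ((hasDerivAt_id (0 : ℂ)).mul_const (D (n.toNat - 1))).const_add (h (n.toNat - 1))
  · rw [hS _ (by omega)]; exact hasDerivAt_const _ _

/-- The derivative of `V^(2g+1)` along the vector field of `t_{2i+1}`, at a zero of the `(2g+1)`-st
vector field, is the commutator `[V^(2i+1), V^(2g+1)]`. -/
theorem lax_equation {g : ℕ} {h : ℕ → ℂ} (hh : h ∈ KdVPhase g) (i : ℕ) :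
    (∀ k, HasDerivAt (fun t : ℂ => (pPoly (h + t • cs2Field (2 * i + 1) h) (2 * g + 1)).coeff k)
      ((qPoly h (2 * i + 1) * VMat h (2 * g + 1) 1 0
        - qPoly h (2 * g + 1) * VMat h (2 * i + 1) 1 0).coeff k) 0) ∧
    (∀ k, HasDerivAt (fun t : ℂ => (qPoly (h + t • cs2Field (2 * i + 1) h) (2 * g + 1)).coeff k)
      ((2 * (pPoly h (2 * i + 1) * qPoly h (2 * g + 1)
        - qPoly h (2 * i + 1) * pPoly h (2 * g + 1))).coeff k) 0) ∧
    (∀ k, HasDerivAt (fun t : ℂ => (VMat (h + t • cs2Field (2 * i + 1) h) (2 * g + 1) 1 0).coeff k)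
      ((2 * (VMat h (2 * i + 1) 1 0 * pPoly h (2 * g + 1)
        - pPoly h (2 * i + 1) * VMat h (2 * g + 1) 1 0)).coeff k) 0) := by
  set D := cs2Field (2 * i + 1) h with hD
  set S := cs2Series h (2 * i + 1) with hS
  have hc : ∀ l, DifferentiableAt ℂ (fun t : ℂ => (h + t • D) l) 0 := fun l => by
    simp only [Pi.add_apply, Pi.smul_apply, smul_eq_mul]; fun_prop
  obtain ⟨p', hp'⟩ := exists_coeff_hasDerivAt (fun t => natDegree_pPoly_le (h + t • D) (2 * g + 1))
    (differentiableAt_coeff_pPoly hc _)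
  obtain ⟨r', hr'⟩ := exists_coeff_hasDerivAt (fun t => natDegree_qPoly_odd (h + t • D) g)
    (differentiableAt_coeff_qPoly hc _)
  obtain ⟨q', hq'⟩ := exists_coeff_hasDerivAt (fun t => natDegree_VMat_10_le (h + t • D) g)
    (differentiableAt_coeff_VMat_10 hc _)
  have dh := hSeries_coeffDeriv h D (LB_cs2Series h (2 * i + 1)) (fun l => rfl)
  have dp := CoeffDeriv.ofPoly (fun t => natDegree_pPoly_le (h + t • D) (2 * g + 1)) hp'
  have dr := CoeffDeriv.ofPoly (fun t => natDegree_qPoly_odd (h + t • D) g) hr'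
  have dq := CoeffDeriv.ofPoly (fun t => natDegree_VMat_10_le (h + t • D) g) hq'
  -- the derivative of `H^(2g+1) = z^(2g+1) + O(z⁻¹)` is `O(z⁻¹)`
  have dH := dp.add (dr.mul dh)
  have dHL : LB 1 (ev p' + (ev r' * hSeries h + ev (qPoly h (2 * g + 1)) * S)) := by
    have h1 := dH.lowerBound (N := 1) fun n hn t => by
      have e : ∀ t : ℂ, HSer (h + t • D) (2 * g + 1) = ev (pPoly (h + t • D) (2 * g + 1))
        + ev (qPoly (h + t • D) (2 * g + 1)) * hSeries (h + t • D) := fun t => HSer_eq _ _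
      simp only [← e]
      rw [coeff_HSer _ _ hn, coeff_HSer _ _ hn]
    simpa using h1
  -- the derivative of the `(2g+1)`-st vector field is `O(z⁻¹)`
  have dcL : LB 1 (ev q' - (ev p' * hSeries h + ev (pPoly h (2 * g + 1)) * S)
      - ((ev p' + (ev r' * hSeries h + ev (qPoly h (2 * g + 1)) * S)) * hSeries h
        + HSer h (2 * g + 1) * S)) := by
    have h1 := ((dq.sub (dp.mul dh)).sub (dH.mul dh)).lowerBound (N := 1) fun n hn t => by
      have e : ∀ t : ℂ, cs2Series (h + t • D) (2 * g + 1) = ev (VMat (h + t • D) (2 * g + 1) 1 0)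
          - ev (pPoly (h + t • D) (2 * g + 1)) * hSeries (h + t • D)
          - (ev (pPoly (h + t • D) (2 * g + 1))
        + ev (qPoly (h + t • D) (2 * g + 1)) * hSeries (h + t • D)) * hSeries (h + t • D) :=
          fun t => by
        have h2 := VMat_spec (h + t • D) (2 * g + 1)
        have h3 := HSer_eq (h + t • D) (2 * g + 1)
        rw [VMat_trace, VMat_00, Polynomial.eval₂_neg] at h2
        simp only [ev]
        linear_combination h2 - hSeries (h + t • D) * h3
      simp only [← e]
      rw [LB_cs2Series _ _ _ hn, LB_cs2Series _ _ _ hn]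
    rw [HSer_eq h (2 * g + 1)]
    simpa using h1
  have hric := riccati_of_mem hh
  have hS1 : S = ev (VMat h (2 * i + 1) 1 0) - 2 * ev (pPoly h (2 * i + 1)) * hSeries h
      - ev (qPoly h (2 * i + 1)) * hSeries h ^ 2 := by
    have h2 := VMat_spec h (2 * i + 1)
    have h3 := HSer_eq h (2 * i + 1)
    rw [VMat_trace, VMat_00, Polynomial.eval₂_neg] at h2
    simp only [ev]
    linear_combination h2 - hSeries h * h3
  have hw := HSer_eq h (2 * g + 1)
  -- the Riccati equation turns these series into the form `P(z²) + Q(z²) h`, so that `P = Q = 0`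
  have key1 : LB 1 (ev (p' - (qPoly h (2 * i + 1) * VMat h (2 * g + 1) 1 0
        - qPoly h (2 * g + 1) * VMat h (2 * i + 1) 1 0))
      + ev (r' - 2 * (pPoly h (2 * i + 1) * qPoly h (2 * g + 1)
        - qPoly h (2 * i + 1) * pPoly h (2 * g + 1))) * hSeries h) := by
    convert dHL using 1
    rw [hS1]
    simp only [ev, Polynomial.eval₂_sub, Polynomial.eval₂_mul, Polynomial.eval₂_ofNat] at hric ⊢
    linear_combination Polynomial.eval₂ HahnSeries.C zSq (qPoly h (2 * i + 1)) * hric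
  obtain ⟨h1, h2⟩ := ev_add_ev_mul_unique h key1
  rw [sub_eq_zero] at h1 h2
  have key2 : LB 1 (ev (q' - 2 * (VMat h (2 * i + 1) 1 0 * pPoly h (2 * g + 1)
        - pPoly h (2 * i + 1) * VMat h (2 * g + 1) 1 0))) := by
    convert dcL using 1
    rw [hS1, hw, h1, h2]
    simp only [ev, Polynomial.eval₂_sub, Polynomial.eval₂_mul, Polynomial.eval₂_ofNat] at hric ⊢
    linear_combination (-2 * Polynomial.eval₂ HahnSeries.C zSq (qPoly h (2 * i + 1)) * hSeries h
      - 2 * Polynomial.eval₂ HahnSeries.C zSq (pPoly h (2 * i + 1))) * hric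
  have h3 := sub_eq_zero.1 (ev_eq_zero_of_LB key2)
  rw [← h1, ← h2, ← h3]
  exact ⟨hp', hr', hq'⟩

variable {g : ℕ}

/-! ### The Hamiltonians on `M_A` and the Lenard chain -/

theorem zero_mlie (M : Matrix (Fin 2) (Fin 2) ℂ) : ⁅(0 : Matrix (Fin 2) (Fin 2) ℂ), M⁆ = 0 := by
  simp [Ring.lie_def]

theorem mlie_zero (M : Matrix (Fin 2) (Fin 2) ℂ) : ⁅M, (0 : Matrix (Fin 2) (Fin 2) ℂ)⁆ = 0 := by
  simp [Ring.lie_def]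

theorem mlie_skew (M N : Matrix (Fin 2) (Fin 2) ℂ) : -⁅M, N⁆ = ⁅N, M⁆ := by
  simp [Ring.lie_def]

theorem self_eq_neg' {M : Matrix (Fin 2) (Fin 2) ℂ} (h : M = -M) : M = 0 := by
  ext a b; exact self_eq_neg.1 (congrFun (congrFun h a) b)

theorem mlie_add (L M N : Matrix (Fin 2) (Fin 2) ℂ) : ⁅L, M + N⁆ = ⁅L, M⁆ + ⁅L, N⁆ := by
  simp only [Ring.lie_def, mul_add, add_mul, add_sub_add_comm]

theorem mlie_smul (c : ℂ) (M N : Matrix (Fin 2) (Fin 2) ℂ) : ⁅M, c • N⁆ = c • ⁅M, N⁆ := by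
  simp only [Ring.lie_def, mul_smul_comm, smul_mul_assoc, smul_sub]

/-- The polynomial `∑ V_k λ^k` in one of the three coordinates of a tangent vector. -/
def vPoly (V : MA g) (a : Fin 3) : ℂ[X] :=
  ∑ k : Fin (g + 1), Polynomial.C (V k a) * Polynomial.X ^ (k : ℕ)

theorem coeff_vPoly (V : MA g) (a : Fin 3) (k : ℕ) :
    (vPoly V a).coeff k = if hk : k < g + 1 then V ⟨k, hk⟩ a else 0 := by
  rw [vPoly, Polynomial.finsetSum_coeff]
  simp only [Polynomial.coeff_C_mul, Polynomial.coeff_X_pow, mul_ite, mul_one, mul_zero]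
  split_ifs with hk
  · rw [Finset.sum_eq_single ⟨k, hk⟩]
    · simp
    · intro b _ hb
      rw [if_neg]; rintro rfl; exact hb rfl
    · simp
  · refine Finset.sum_eq_zero fun i _ => if_neg ?_
    have := i.2; omega

theorem coeff_vPoly_fin (V : MA g) (a : Fin 3) (k : Fin (g + 1)) : (vPoly V a).coeff k = V k a := by
  rw [coeff_vPoly, dif_pos k.2]

theorem natDegree_vPoly (V : MA g) (a : Fin 3) : (vPoly V a).natDegree ≤ g :=
  Polynomial.natDegree_le_iff_coeff_eq_zero.2 fun m hm => by
    rw [coeff_vPoly, dif_neg (by omega)]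

theorem vPoly_add (V V' : MA g) (a : Fin 3) : vPoly (V + V') a = vPoly V a + vPoly V' a := by
  simp [vPoly, add_mul, Finset.sum_add_distrib]

theorem vPoly_smul (c : ℂ) (V : MA g) (a : Fin 3) :
    vPoly (c • V) a = Polynomial.C c * vPoly V a := by
  simp [vPoly, mul_assoc, Finset.mul_sum]

theorem vPoly_injective {V V' : MA g} (h : ∀ a, vPoly V a = vPoly V' a) : V = V' := by
  funext k a; rw [← coeff_vPoly_fin V, h, coeff_vPoly_fin]

/-- The entries of `X(λ)`: `pX` is the `(1,1)` entry. -/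
def pX (X : MA g) : ℂ[X] := vPoly X 0
/-- The `(2,1)` entry of `X(λ)`, monic of degree `g + 1`. -/
def qX (X : MA g) : ℂ[X] := vPoly X 1 + Polynomial.X ^ (g + 1)
/-- The `(1,2)` entry of `X(λ)`. -/
def rX (X : MA g) : ℂ[X] := vPoly X 2

theorem coefMat_eq (X : MA g) (k : ℕ) :
    coefMat X k = !![(pX X).coeff k, (rX X).coeff k; (qX X).coeff k, -(pX X).coeff k] := by
  simp only [pX, qX, rX, Polynomial.coeff_add, coeff_vPoly, Polynomial.coeff_X_pow, coefMat,
    slMat, matA]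
  split_ifs with h1 h2 h2
  · omega
  · simp
  · simp
  · ext a b; fin_cases a <;> fin_cases b <;> simp

theorem coeff_laxPoly (X : MA g) (k : ℕ) (a b : Fin 2) :
    (laxPoly X a b).coeff k = coefMat X k a b := by
  have h0 : g + 2 ≤ k → coefMat X k = 0 := fun h => by
    rw [coefMat, dif_neg (by omega), if_neg (by omega)]
  rw [laxPoly, Matrix.sum_apply, Polynomial.finsetSum_coeff]
  simp only [Matrix.smul_apply, Matrix.map_apply, smul_eq_mul, mul_comm (Polynomial.X ^ _),
    Polynomial.coeff_C_mul, Polynomial.coeff_X_pow, mul_ite, mul_one, mul_zero]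
  rw [Finset.sum_ite_eq]
  split_ifs with h
  · rfl
  · rw [h0 (by simpa using h)]; rfl

theorem laxPoly_eq (X : MA g) : laxPoly X = !![pX X, rX X; qX X, -pX X] := by
  ext a b k
  rw [coeff_laxPoly, coefMat_eq]
  fin_cases a <;> fin_cases b <;> simp

theorem Hfun_eq (i : ℕ) (X : MA g) : Hfun i X = (pX X ^ 2 + rX X * qX X).coeff i := by
  have : Matrix.trace (laxPoly X * laxPoly X) = Polynomial.C 2 * (pX X ^ 2 + rX X * qX X) := by
    rw [laxPoly_eq, Matrix.trace_fin_two]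
    simp only [Matrix.mul_apply, Fin.sum_univ_two]
    simp
    rw [Polynomial.C_ofNat]; ring
  rw [Hfun, this, Polynomial.coeff_C_mul]; ring

theorem coeff_qX_succ (X : MA g) : (qX X).coeff (g + 1) = 1 := by
  simp [qX, coeff_vPoly]

theorem natDegree_qX (X : MA g) : (qX X).natDegree ≤ g + 1 :=
  (Polynomial.natDegree_add_le _ _).trans (max_le ((natDegree_vPoly X 1).trans (by omega)) (by simp))

theorem Hfun_top (X : MA g) : Hfun (2 * g + 1) X = X (Fin.last g) 2 := by
  have hr : (rX X).natDegree ≤ g := natDegree_vPoly X 2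
  rw [Hfun_eq, Polynomial.coeff_add, sq, Polynomial.coeff_eq_zero_of_natDegree_lt, zero_add,
    show 2 * g + 1 = g + (g + 1) by ring,
    Polynomial.coeff_mul_add_eq_of_natDegree_le hr (natDegree_qX X), coeff_qX_succ, mul_one]
  · exact coeff_vPoly_fin X 2 (Fin.last g)
  · exact (Polynomial.natDegree_mul_le_of_le (natDegree_vPoly X 0) (natDegree_vPoly X 0)).trans_lt (by omega)

theorem hasFDerivAt_coeff_vPoly (X : MA g) (a : Fin 3) (k : ℕ) :
    ∃ f : MA g →L[ℂ] ℂ, HasFDerivAt (fun X : MA g => (vPoly X a).coeff k) f X ∧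
      ∀ V, f V = (vPoly V a).coeff k := by
  simp only [coeff_vPoly]
  split_ifs with h
  · refine ⟨(ContinuousLinearMap.proj (R := ℂ) (φ := fun _ => ℂ) a).comp
      (ContinuousLinearMap.proj (R := ℂ) (φ := fun _ : Fin (g + 1) => Fin 3 → ℂ) ⟨k, h⟩),
      ?_, fun V => rfl⟩
    exact ContinuousLinearMap.hasFDerivAt ((ContinuousLinearMap.proj (R := ℂ) (φ := fun _ => ℂ) a).comp
      (ContinuousLinearMap.proj (R := ℂ) (φ := fun _ : Fin (g + 1) => Fin 3 → ℂ) ⟨k, h⟩))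
  · exact ⟨0, hasFDerivAt_const _ _, fun V => rfl⟩

/-- `dH_i` is the coefficient of `λ^i` in `Tr X(λ) dX(λ)`. -/
theorem hasFDerivAt_Hfun (i : ℕ) (X : MA g) :
    ∃ f : MA g →L[ℂ] ℂ, HasFDerivAt (Hfun i) f X ∧ ∀ V, f V =
      (2 * pX X * vPoly V 0 + rX X * vPoly V 1 + qX X * vPoly V 2).coeff i := by
  choose f hf hf' using hasFDerivAt_coeff_vPoly X
  have hq : ∀ k, HasFDerivAt (fun X : MA g => (qX X).coeff k) (f 1 k) X := fun k => by
    simp only [qX, Polynomial.coeff_add]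
    exact (hf 1 k).add_const _
  have h1 : (Hfun i : MA g → ℂ) = fun X => ∑ x ∈ Finset.HasAntidiagonal.antidiagonal i,
      ((pX X).coeff x.1 * (pX X).coeff x.2 + (rX X).coeff x.1 * (qX X).coeff x.2) := by
    funext X
    rw [Hfun_eq, sq, Polynomial.coeff_add, Polynomial.coeff_mul, Polynomial.coeff_mul,
      Finset.sum_add_distrib]
  have h2 := HasFDerivAt.fun_sum (u := Finset.HasAntidiagonal.antidiagonal i) fun x _ =>
    ((hf 0 x.1).mul (hf 0 x.2)).add ((hf 2 x.1).mul (hq x.2))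
  refine ⟨_, h1 ▸ h2, fun V => ?_⟩
  rw [show 2 * pX X * vPoly V 0 + rX X * vPoly V 1 + qX X * vPoly V 2
    = (pX X * vPoly V 0 + vPoly V 0 * pX X) + (rX X * vPoly V 1 + vPoly V 2 * qX X) by ring]
  simp only [Polynomial.coeff_add, Polynomial.coeff_mul, ← Finset.sum_add_distrib]
  rw [sum_apply]
  refine Finset.sum_congr rfl fun x _ => ?_
  simp only [add_apply, smul_apply, hf', smul_eq_mul,
    ← pX.eq_1, ← rX.eq_1]
  ring

theorem differentiable_Hfun (i : ℕ) : Differentiable ℂ (Hfun i : MA g → ℂ) := fun X =>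
  (hasFDerivAt_Hfun i X).choose_spec.1.differentiableAt

theorem fderiv_Hfun (i : ℕ) (X V : MA g) : fderiv ℂ (Hfun i) X V =
    (2 * pX X * vPoly V 0 + rX X * vPoly V 1 + qX X * vPoly V 2).coeff i := by
  obtain ⟨f, hf, h⟩ := hasFDerivAt_Hfun i X
  rw [hf.fderiv, h]

theorem vPoly_single (j : Fin (g + 1)) (a b : Fin 3) :
    vPoly (Pi.single j (Pi.single a 1) : MA g) b = if b = a then Polynomial.X ^ (j : ℕ) else 0 := by
  ext k
  rw [coeff_vPoly]
  by_cases hb : b = a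
  · subst hb
    simp only [if_true, Polynomial.coeff_X_pow]
    by_cases hk : k < g + 1
    · rw [dif_pos hk]
      by_cases h : k = j
      · subst h; simp
      · rw [if_neg h, Pi.single_eq_of_ne (fun h' => h (by rw [← h']))]; rfl
    · rw [dif_neg hk, if_neg (by have := j.2; omega)]
  · rw [if_neg hb, Polynomial.coeff_zero]
    split_ifs with hk
    · by_cases h : (⟨k, hk⟩ : Fin (g + 1)) = j
      · rw [h, Pi.single_eq_same, Pi.single_eq_of_ne hb]
      · rw [Pi.single_eq_of_ne h]; rfl
    · rfl

theorem slMat_slCoord {M : Matrix (Fin 2) (Fin 2) ℂ} (h : M.trace = 0) : slMat (slCoord M) = M := by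
  rw [Matrix.trace_fin_two] at h
  ext a b
  fin_cases a <;> fin_cases b <;> simp [slMat, slCoord]
  linear_combination -h

theorem trace_coefMat (X : MA g) (k : ℕ) : (coefMat X k).trace = 0 := by
  rw [coefMat_eq, Matrix.trace_fin_two]; simp

theorem trace_lie (M N : Matrix (Fin 2) (Fin 2) ℂ) : (⁅M, N⁆).trace = 0 := by
  rw [Ring.lie_def, Matrix.trace_sub, Matrix.trace_mul_comm, sub_self]

/-- `dH_i = (X_i, X_{i-1}, …)`. -/
theorem grad_Hfun (i : ℕ) (X : MA g) (j : Fin (g + 1)) :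
    grad (Hfun i) X j = if (j : ℕ) ≤ i then slCoord (coefMat X (i - j)) else 0 := by
  have e : ∀ a, fderiv ℂ (Hfun i) X (Pi.single j (Pi.single a 1)) = _ := fun a => by
    rw [fderiv_Hfun, vPoly_single, vPoly_single, vPoly_single]
  simp only [grad, e]
  rw [coefMat_eq, slCoord]
  by_cases h : (j : ℕ) ≤ i <;> simp only [h, if_true, if_false]
  · ext a
    fin_cases a <;> simp [Polynomial.coeff_mul_X_pow', h, mul_assoc]
  · ext a
    fin_cases a <;> simp [Polynomial.coeff_mul_X_pow', h, mul_assoc]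

theorem slMat_zero : slMat 0 = 0 := by
  ext a b; fin_cases a <;> fin_cases b <;> simp [slMat]

theorem slCoord_zero : slCoord 0 = 0 := by
  ext a; fin_cases a <;> simp [slCoord]

theorem slMat_grad_Hfun (i : ℕ) (X : MA g) (j : Fin (g + 1)) :
    slMat (grad (Hfun i) X j) = if (j : ℕ) ≤ i then coefMat X (i - j) else 0 := by
  rw [grad_Hfun]
  split_ifs
  · rw [slMat_slCoord (trace_coefMat X _)]
  · exact slMat_zero

theorem coefMat_of_lt (X : MA g) {k : ℕ} (hk : g + 1 < k) : coefMat X k = 0 := by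
  rw [coefMat, dif_neg (by omega), if_neg (by omega)]

theorem coefMat_succ (X : MA g) : coefMat X (g + 1) = matA := by
  rw [coefMat, dif_neg (by omega), if_pos rfl]

theorem coefMat_fin (X : MA g) (i : Fin (g + 1)) : coefMat X i = slMat (X i) := by
  rw [coefMat, dif_pos i.2]

/-- A sum over `Fin (g + 1)`, cut off at `m`, of terms that vanish beyond `g`. -/
theorem sum_fin_cut {M : Type*} [AddCommMonoid M] {m : ℕ} {f : ℕ → M} (hf : ∀ j, g < j → f j = 0) :
    ∑ j : Fin (g + 1), (if (j : ℕ) ≤ m then f j else 0) = ∑ j ∈ Finset.range (m + 1), f j := by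
  rw [Fin.sum_univ_eq_sum_range (fun j => if j ≤ m then f j else 0), ← Finset.sum_filter]
  refine Finset.sum_subset (fun j => ?_) (fun j h1 h2 => hf j ?_)
  · simp
  · simp at h1 h2; omega

/-- The Hamiltonian vector field `P_0 dH_m` in Lax form: the coefficients of the commutator of
`(λ^(-m-1) X)_+` with `X`. -/
theorem P0_grad_Hfun (m : ℕ) (X : MA g) (k : Fin (g + 1)) :
    P0 X (grad (Hfun m) X) k
      = slCoord (∑ n ∈ Finset.range (k + 1), ⁅coefMat X (m + 1 + n), coefMat X (k - n)⁆) := by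
  rw [P0]
  congr 1
  have h1 : ∀ j : Fin (g + 1), ⁅coefMat X (k + j + 1), slMat (grad (Hfun m) X j)⁆
      = if (j : ℕ) ≤ m then ⁅coefMat X (k + j + 1), coefMat X (m - j)⁆ else 0 := fun j => by
    rw [slMat_grad_Hfun]; split_ifs <;> simp [mlie_zero]
  rw [Finset.sum_congr rfl fun j _ => h1 j,
    sum_fin_cut (f := fun j => ⁅coefMat X (k + j + 1), coefMat X (m - j)⁆) fun j hj => by
      rw [coefMat_of_lt X (by omega), zero_mlie]]
  -- the coefficient of `λ^(k+1+m)` in `[X, X] = 0`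
  have h2 : ∑ a ∈ Finset.range (k + 1 + (m + 1)), ⁅coefMat X a, coefMat X (k + 1 + m - a)⁆ = 0 := by
    have h3 := Finset.sum_range_reflect (fun a => ⁅coefMat X a, coefMat X (k + 1 + m - a)⁆) (k
      + 1 + (m + 1))
    have h4 : ∑ a ∈ Finset.range (k + 1 + (m + 1)), ⁅coefMat X (k + 1 + (m + 1) - 1 - a),
        coefMat X (k + 1 + m - (k + 1 + (m + 1) - 1 - a))⁆
        = -∑ a ∈ Finset.range (k + 1 + (m + 1)), ⁅coefMat X a, coefMat X (k + 1 + m - a)⁆ := by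
      rw [← Finset.sum_neg_distrib]
      refine Finset.sum_congr rfl fun a ha => ?_
      rw [Finset.mem_range] at ha
      rw [show k + 1 + m - (k + 1 + (m + 1) - 1 - a) = a by omega,
        show k + 1 + (m + 1) - 1 - a = k + 1 + m - a by omega, mlie_skew]
    rw [h4] at h3
    exact self_eq_neg' h3.symm
  rw [Finset.sum_range_add, ← Finset.sum_range_reflect] at h2
  rw [← sub_eq_zero, ← h2, sub_eq_add_neg, ← Finset.sum_neg_distrib, add_comm]
  congr 1
  · refine Finset.sum_congr rfl fun a ha => ?_
    rw [Finset.mem_range] at ha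
    rw [mlie_skew, show (k : ℕ) + 1 - 1 - a = k - a by omega,
      show (k : ℕ) + 1 + m - (k - a) = m + 1 + a by omega]
  · refine Finset.sum_congr rfl fun a ha => ?_
    rw [show (k : ℕ) + a + 1 = k + 1 + a by ring,
      show (k : ℕ) + 1 + m - (k + 1 + a) = m - a by omega]

theorem P0_grad_Hfun_of_lt {m : ℕ} (hm : g < m) (X : MA g) : P0 X (grad (Hfun m) X) = 0 := by
  funext k
  rw [P0_grad_Hfun, Finset.sum_eq_zero, slCoord_zero]; · rfl
  intro n _
  rw [coefMat_of_lt X (by omega), zero_mlie]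

theorem P0_grad_Hfun_self (X : MA g) : P0 X (grad (Hfun g) X) = genD X := by
  funext k
  rw [P0_grad_Hfun, Finset.sum_range_succ', Finset.sum_eq_zero, zero_add]
  · rw [add_zero, coefMat_succ, Nat.sub_zero, coefMat_fin]; rfl
  · intro n _
    rw [coefMat_of_lt X (by omega), zero_mlie]

/-- The Lenard relation `P_1 dH_{m+1} = P_0 dH_m`. The terms agree after a shift of the index by
one. -/
theorem P1_grad_Hfun (m : ℕ) (X : MA g) :
    P1 X (grad (Hfun (m + 1)) X) = P0 X (grad (Hfun m) X) := by
  funext k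
  rw [P1]
  split_ifs with hk
  · subst hk
    rw [P0_grad_Hfun, slMat_grad_Hfun]
    simp [mlie_skew]
  · have hk0 : (k : ℕ) ≠ 0 := fun h => hk (Fin.ext h)
    rw [P0]
    congr 1
    have h1 : ∀ j : Fin (g + 1), ⁅coefMat X (k + j + 1), slMat (grad (Hfun m) X j)⁆
        = if (j : ℕ) ≤ m then ⁅coefMat X (k + j + 1), coefMat X (m - j)⁆ else 0 := fun j => by
      rw [slMat_grad_Hfun]; split_ifs <;> simp [mlie_zero]
    have h2 : ∀ j : Fin (g + 1), (if j = 0 then 0 else ⁅coefMat X (k + j),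
      slMat (grad (Hfun (m + 1)) X j)⁆)
        = if (j : ℕ) ≤ m + 1 then (if (j : ℕ) = 0 then 0 else
          ⁅coefMat X (k + j), coefMat X (m + 1 - j)⁆) else 0 := fun j => by
      rw [slMat_grad_Hfun]
      simp only [Fin.ext_iff, Fin.val_zero]
      split_ifs <;> simp [mlie_zero]
    rw [Finset.sum_congr rfl fun j _ => h1 j, Finset.sum_congr rfl fun j _ => h2 j,
      sum_fin_cut (f := fun j => ⁅coefMat X (k + j + 1), coefMat X (m - j)⁆) fun j hj => by
        rw [coefMat_of_lt X (by omega), zero_mlie],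
      sum_fin_cut (f := fun j => if j = 0 then 0 else ⁅coefMat X (k + j), coefMat X (m + 1 - j)⁆)
        fun j hj => by rw [coefMat_of_lt X (by omega), zero_mlie, ite_self],
      Finset.sum_range_succ']
    simp [Nat.succ_sub_succ, add_assoc]

theorem vPoly_genD (X : MA g) : vPoly (genD X) 0 = -rX X ∧ vPoly (genD X) 1 = 2 * pX X ∧
    vPoly (genD X) 2 = 0 := by
  have h : ∀ i, genD X i = ![-X i 2, 2 * X i 0, 0] := fun i => by
    ext a
    fin_cases a <;> simp [genD, slCoord, slMat, matA, Ring.lie_def]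
    ring
  refine ⟨?_, ?_, ?_⟩ <;> ext k
  · rw [Polynomial.coeff_neg, rX, coeff_vPoly, coeff_vPoly]; simp only [h]; split_ifs <;> simp
  · rw [show (2 : ℂ[X]) = Polynomial.C 2 from rfl, Polynomial.coeff_C_mul, pX, coeff_vPoly,
      coeff_vPoly]
    simp only [h]; split_ifs <;> simp
  · rw [coeff_vPoly]; simp only [h]; split_ifs <;> simp

theorem fderiv_Hfun_genD (i : ℕ) (X : MA g) : fderiv ℂ (Hfun i) X (genD X) = 0 := by
  obtain ⟨h1, h2, h3⟩ := vPoly_genD X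
  rw [fderiv_Hfun, h1, h2, h3]
  ring_nf; simp

theorem vPoly_zVec : vPoly (zVec g) 0 = 0 ∧ vPoly (zVec g) 1 = 1 ∧ vPoly (zVec g) 2 = 0 := by
  have h : zVec g = Pi.single 0 (Pi.single 1 1) := by
    rw [zVec]; congr 1; ext a; fin_cases a <;> simp [slCoord, matA]
  simp [h, vPoly_single]

/-- `Z (H(λ))` is the `(1,2)` entry of `X(λ)`. -/
theorem fderiv_Hfun_zVec (i : ℕ) (X : MA g) : fderiv ℂ (Hfun i) X (zVec g) = (rX X).coeff i := by
  obtain ⟨h1, h2, h3⟩ := vPoly_zVec (g := g)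
  rw [fderiv_Hfun, h1, h2, h3]; simp

/-! ### The pairing and the Poisson tensors -/

theorem pair_comm (W V : MA g) : pair W V = pair V W :=
  Finset.sum_congr rfl fun _ _ => Matrix.trace_mul_comm _ _

theorem pair_eq (W V : MA g) :
    pair W V = ∑ i, (2 * W i 0 * V i 0 + W i 2 * V i 1 + W i 1 * V i 2) := by
  refine Finset.sum_congr rfl fun i _ => ?_
  simp [slMat, Matrix.trace_fin_two]; ring

/-- The pairing as a bilinear map. -/
def pairB (g : ℕ) : LinearMap.BilinForm ℂ (MA g) :=
  LinearMap.mk₂ ℂ pair pair_add_left pair_smul_left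
    (fun W V V' => by rw [pair_comm, pair_add_left, pair_comm V, pair_comm V'])
    (fun c W V => by rw [pair_comm, pair_smul_left, pair_comm V]; rfl)

theorem pairB_apply (W V : MA g) : pairB g W V = pair W V := rfl

/-- Every linear form is the pairing with a covector. -/
theorem exists_pair_eq (f : MA g →ₗ[ℂ] ℂ) : ∃ W, ∀ V, pair W V = f V :=
  ⟨grad (LinearMap.toContinuousLinearMap f) 0, fun V => by
    rw [pair_grad, ContinuousLinearMap.fderiv]; rfl⟩

theorem eq_zero_of_pair {W : MA g} (h : ∀ V, pair V W = 0) : W = 0 := by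
  funext i a
  obtain ⟨V, hV⟩ := exists_pair_eq ((LinearMap.proj a).comp
    (LinearMap.proj (R := ℂ) (φ := fun _ : Fin (g + 1) => Fin 3 → ℂ) i))
  exact (hV W).symm.trans (h V)

theorem eq_zero_of_pair' {W : MA g} (h : ∀ V, pair W V = 0) : W = 0 :=
  eq_zero_of_pair fun V => by rw [pair_comm]; exact h V

/-- `P_1` at `X` as a linear map. -/
def P1Lin (X : MA g) : MA g →ₗ[ℂ] MA g where
  toFun := P1 X
  map_add' := by
    intro W W'
    funext i
    simp only [P1, Pi.add_apply, slMat_add, mlie_add]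
    split_ifs with h
    · rw [neg_add, slCoord_add]
    · rw [← slCoord_add, ← Finset.sum_add_distrib]
      congr 1
      refine Finset.sum_congr rfl fun j _ => ?_
      split_ifs
      · rw [add_zero]
      · rfl
  map_smul' := by
    intro c W
    funext i
    simp only [P1, Pi.smul_apply, slMat_smul, mlie_smul, ← smul_neg, RingHom.id_apply]
    split_ifs with h
    · rw [slCoord_smul]
    · rw [← slCoord_smul, Finset.smul_sum]
      congr 1
      refine Finset.sum_congr rfl fun j _ => ?_
      split_ifs
      · rw [smul_zero]
      · rfl

theorem P0Lin_apply (X W : MA g) : P0Lin X W = P0 X W := rfl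
theorem P1Lin_apply (X W : MA g) : P1Lin X W = P1 X W := rfl

theorem trace_mul_lie (L M N : Matrix (Fin 2) (Fin 2) ℂ) :
    (L * ⁅M, N⁆).trace = -(N * ⁅M, L⁆).trace := by
  simp only [Ring.lie_def, Matrix.trace_fin_two, Matrix.mul_apply, Matrix.sub_apply,
    Fin.sum_univ_two]
  ring

theorem trace_sum_lie {ι : Type*} (s : Finset ι) (M N : ι → Matrix (Fin 2) (Fin 2) ℂ) :
    (∑ j ∈ s, ⁅M j, N j⁆).trace = 0 := by
  rw [Matrix.trace_sum]; exact Finset.sum_eq_zero fun j _ => trace_lie _ _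

theorem pair_P0 (X W W' : MA g) : pair W (P0 X W') =
    ∑ i : Fin (g + 1), ∑ j : Fin (g + 1),
      (slMat (W i) * ⁅coefMat X (i + j + 1), slMat (W' j)⁆).trace := by
  refine Finset.sum_congr rfl fun i _ => ?_
  rw [P0, slMat_slCoord (trace_sum_lie _ _ _), Finset.mul_sum, Matrix.trace_sum]

theorem pair_P1 (X W W' : MA g) : pair W (P1 X W') =
    ∑ i : Fin (g + 1), ∑ j : Fin (g + 1), (if i = 0 then (if j = 0 then -1 else 0) else
      if j = 0 then 0 else 1) * (slMat (W i) * ⁅coefMat X (i + j), slMat (W' j)⁆).trace := by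
  refine Finset.sum_congr rfl fun i _ => ?_
  rw [P1]
  split_ifs with h
  · rw [slMat_slCoord (by rw [Matrix.trace_neg, trace_lie, neg_zero]),
      Finset.sum_eq_single 0 (fun b _ hb => by rw [if_neg hb, zero_mul]) (by simp)]
    subst h
    simp
  · rw [slMat_slCoord, Finset.mul_sum, Matrix.trace_sum]
    · refine Finset.sum_congr rfl fun j _ => ?_
      split_ifs <;> simp
    · rw [Matrix.trace_sum]
      refine Finset.sum_eq_zero fun j _ => ?_
      split_ifs
      · simp
      · exact trace_lie _ _

theorem pair_P0_skew (X W W' : MA g) : pair W (P0 X W') = -pair W' (P0 X W) := by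
  rw [pair_P0, pair_P0, Finset.sum_comm, ← Finset.sum_neg_distrib]
  refine Finset.sum_congr rfl fun i _ => ?_
  rw [← Finset.sum_neg_distrib]
  refine Finset.sum_congr rfl fun j _ => ?_
  rw [trace_mul_lie, add_comm (j : ℕ)]

theorem pair_P1_skew (X W W' : MA g) : pair W (P1 X W') = -pair W' (P1 X W) := by
  rw [pair_P1, pair_P1, Finset.sum_comm, ← Finset.sum_neg_distrib]
  refine Finset.sum_congr rfl fun i _ => ?_
  rw [← Finset.sum_neg_distrib]
  refine Finset.sum_congr rfl fun j _ => ?_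
  rw [trace_mul_lie, add_comm (j : ℕ)]
  split_ifs <;> ring

theorem pair_zero_right (W : MA g) : pair W 0 = 0 := map_zero (pairB g W)

theorem pair_add_right (W V V' : MA g) : pair W (V + V') = pair W V + pair W V' :=
  map_add (pairB g W) V V'

theorem pair_sub_right (W V V' : MA g) : pair W (V - V') = pair W V - pair W V' :=
  map_sub (pairB g W) V V'

theorem pair_sub_left (W W' V : MA g) : pair (W - W') V = pair W V - pair W' V := by
  rw [pair_comm, pair_sub_right, pair_comm V, pair_comm V]

theorem pair_smul_right (c : ℂ) (W V : MA g) : pair W (c • V) = c * pair W V :=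
  map_smul (pairB g W) c V

theorem pair_neg_left (W V : MA g) : pair (-W) V = -pair W V := by
  rw [pair_comm, ← pair_comm V]; exact map_neg (pairB g V) W

theorem pair_sum_left {ι : Type*} (s : Finset ι) (W : ι → MA g) (V : MA g) :
    pair (∑ i ∈ s, W i) V = ∑ i ∈ s, pair (W i) V := by
  rw [pair_comm]
  simp only [pair_comm _ V]
  exact map_sum (pairB g V) W s

/-- `dH_i`, for `i ≥ g + 1`, span the kernel of `P_0`. The coefficients are found successively: the
first nonzero component of a covector in the kernel commutes with `A`, hence is a multiple of `A`,
as is the first nonzero component of `dH_i`. -/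
theorem ker_P0 {X W : MA g} (h : P0 X W = 0) :
    ∃ c : ℕ → ℂ, W = ∑ k ∈ Finset.range (g + 1), c k • grad (Hfun (g + 1 + k)) X := by
  suffices H : ∀ n ≤ g + 1, ∃ c : ℕ → ℂ, ∀ j : Fin (g + 1), (j : ℕ) < n →
      W j = (∑ k ∈ Finset.range n, c k • grad (Hfun (g + 1 + k)) X) j by
    obtain ⟨c, hc⟩ := H (g + 1) le_rfl
    exact ⟨c, funext fun j => hc j j.2⟩
  intro n
  induction n with
  | zero => exact fun _ => ⟨0, fun j hj => absurd hj (by omega)⟩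
  | succ n ih =>
    intro hn
    obtain ⟨c, hc⟩ := ih (by omega)
    set W' := W - ∑ k ∈ Finset.range n, c k • grad (Hfun (g + 1 + k)) X with hW'
    have h0 : P0 X W' = 0 := by
      rw [← P0Lin_apply, hW', map_sub, map_sum, P0Lin_apply, h, zero_sub, neg_eq_zero]
      refine Finset.sum_eq_zero fun k _ => ?_
      rw [map_smul, P0Lin_apply, P0_grad_Hfun_of_lt (by omega), smul_zero]
    have hz : ∀ j : Fin (g + 1), (j : ℕ) < n → W' j = 0 := fun j hj => by
      rw [hW', Pi.sub_apply, hc j hj, sub_self]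
    -- the component of index `g - n` of `P_0 W'` is `[A, W'_n]`
    have h1 : P0 X W' ⟨g - n, by omega⟩ = slCoord ⁅matA, slMat (W' ⟨n, by omega⟩)⁆ := by
      rw [P0]
      congr 1
      rw [Finset.sum_eq_single ⟨n, by omega⟩]
      · rw [← coefMat_succ X]
        congr 2
        simp only
        omega
      · intro j _ hj
        have hj' : (j : ℕ) ≠ n := fun h => hj (Fin.ext h)
        rcases lt_or_gt_of_ne hj' with h | h
        · rw [hz j h, slMat_zero, mlie_zero]
        · rw [coefMat_of_lt X (by simp only; omega), zero_mlie]
      · simp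
    rw [h0] at h1
    have h2 : W' ⟨n, by omega⟩ = ![0, W' ⟨n, by omega⟩ 1, 0] := by
      have e0 := congrFun h1 0
      have e1 := congrFun h1 1
      simp [slCoord, slMat, matA, Ring.lie_def] at e0 e1
      ext a
      fin_cases a
      · show W' ⟨n, by omega⟩ 0 = (0 : ℂ); linear_combination -e1 / 2
      · rfl
      · exact e0
    refine ⟨Function.update c n (W' ⟨n, by omega⟩ 1), fun j hj => ?_⟩
    rw [Finset.sum_range_succ, Function.update_self,
      Finset.sum_congr rfl fun k hk => by
        rw [Function.update_of_ne (Finset.mem_range.1 hk).ne], Pi.add_apply, ← sub_eq_iff_eq_add',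
          ← Pi.sub_apply,
      ← hW', Pi.smul_apply, grad_Hfun, if_pos (by omega)]
    by_cases hjn : (j : ℕ) < n
    · rw [hz j hjn, coefMat_of_lt X (by omega), slCoord_zero, smul_zero]
    · have hj' : j = ⟨n, by omega⟩ := Fin.ext (by simp only; omega)
      rw [show g + 1 + n - (j : ℕ) = g + 1 by omega, coefMat_succ, hj', h2]
      ext a; fin_cases a <;> simp [slCoord, matA]

/-- The image of `P_0` is the annihilator of its kernel. -/
theorem exists_P0_eq {X V : MA g} (h : ∀ k, g < k → pair (grad (Hfun k) X) V = 0) :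
    ∃ W, P0 X W = V := by
  by_contra hV
  have hV' : V ∉ LinearMap.range (P0Lin X) := fun ⟨W, hW⟩ => hV ⟨W, hW⟩
  obtain ⟨f, hf, hf0⟩ := Submodule.exists_le_ker_of_notMem hV'
  obtain ⟨W, hW⟩ := exists_pair_eq f
  have h1 : P0 X W = 0 := eq_zero_of_pair fun W' => by
    rw [pair_P0_skew, hW, neg_eq_zero]
    exact hf0 ⟨W', rfl⟩
  obtain ⟨c, hc⟩ := ker_P0 h1
  refine hf ?_
  rw [← hW, hc, pair_sum_left]
  exact Finset.sum_eq_zero fun k _ => by rw [pair_smul_left, h _ (by omega), mul_zero]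

/-! ### The symplectic leaves of the reduction of `P_0` -/

theorem mem_annih {X W : MA g} : W ∈ annih X ↔ pair W (genD X) = 0 := Iff.rfl

theorem mem_tanS {X v : MA g} :
    v ∈ tanS X ↔ ∀ i, g + 1 ≤ i → i ≤ 2 * g + 1 → fderiv ℂ (Hfun i) X v = 0 := by
  simp [tanS, Submodule.mem_iInf, LinearMap.mem_ker]

theorem Hfun_zero_of_gt {i : ℕ} (hi : 2 * g + 1 < i) (X : MA g) :
    fderiv ℂ (Hfun i) X = 0 := by
  have : (Hfun i : MA g → ℂ) = fun _ => 0 := funext fun Y => by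
    rw [Hfun_eq]
    refine Polynomial.coeff_eq_zero_of_natDegree_lt (lt_of_le_of_lt (Polynomial.natDegree_add_le _ _) (max_lt ?_ ?_))
    · exact (Polynomial.natDegree_pow_le_of_le 2 (natDegree_vPoly Y 0)).trans_lt (by omega)
    · exact (Polynomial.natDegree_mul_le_of_le (natDegree_vPoly Y 2) (natDegree_qX Y)).trans_lt (by omega)
  rw [this]; simp

theorem fderiv_Hfun_of_mem_tanS {X v : MA g} (hv : v ∈ tanS X) {i : ℕ} (hi : g < i) :
    fderiv ℂ (Hfun i) X v = 0 := by
  by_cases h : i ≤ 2 * g + 1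
  · exact mem_tanS.1 hv i hi h
  · rw [Hfun_zero_of_gt (by omega)]; rfl

theorem P0_mem_tanS (X W : MA g) : P0 X W ∈ tanS X := mem_tanS.2 fun i hi _ => by
  rw [← pair_grad, pair_P0_skew, P0_grad_Hfun_of_lt (by omega), pair_zero_right, neg_zero]

theorem fderiv_Hfun_P0 {X W : MA g} : fderiv ℂ (Hfun g) X (P0 X W) = -pair W (genD X) := by
  rw [← pair_grad, pair_P0_skew, P0_grad_Hfun_self]

theorem genD_mem_tanS (X : MA g) : genD X ∈ tanS X := P0_grad_Hfun_self X ▸ P0_mem_tanS X _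

theorem leafT_eq (X : MA g) : leafT X =
    (tanS X ⊓ LinearMap.ker (fderiv ℂ (Hfun g) X).toLinearMap).map (Submodule.mkQ _) := by
  rw [leafT]
  congr 1
  ext v
  constructor
  · rintro ⟨W, hW, rfl⟩
    exact ⟨P0_mem_tanS X W, by
      show fderiv ℂ (Hfun g) X (P0 X W) = 0
      rw [fderiv_Hfun_P0, mem_annih.1 hW, neg_zero]⟩
  · rintro ⟨h1, h2⟩
    obtain ⟨W, rfl⟩ := exists_P0_eq (X := X) (V := v) fun k hk => by
      rw [pair_grad, fderiv_Hfun_of_mem_tanS h1 hk]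
    refine ⟨W, ?_, rfl⟩
    have h3 : fderiv ℂ (Hfun g) X (P0 X W) = 0 := h2
    rw [fderiv_Hfun_P0, neg_eq_zero] at h3
    exact h3

theorem cls_eq_zero {X v : MA g} : cls X v = 0 ↔ ∃ c : ℂ, v = c • genD X := by
  rw [cls, Submodule.Quotient.mk_eq_zero, Submodule.mem_span_singleton]
  exact ⟨fun ⟨c, hc⟩ => ⟨c, hc.symm⟩, fun ⟨c, hc⟩ => ⟨c, hc.symm⟩⟩

theorem rX_top {X : MA g} (hX : X ∈ Stil g) : (rX X).coeff g = 1 := by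
  have h := hX.1
  rw [Hfun_top] at h
  rw [← h]; exact coeff_vPoly_fin X 2 (Fin.last g)

theorem fderiv_Hfun_zVec_self {X : MA g} (hX : X ∈ Stil g) : fderiv ℂ (Hfun g) X (zVec g) = 1 := by
  rw [fderiv_Hfun_zVec, rX_top hX]

theorem fderiv_Hfun_zVec_of_lt {i : ℕ} (hi : g < i) (X : MA g) :
    fderiv ℂ (Hfun i) X (zVec g) = 0 := by
  rw [fderiv_Hfun_zVec]
  exact Polynomial.coeff_eq_zero_of_natDegree_lt ((natDegree_vPoly X 2).trans_lt hi)

theorem zVec_mem_tanS (X : MA g) : zVec g ∈ tanS X := mem_tanS.2 fun i hi _ =>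
  fderiv_Hfun_zVec_of_lt (by omega) X

theorem zVec_not_mem_leafT {X : MA g} (hX : X ∈ Stil g) : cls X (zVec g) ∉ leafT X := by
  rw [leafT_eq]
  rintro ⟨v, ⟨_, hv⟩, h⟩
  have h1 : cls X (zVec g - v) = 0 := by
    rw [cls, Submodule.Quotient.mk_sub, sub_eq_zero]; exact h.symm
  obtain ⟨c, hc⟩ := cls_eq_zero.1 h1
  have h2 := congrArg (fderiv ℂ (Hfun g) X) hc
  have hv' : fderiv ℂ (Hfun g) X v = 0 := hv
  rw [map_sub, map_smul, fderiv_Hfun_genD, fderiv_Hfun_zVec_self hX, hv'] at h2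
  simp at h2

theorem leafT_sup_zVec {X : MA g} (hX : X ∈ Stil g) :
    leafT X ⊔ Submodule.span ℂ {cls X (zVec g)} = (tanS X).map (Submodule.mkQ _) := by
  apply le_antisymm
  · refine sup_le ?_ ?_
    · rw [leafT_eq]; exact Submodule.map_mono inf_le_left
    · rw [Submodule.span_le, Set.singleton_subset_iff]
      exact ⟨zVec g, zVec_mem_tanS X, rfl⟩
  · rintro _ ⟨v, hv, rfl⟩
    rw [Submodule.mem_sup]
    refine ⟨cls X (v - fderiv ℂ (Hfun g) X v • zVec g), ?_, fderiv ℂ (Hfun g) X v • cls X (zVec g),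
      Submodule.smul_mem _ _ (Submodule.mem_span_singleton_self _), ?_⟩
    · rw [leafT_eq]
      refine ⟨_, ⟨Submodule.sub_mem _ hv (Submodule.smul_mem _ _ (zVec_mem_tanS X)), ?_⟩, rfl⟩
      show fderiv ℂ (Hfun g) X _ = 0
      rw [map_sub, map_smul, fderiv_Hfun_zVec_self hX, smul_eq_mul, mul_one, sub_self]
    · rw [cls, cls, ← Submodule.Quotient.mk_smul, ← Submodule.Quotient.mk_add, sub_add_cancel]; rfl

/-! ### The symplectic form and the Nijenhuis tensor -/

/-- `W ↦ P_0 W` as a linear map onto the tangent space of the leaf. -/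
def hamL (X : MA g) : annih X →ₗ[ℂ] leafT X where
  toFun := ham X
  map_add' W W' := Subtype.ext (by
    show cls X (P0Lin X (W.1 + W'.1)) = cls X (P0Lin X W.1) + cls X (P0Lin X W'.1)
    rw [map_add]; rfl)
  map_smul' c W := Subtype.ext (by
    show cls X (P0Lin X (c • W.1)) = c • cls X (P0Lin X W.1)
    rw [map_smul]; rfl)

theorem hamL_apply (X : MA g) (W : annih X) : hamL X W = ham X W := rfl

theorem hamL_surjective (X : MA g) : Function.Surjective (hamL X) := by
  rintro ⟨_, _, ⟨W, hW, rfl⟩, rfl⟩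
  exact ⟨⟨W, hW⟩, rfl⟩

theorem exists_of_ham_eq_zero {X : MA g} {W : annih X} (h : ham X W = 0) :
    ∃ c : ℂ, P0 X W.1 = c • genD X :=
  cls_eq_zero.1 (congrArg Subtype.val h)

theorem pair_P0_of_ham_eq_zero {X : MA g} {W : annih X} (h : ham X W = 0) (W' : annih X) :
    pair W'.1 (P0 X W.1) = 0 := by
  obtain ⟨c, hc⟩ := exists_of_ham_eq_zero h
  rw [hc, pair_smul_right, mem_annih.1 W'.2, mul_zero]

/-- A covector that vanishes on `Z` and whose Hamiltonian vector field vanishes on `Ñ` is in the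
span of the `dH_i`, `i ≥ g + 1`; hence so does its Hamiltonian vector field for `P_1`. -/
theorem pair_P1_of_ham_eq_zero {X : MA g} (hX : X ∈ Stil g) {W : annih X} (h : ham X W = 0)
    (hz : pair W.1 (zVec g) = 0) (W' : annih X) : pair W'.1 (P1 X W.1) = 0 := by
  obtain ⟨c, hc⟩ := exists_of_ham_eq_zero h
  have h1 : P0 X (W.1 - c • grad (Hfun g) X) = 0 := by
    rw [← P0Lin_apply, map_sub, map_smul, P0Lin_apply, P0Lin_apply, hc, P0_grad_Hfun_self, sub_self]
  obtain ⟨d, hd⟩ := ker_P0 h1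
  have hcz : c = 0 := by
    have h2 := congrArg (fun V => pair V (zVec g)) hd
    simp only [pair_sub_left, pair_smul_left, pair_grad, fderiv_Hfun_zVec_self hX, hz,
      pair_sum_left] at h2
    rw [Finset.sum_eq_zero fun k _ => by rw [fderiv_Hfun_zVec_of_lt (by omega), mul_zero]] at h2
    linear_combination -h2
  rw [hcz, zero_smul, sub_zero] at hd
  rw [hd, ← P1Lin_apply, map_sum, ← pairB_apply, map_sum]
  refine Finset.sum_eq_zero fun k _ => ?_
  rw [map_smul, map_smul, pairB_apply, P1Lin_apply, show g + 1 + k = g + k + 1 by ring,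
    P1_grad_Hfun]
  cases k with
  | zero => rw [add_zero, P0_grad_Hfun_self, mem_annih.1 W'.2, smul_zero]
  | succ k => rw [P0_grad_Hfun_of_lt (by omega), pair_zero_right, smul_zero]

/-- `dH_g` as a covector that annihilates `E`. -/
def dHg (X : MA g) : annih X := ⟨grad (Hfun g) X, by rw [mem_annih, pair_grad, fderiv_Hfun_genD]⟩

theorem ham_dHg (X : MA g) : ham X (dHg X) = 0 := Subtype.ext (cls_eq_zero.2 ⟨1, by
  rw [one_smul]; exact P0_grad_Hfun_self X⟩)

/-- Every tangent vector of the leaf is the Hamiltonian vector of a covector that vanishes on `Z`.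
-/
theorem exists_ham_eq {X : MA g} (hX : X ∈ Stil g) (u : leafT X) :
    ∃ W : annih X, ham X W = u ∧ pair W.1 (zVec g) = 0 := by
  obtain ⟨W, rfl⟩ := hamL_surjective X u
  refine ⟨W - pair W.1 (zVec g) • dHg X, ?_, ?_⟩
  · rw [← hamL_apply, map_sub, map_smul, hamL_apply X (dHg X), ham_dHg, smul_zero, sub_zero]
  · show pair (W.1 - pair W.1 (zVec g) • grad (Hfun g) X) (zVec g) = 0
    rw [pair_sub_left, pair_smul_left, pair_grad, fderiv_Hfun_zVec_self hX, mul_one, sub_self]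

theorem exists_section (X : MA g) : ∃ σ : leafT X →ₗ[ℂ] annih X, ∀ u, ham X (σ u) = u := by
  obtain ⟨σ, hσ⟩ := LinearMap.exists_rightInverse_of_surjective (hamL X)
    (LinearMap.range_eq_top.2 (hamL_surjective X))
  exact ⟨σ, fun u => LinearMap.congr_fun hσ u⟩

/-- Two covectors with the same Hamiltonian vector. -/
theorem ham_sub_eq_zero {X : MA g} {W W' : annih X} (h : ham X W = ham X W') :
    ham X (W - W') = 0 := by
  rw [← hamL_apply, map_sub, hamL_apply, hamL_apply, h, sub_self]

theorem existsUnique_leafForm (X : MA g) : ∃! ω, IsLeafForm X ω := by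
  obtain ⟨σ, hσ⟩ := exists_section X
  refine ⟨(pairB g).compl₁₂ ((annih X).subtype ∘ₗ σ) (P0Lin X ∘ₗ (annih X).subtype ∘ₗ σ), ?_, ?_⟩
  · intro W W'
    show pair (σ (ham X W)).1 (P0 X (σ (ham X W')).1) = _
    have h1 := pair_P0_of_ham_eq_zero (ham_sub_eq_zero (hσ (ham X W'))) (σ (ham X W))
    have h2 := pair_P0_of_ham_eq_zero (ham_sub_eq_zero (hσ (ham X W))) W'
    rw [pair_P0_skew, neg_eq_zero, AddSubgroupClass.coe_sub, pair_sub_left, sub_eq_zero] at h2 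
    rw [AddSubgroupClass.coe_sub, ← P0Lin_apply, map_sub, pair_sub_right, sub_eq_zero] at h1
    rw [← h2]; exact h1
  · intro ω hω
    refine LinearMap.ext₂ fun u v => ?_
    have h := hω (σ u) (σ v)
    rw [hσ, hσ] at h
    exact h

theorem leafForm_skew {X : MA g} {ω : LinearMap.BilinForm ℂ (leafT X)} (hω : IsLeafForm X ω)
    (u v : leafT X) : ω u v = -ω v u := by
  obtain ⟨W, rfl⟩ := hamL_surjective X u
  obtain ⟨W', rfl⟩ := hamL_surjective X v
  rw [hamL_apply, hamL_apply, hω, hω, pair_P0_skew]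

theorem leafForm_eq_zero {X : MA g} {ω : LinearMap.BilinForm ℂ (leafT X)} (hω : IsLeafForm X ω)
    {v : leafT X} (h : ∀ u, ω u v = 0) : v = 0 := by
  obtain ⟨W', rfl⟩ := hamL_surjective X v
  by_contra hv
  have hv' : P0 X W'.1 ∉ Submodule.span ℂ {genD X} := fun h' => hv (Subtype.ext (by
    rw [hamL_apply]
    exact (Submodule.Quotient.mk_eq_zero _).2 h'))
  obtain ⟨f, hf, hf0⟩ := Submodule.exists_le_ker_of_notMem hv'
  obtain ⟨W, hW⟩ := exists_pair_eq f
  have hWa : W ∈ annih X := by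
    rw [mem_annih, hW]; exact hf0 (Submodule.mem_span_singleton_self _)
  refine hf ?_
  rw [← hW, ← hω ⟨W, hWa⟩ W']
  exact h _

theorem existsUnique_nijenhuis {X : MA g} (hX : X ∈ Stil g) {ω : LinearMap.BilinForm ℂ (leafT X)}
    (hω : IsLeafForm X ω) : ∃! N, IsNijenhuis X ω N := by
  obtain ⟨σ, hσ⟩ := exists_section X
  -- the Hamiltonian vectors of the covectors that vanish on `Z`
  let τ : leafT X →ₗ[ℂ] MA g := (annih X).subtype ∘ₗ σ
    - (((pairB g).flip (zVec g)) ∘ₗ (annih X).subtype ∘ₗ σ).smulRight (grad (Hfun g) X)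
  have hτ : ∀ u, τ u = (σ u).1 - pair (σ u).1 (zVec g) • grad (Hfun g) X := fun u => rfl
  have hτz : ∀ u, pair (τ u) (zVec g) = 0 := fun u => by
    rw [hτ, pair_sub_left, pair_smul_left, pair_grad, fderiv_Hfun_zVec_self hX, mul_one, sub_self]
  have hτa : ∀ u, τ u ∈ annih X := fun u =>
    (σ u - pair (σ u).1 (zVec g) • dHg X).2
  have hτh : ∀ u, ham X ⟨τ u, hτa u⟩ = u := fun u => by
    have : (⟨τ u, hτa u⟩ : annih X) = σ u - pair (σ u).1 (zVec g) • dHg X := rfl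
    rw [this, ← hamL_apply, map_sub, map_smul, hamL_apply, hamL_apply, ham_dHg, smul_zero,
      sub_zero, hσ]
  -- `P_1` as a form on the tangent space of the leaf; it is well defined on covectors that vanish on `Z`
  let β : LinearMap.BilinForm ℂ (leafT X) := (pairB g).compl₁₂ τ (P1Lin X ∘ₗ τ)
  have hβ : ∀ W W' : annih X, pair W.1 (zVec g) = 0 → pair W'.1 (zVec g) = 0 →
      β (ham X W) (ham X W') = pair W.1 (P1 X W'.1) := fun W W' hW hW' => by
    show pair (τ (ham X W)) (P1 X (τ (ham X W'))) = _
    have z1 : pair (⟨_, hτa (ham X W)⟩ - W : annih X).1 (zVec g) = 0 := by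
      rw [AddSubgroupClass.coe_sub, pair_sub_left, hτz, hW, sub_zero]
    have z2 : pair (⟨_, hτa (ham X W')⟩ - W' : annih X).1 (zVec g) = 0 := by
      rw [AddSubgroupClass.coe_sub, pair_sub_left, hτz, hW', sub_zero]
    have h1 := pair_P1_of_ham_eq_zero hX (ham_sub_eq_zero (hτh (ham X W'))) z2 ⟨_, hτa (ham X W)⟩
    have h2 := pair_P1_of_ham_eq_zero hX (ham_sub_eq_zero (hτh (ham X W))) z1 W'
    rw [pair_P1_skew, neg_eq_zero, AddSubgroupClass.coe_sub, pair_sub_left, sub_eq_zero] at h2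
    rw [AddSubgroupClass.coe_sub, ← P1Lin_apply, map_sub, pair_sub_right, sub_eq_zero] at h1
    rw [← h2]; exact h1
  have hnd : ω.Nondegenerate := by
    refine ⟨fun u hu => leafForm_eq_zero hω fun v => ?_, fun v hv => leafForm_eq_zero hω hv⟩
    rw [leafForm_skew hω, hu, neg_zero]
  refine ⟨-((LinearMap.BilinForm.toDual ω hnd).symm.toLinearMap ∘ₗ β.flip), ?_, ?_⟩
  · intro W W' hW hW'
    rw [leafForm_skew hω, LinearMap.neg_apply, map_neg, LinearMap.neg_apply, neg_neg,
      LinearMap.comp_apply, LinearEquiv.coe_coe, ← LinearMap.BilinForm.toDual_def (b := hnd),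
      LinearEquiv.apply_symm_apply]
    exact hβ W W' hW hW'
  · intro N hN
    refine LinearMap.ext fun v => sub_eq_zero.1 (leafForm_eq_zero hω fun u => ?_)
    obtain ⟨W, rfl, hW⟩ := exists_ham_eq hX u
    obtain ⟨W', rfl, hW'⟩ := exists_ham_eq hX v
    rw [map_sub, hN W W' hW hW', leafForm_skew hω, LinearMap.neg_apply, map_neg,
      LinearMap.neg_apply,
      neg_neg, LinearMap.comp_apply, LinearEquiv.coe_coe,
        ← LinearMap.BilinForm.toDual_def (b := hnd),
      LinearEquiv.apply_symm_apply, sub_eq_zero]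
    exact (hβ W W' hW hW').symm

/-! ### Derivatives of holomorphic functions of several variables -/

/-- The directional derivatives of a holomorphic function of several variables are holomorphic: they
are given by Cauchy integrals, which can be differentiated under the integral sign. -/
theorem differentiableAt_fderiv_apply {E : Type*} [NormedAddCommGroup E] [NormedSpace ℂ E]
    [FiniteDimensional ℂ E] {f : E → ℂ} {y₀ : E}
      (hf : ∀ᶠ y in 𝓝 y₀, DifferentiableAt ℂ f y) (v : E) :
    DifferentiableAt ℂ (fun y => fderiv ℂ f y v) y₀ := by
  have hcont : ∀ᶠ y in 𝓝 y₀, f y ∈ Metric.ball (f y₀) 1 :=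
    hf.self_of_nhds.continuousAt.eventually (Metric.ball_mem_nhds _ one_pos)
  obtain ⟨δ, hδ, hball⟩ := Metric.eventually_nhds_iff_ball.1 (hf.and hcont)
  obtain ⟨ε, hε, rfl⟩ : ∃ ε > 0, δ = 4 * ε := ⟨δ / 4, by positivity, by ring⟩
  set ρ : ℝ := ε / (‖v‖ + 1) with hρ
  have hv1 : 0 < ‖v‖ + 1 := by positivity
  have hρ0 : 0 < ρ := by positivity
  have hρv : ρ * ‖v‖ < ε := by
    rw [hρ, div_mul_eq_mul_div, div_lt_iff₀ hv1]; nlinarith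
  have hmem : ∀ y ∈ Metric.ball y₀ ε, ∀ ζ : ℂ, ‖ζ‖ ≤ ρ → y + ζ • v ∈ Metric.ball y₀ (2 * ε) := by
    intro y hy ζ hζ
    rw [Metric.mem_ball, dist_eq_norm] at hy ⊢
    calc ‖y + ζ • v - y₀‖ = ‖(y - y₀) + ζ • v‖ := by congr 1; abel
      _ ≤ ‖y - y₀‖ + ‖ζ • v‖ := norm_add_le _ _
      _ < ε + ε := add_lt_add_of_lt_of_le hy (by
          rw [norm_smul]
          exact (mul_le_mul_of_nonneg_right hζ (norm_nonneg v)).trans hρv.le)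
      _ = 2 * ε := by ring
  have hd : ∀ w ∈ Metric.ball y₀ (2 * ε), DifferentiableAt ℂ f w := fun w hw =>
    (hball w (Metric.ball_subset_ball (by linarith) hw)).1
  -- the Cauchy estimate bounds the integrand of the derivative
  have hbd : ∀ w ∈ Metric.ball y₀ (2 * ε), ‖fderiv ℂ f w‖ ≤ 2 / (2 * ε) := by
    intro w hw
    have hsub : Metric.ball w (2 * ε) ⊆ Metric.ball y₀ (4 * ε) :=
      Metric.ball_subset_ball' (by rw [Metric.mem_ball] at hw; linarith)
    refine Complex.norm_fderiv_le_div_of_mapsTo_ball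
      (fun x hx => (hball x (hsub hx)).1.differentiableWithinAt) (fun x hx => ?_) (by positivity)
    have h1 := (hball x (hsub hx)).2
    have h2 := (hball w (hsub (Metric.mem_ball_self (by positivity)))).2
    rw [Metric.mem_ball] at h1 h2
    refine Metric.mem_closedBall.2 ((dist_triangle_right _ _ (f y₀)).trans (by linarith))
  have hc : ∀ θ : ℝ, ‖circleMap 0 ρ θ‖ = ρ := fun θ => by simp [abs_of_pos hρ0]
  have hc0 : ∀ θ : ℝ, circleMap 0 ρ θ ≠ 0 := fun θ => by
    rw [← norm_ne_zero_iff, hc]; exact hρ0.ne'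
  set k : ℝ → ℂ := fun θ => deriv (circleMap 0 ρ) θ * (1 / (circleMap 0 ρ θ - 0) ^ 2) with hk
  have hkc : Continuous k := by
    have h1 : Continuous (deriv (circleMap 0 ρ)) := by
      have : deriv (circleMap 0 ρ) = fun θ => circleMap 0 ρ θ * Complex.I := funext fun θ =>
        deriv_circleMap 0 ρ θ
      rw [this]; exact (continuous_circleMap 0 ρ).mul continuous_const
    exact h1.mul (continuous_const.div (((continuous_circleMap 0 ρ).sub continuous_const).pow 2) fun θ => by
      rw [sub_zero]; exact pow_ne_zero _ (hc0 θ))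
  have hkn : ∀ θ, ‖k θ‖ = 1 / ρ := fun θ => by
    simp only [hk, deriv_circleMap, sub_zero, norm_mul, norm_div, norm_pow, hc,
      Complex.norm_I, norm_one]
    field_simp
  -- the Cauchy integral for the derivative
  have hcauchy : ∀ y ∈ Metric.ball y₀ ε, fderiv ℂ f y v = (2 * Real.pi * Complex.I)⁻¹ *
      ∫ θ in (0 : ℝ)..2 * Real.pi, k θ * f (y + circleMap 0 ρ θ • v) := by
    intro y hy
    have h1 : DifferentiableOn ℂ (fun ζ : ℂ => f (y + ζ • v)) (Metric.closedBall 0 ρ) :=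
      fun ζ hζ => by
      refine DifferentiableAt.differentiableWithinAt ?_
      have := hd _ (hmem y hy ζ (by simpa using hζ))
      exact this.comp ζ (by fun_prop)
    have h2 := h1.deriv_eq_smul_circleIntegral hρ0
    have h3 : deriv (fun ζ : ℂ => f (y + ζ • v)) 0 = fderiv ℂ f y v := by
      have h4 : HasFDerivAt f (fderiv ℂ f y) (y + (0 : ℂ) • v) := by
        rw [zero_smul, add_zero]
        exact (hd y (Metric.ball_subset_ball (by linarith) hy)).hasFDerivAt
      have h5 : HasDerivAt (fun ζ : ℂ => y + ζ • v) v 0 := by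
        simpa using ((hasDerivAt_id (0 : ℂ)).smul_const v).const_add y
      exact (h4.comp_hasDerivAt 0 h5).deriv
    rw [h3, circleIntegral] at h2
    simp only [smul_eq_mul, ← mul_assoc] at h2
    have h6 : (2 * Real.pi * Complex.I : ℂ) ≠ 0 := Complex.two_pi_I_ne_zero
    rw [eq_inv_mul_iff_mul_eq₀ h6, ← h2]
  -- differentiation under the integral sign
  have hdiff : HasFDerivAt (fun y => ∫ θ in (0 : ℝ)..2 * Real.pi, k θ * f (y + circleMap 0 ρ θ • v))
      (∫ θ in (0 : ℝ)..2 * Real.pi, k θ • fderiv ℂ f (y₀ + circleMap 0 ρ θ • v)) y₀ := by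
    have hFc : ∀ y ∈ Metric.ball y₀ ε, Continuous fun θ : ℝ =>
      k θ * f (y + circleMap 0 ρ θ • v) := by
      intro y hy
      refine hkc.mul (continuous_iff_continuousAt.2 fun θ => ?_)
      have := (hd _ (hmem y hy (circleMap 0 ρ θ) (hc θ).le)).continuousAt
      exact ContinuousAt.comp (f := fun θ : ℝ => y + circleMap 0 ρ θ • v) this (by fun_prop)
    refine intervalIntegral.hasFDerivAt_integral_of_dominated_of_fderiv_le
      (F := fun y θ => k θ * f (y + circleMap 0 ρ θ • v))
      (F' := fun y θ => k θ • fderiv ℂ f (y + circleMap 0 ρ θ • v))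
      (bound := fun _ => 1 / ρ * (2 / (2 * ε))) (Metric.ball_mem_nhds y₀ hε) ?_ ?_ ?_ ?_ ?_ ?_
    · filter_upwards [Metric.ball_mem_nhds y₀ hε] with y hy
      exact (hFc y hy).aestronglyMeasurable
    · exact (hFc y₀ (Metric.mem_ball_self hε)).intervalIntegrable _ _
    · borelize E
      have : FiniteDimensional ℂ (E →L[ℂ] ℂ) := inferInstance
      have : ProperSpace (E →L[ℂ] ℂ) := FiniteDimensional.proper ℂ _
      have h1 : Measurable fun θ : ℝ => fderiv ℂ f (y₀ + circleMap 0 ρ θ • v) :=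
        (measurable_fderiv ℂ f).comp (Continuous.measurable (by fun_prop))
      exact hkc.aestronglyMeasurable.smul h1.aestronglyMeasurable
    · refine Filter.Eventually.of_forall fun θ _ y hy => ?_
      rw [norm_smul, hkn]
      exact mul_le_mul_of_nonneg_left (hbd _ (hmem y hy _ (hc θ).le)) (by positivity)
    · exact intervalIntegrable_const
    · refine Filter.Eventually.of_forall fun θ _ y hy => ?_
      have h1 := (hd _ (hmem y hy (circleMap 0 ρ θ) (hc θ).le)).hasFDerivAt
      have h2 : HasFDerivAt (fun y : E => y + circleMap 0 ρ θ • v) (ContinuousLinearMap.id ℂ E) y :=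
        (hasFDerivAt_id y).add_const _
      have h3 := (h1.comp y h2).const_mul (k θ)
      simpa using h3
  refine (hdiff.differentiableAt.const_mul ((2 * Real.pi * Complex.I : ℂ)⁻¹)).congr_of_eventuallyEq ?_
  filter_upwards [Metric.ball_mem_nhds y₀ hε] with y hy
  exact hcauchy y hy

/-! ### A global chart of the reduced manifold -/

/-- The model space of the chart: the coefficients of the `(1,2)` entry and of the `(1,1)` entry
below the top ones, at the point of the leaf of `E` where the `(1,1)` entry has degree `< g`, and
the value of `H_g`. -/
abbrev Chart (g : ℕ) := (Fin g → ℂ) × (Fin g → ℂ) × ℂ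

/-- Polynomials on `M_A`, invariant along `E`, which are the coordinates of the chart on `S̃`. -/
def chartPt (X : MA g) : Chart g :=
  (fun i => X i.castSucc 2,
    fun i => X (Fin.last g) 2 * X i.castSucc 0 - X (Fin.last g) 0 * X i.castSucc 2, Hfun g X)

/-- The polynomial `∑ a_i λ^i` of degree `< g`. -/
def lowPoly (a : Fin g → ℂ) : ℂ[X] := ∑ i : Fin g, Polynomial.C (a i) * Polynomial.X ^ (i : ℕ)

theorem coeff_lowPoly (a : Fin g → ℂ) (k : ℕ) :
    (lowPoly a).coeff k = if hk : k < g then a ⟨k, hk⟩ else 0 := by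
  rw [lowPoly, Polynomial.finsetSum_coeff]
  simp only [Polynomial.coeff_C_mul, Polynomial.coeff_X_pow, mul_ite, mul_one, mul_zero]
  split_ifs with hk
  · rw [Finset.sum_eq_single ⟨k, hk⟩]
    · simp
    · intro b _ hb
      rw [if_neg]; rintro rfl; exact hb rfl
    · simp
  · refine Finset.sum_eq_zero fun i _ => if_neg ?_
    have := i.2; omega

theorem degree_lowPoly (a : Fin g → ℂ) : (lowPoly a).degree < g :=
  (Polynomial.degree_lt_iff_coeff_zero _ _).2 fun m hm => by
    rw [coeff_lowPoly, dif_neg (by have : g ≤ m := by exact_mod_cast hm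
                                   omega)]

/-- The `(1,2)` entry of the point with given chart coordinates. -/
def rC (y : Chart g) : ℂ[X] := Polynomial.X ^ g + lowPoly y.1
/-- The `(1,1)` entry of the point with given chart coordinates. -/
def pC (y : Chart g) : ℂ[X] := lowPoly y.2.1
/-- The `(2,1)` entry of the point with given chart coordinates: it is the quotient for which
`p² + q r = λ^(2g+1) + H_g λ^g + O(λ^(g-1))`. -/
def qC (y : Chart g) : ℂ[X] :=
  (Polynomial.X ^ (2 * g + 1) + (Polynomial.C y.2.2 * Polynomial.X ^ g - pC y ^ 2)) /ₘ rC y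

theorem rC_monic (y : Chart g) : (rC y).Monic := Polynomial.monic_X_pow_add (degree_lowPoly _)

theorem natDegree_rC (y : Chart g) : (rC y).natDegree = g := by
  rw [rC, Polynomial.natDegree_eq_of_degree_eq_some]
  rw [Polynomial.degree_add_eq_left_of_degree_lt] <;> rw [Polynomial.degree_X_pow]
  exact degree_lowPoly _

theorem degree_rC (y : Chart g) : (rC y).degree = g := by
  rw [Polynomial.degree_eq_natDegree (rC_monic y).ne_zero, natDegree_rC]

theorem natDegree_pC (y : Chart g) : (pC y).natDegree ≤ g :=
  Polynomial.natDegree_le_of_degree_le (degree_lowPoly _).le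

theorem coeff_pC (y : Chart g) {k : ℕ} (hk : g ≤ k) : (pC y).coeff k = 0 := by
  rw [pC, coeff_lowPoly, dif_neg (by omega)]

theorem coeff_rC (y : Chart g) (k : ℕ) :
    (rC y).coeff k = (if k = g then 1 else 0) + if hk : k < g then y.1 ⟨k, hk⟩ else 0 := by
  rw [rC, Polynomial.coeff_add, Polynomial.coeff_X_pow, coeff_lowPoly]

theorem degree_numerator (y : Chart g) :
    (Polynomial.C y.2.2 * Polynomial.X ^ g - pC y ^ 2).degree < ((2 * g + 1 : ℕ) : WithBot ℕ) := by
  refine (Polynomial.degree_lt_iff_coeff_zero _ _).2 fun m hm => ?_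
  have hm : 2 * g + 1 ≤ m := by exact_mod_cast hm
  refine Polynomial.coeff_eq_zero_of_natDegree_lt (lt_of_le_of_lt (Polynomial.natDegree_sub_le _ _) (max_lt ?_ ?_))
  · exact (Polynomial.natDegree_C_mul_X_pow_le _ _).trans_lt (by omega)
  · exact (Polynomial.natDegree_pow_le_of_le 2 (natDegree_pC y)).trans_lt (by omega)

theorem numerator_monic (y : Chart g) :
    (Polynomial.X ^ (2 * g + 1) + (Polynomial.C y.2.2 * Polynomial.X ^ g - pC y ^ 2)).Monic :=
  Polynomial.monic_X_pow_add (degree_numerator y)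

theorem degree_num (y : Chart g) :
    (Polynomial.X ^ (2 * g + 1) + (Polynomial.C y.2.2 * Polynomial.X ^ g - pC y ^ 2)).degree
      = ((2 * g + 1 : ℕ) : WithBot ℕ) := by
  rw [Polynomial.degree_add_eq_left_of_degree_lt] <;> rw [Polynomial.degree_X_pow]
  exact degree_numerator y

theorem natDegree_qC (y : Chart g) : (qC y).natDegree = g + 1 := by
  rw [qC, Polynomial.natDegree_divByMonic _ (rC_monic y), natDegree_rC,
    Polynomial.natDegree_eq_of_degree_eq_some (degree_num y)]
  omega

theorem coeff_qC (y : Chart g) {k : ℕ} (hk : g + 1 ≤ k) :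
    (qC y).coeff k = if k = g + 1 then 1 else 0 := by
  split_ifs with h
  · rw [h, ← natDegree_qC y, Polynomial.coeff_natDegree, qC,
      Polynomial.leadingCoeff_divByMonic_of_monic (rC_monic y), numerator_monic y]
    rw [degree_num, degree_rC]
    exact_mod_cast (by omega : g ≤ 2 * g + 1)
  · exact Polynomial.coeff_eq_zero_of_natDegree_lt (by rw [natDegree_qC]; omega)

theorem coeff_det_C (y : Chart g) {k : ℕ} (hk : g ≤ k) : (pC y ^ 2 + rC y * qC y).coeff k
    = (if k = 2 * g + 1 then 1 else 0) + if k = g then y.2.2 else 0 := by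
  have h := Polynomial.modByMonic_add_div
    (Polynomial.X ^ (2 * g + 1) + (Polynomial.C y.2.2 * Polynomial.X ^ g - pC y ^ 2)) (rC y)
  have h1 : pC y ^ 2 + rC y * qC y = Polynomial.X ^ (2 * g + 1) + Polynomial.C y.2.2
    * Polynomial.X ^ g
      - (Polynomial.X ^ (2 * g + 1)
        + (Polynomial.C y.2.2 * Polynomial.X ^ g - pC y ^ 2)) %ₘ rC y := by
    rw [qC]; linear_combination h
  have h2 := Polynomial.degree_modByMonic_lt
    (Polynomial.X ^ (2 * g + 1) + (Polynomial.C y.2.2 * Polynomial.X ^ g - pC y ^ 2)) (rC_monic y)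
  rw [degree_rC] at h2
  rw [h1, Polynomial.coeff_sub,
    (Polynomial.degree_lt_iff_coeff_zero _ _).1 h2 k (by exact_mod_cast hk),
    Polynomial.coeff_add, Polynomial.coeff_X_pow, Polynomial.coeff_C_mul, Polynomial.coeff_X_pow]
  simp

/-- The point of `S̃` with given chart coordinates and `(1,1)` entry of degree `< g`. -/
def sec (y : Chart g) : MA g := fun i => ![(pC y).coeff i, (qC y).coeff i, (rC y).coeff i]

theorem pX_sec (y : Chart g) : pX (sec y) = pC y := by
  ext k
  rw [pX, coeff_vPoly]
  split_ifs with h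
  · rfl
  · rw [coeff_pC y (by omega)]

theorem rX_sec (y : Chart g) : rX (sec y) = rC y := by
  ext k
  rw [rX, coeff_vPoly]
  split_ifs with h
  · rfl
  · rw [Polynomial.coeff_eq_zero_of_natDegree_lt (by rw [natDegree_rC]; omega)]

theorem qX_sec (y : Chart g) : qX (sec y) = qC y := by
  ext k
  rw [qX, Polynomial.coeff_add, Polynomial.coeff_X_pow, coeff_vPoly]
  split_ifs with h h' h'
  · omega
  · rw [add_zero]; rfl
  · rw [coeff_qC y (by omega), if_pos h', zero_add]
  · rw [coeff_qC y (by omega), if_neg h', zero_add]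

theorem Hfun_sec (y : Chart g) {k : ℕ} (hk : g ≤ k) :
    Hfun k (sec y) = (if k = 2 * g + 1 then 1 else 0) + if k = g then y.2.2 else 0 := by
  rw [Hfun_eq, pX_sec, rX_sec, qX_sec, coeff_det_C y hk]

theorem sec_mem (y : Chart g) : sec y ∈ Stil g := by
  refine ⟨?_, fun i hi hi' => ?_⟩
  · rw [Hfun_sec y (by omega), if_pos rfl, if_neg (by omega), add_zero]
  · rw [Hfun_sec y (by omega), if_neg (by omega), if_neg (by omega), add_zero]

theorem sec_last_zero (y : Chart g) : sec y (Fin.last g) 0 = 0 := coeff_pC y le_rfl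

theorem sec_last_two (y : Chart g) : sec y (Fin.last g) 2 = 1 := by
  show (rC y).coeff g = 1
  rw [coeff_rC, if_pos rfl, dif_neg (lt_irrefl g), add_zero]

theorem chartPt_sec (y : Chart g) : chartPt (sec y) = y := by
  refine Prod.ext ?_ (Prod.ext ?_ ?_)
  · funext i
    show (rC y).coeff i = _
    rw [coeff_rC, if_neg i.2.ne, dif_pos i.2, zero_add]
  · funext i
    show sec y (Fin.last g) 2 * (pC y).coeff i - sec y (Fin.last g) 0 * _ = _
    rw [sec_last_zero, sec_last_two, pC, coeff_lowPoly, dif_pos i.2]; ring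
  · show Hfun g (sec y) = _
    rw [Hfun_sec y le_rfl, if_neg (by omega), if_pos rfl, zero_add]

theorem Hfun_of_mem {X : MA g} (hX : X ∈ Stil g) {k : ℕ} (hk : g < k) :
    Hfun k X = if k = 2 * g + 1 then 1 else 0 := by
  split_ifs with h
  · rw [h]; exact hX.1
  · by_cases h' : k ≤ 2 * g
    · exact hX.2 k hk h'
    · rw [Hfun_eq]
      refine Polynomial.coeff_eq_zero_of_natDegree_lt
        (lt_of_le_of_lt (Polynomial.natDegree_add_le _ _) (max_lt ?_ ?_))
      · exact (Polynomial.natDegree_pow_le_of_le 2 (natDegree_vPoly X 0)).trans_lt (by omega)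
      · exact (Polynomial.natDegree_mul_le_of_le (natDegree_vPoly X 2) (natDegree_qX X)).trans_lt (by omega)

theorem last_two_of_mem {X : MA g} (hX : X ∈ Stil g) : X (Fin.last g) 2 = 1 := by
  exact (Hfun_top X).symm.trans hX.1

theorem sec_chartPt {X : MA g} (hX : X ∈ Stil g) (h0 : X (Fin.last g) 0 = 0) :
    sec (chartPt X) = X := by
  have h2 := last_two_of_mem hX
  have hp : pC (chartPt X) = pX X := by
    ext k
    rw [pC, coeff_lowPoly, pX, coeff_vPoly]
    by_cases hk : k < g
    · rw [dif_pos hk, dif_pos (by omega)]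
      show X (Fin.last g) 2 * X _ 0 - X (Fin.last g) 0 * X _ 2 = _
      rw [h2, h0, one_mul, zero_mul, sub_zero]; rfl
    · rw [dif_neg hk]
      split_ifs with hk'
      · obtain rfl : k = g := by omega
        exact h0.symm
      · rfl
  have hr : rC (chartPt X) = rX X := by
    ext k
    rw [coeff_rC, rX, coeff_vPoly]
    by_cases hk : k < g
    · rw [if_neg (by omega), dif_pos hk, dif_pos (by omega), zero_add]; rfl
    · rw [dif_neg hk, add_zero]
      split_ifs with h' hk' hk'
      · subst h'; exact h2.symm
      · omega
      · omega
      · rfl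
  -- `rX * qX` differs from `λ^(2g+1) + H_g λ^g - pX²` by a polynomial of degree `< g`
  have hq : qC (chartPt X) = qX X := by
    rw [qC, hp]
    refine (Polynomial.div_modByMonic_unique _ ((Polynomial.X ^ (2 * g + 1) + (Polynomial.C (Hfun g X) * Polynomial.X ^ g
      - pX X ^ 2)) - rX X * qX X) (rC_monic _) ⟨?_, ?_⟩).1
    · rw [hr]; simp [chartPt]
    · rw [degree_rC]
      refine (Polynomial.degree_lt_iff_coeff_zero _ _).2 fun m hm => ?_
      have hm : g ≤ m := by exact_mod_cast hm
      have e := Hfun_eq m X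
      rw [show Polynomial.X ^ (2 * g + 1) + (Polynomial.C (Hfun g X) * Polynomial.X ^ g - pX X ^ 2)
        - rX X * qX X = Polynomial.X ^ (2 * g + 1) + Polynomial.C (Hfun g X) * Polynomial.X ^ g
          - (pX X ^ 2 + rX X * qX X) by ring, Polynomial.coeff_sub, ← e, Polynomial.coeff_add,
        Polynomial.coeff_X_pow, Polynomial.coeff_C_mul, Polynomial.coeff_X_pow]
      rcases hm.eq_or_lt with rfl | hm
      · rw [if_neg (by omega), if_pos rfl]; ring
      · rw [Hfun_of_mem hX hm, if_neg (show ¬ m = g by omega)]; ring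
  refine vPoly_injective fun a => ?_
  fin_cases a
  · exact (pX_sec _).trans hp
  · have := (qX_sec _).trans hq
    rw [qX, qX] at this
    exact add_right_cancel this
  · exact (rX_sec _).trans hr

/-! ### The flow of `E` -/

theorem flowD_apply (t : ℂ) (X : MA g) (i : Fin (g + 1)) :
    flowD t X i = ![X i 0 - t * X i 2, X i 1 + 2 * t * X i 0 - t ^ 2 * X i 2, X i 2] := by
  ext a
  fin_cases a <;> simp [flowD, slCoord, slMat, expA, matA, Matrix.mul_apply,
    Fin.sum_univ_two] <;> ring

theorem flowD_mem (t : ℂ) {X : MA g} (hX : X ∈ Stil g) : flowD t X ∈ Stil g :=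
  ⟨by rw [Hfun_flowD]; exact hX.1, fun i h h' => by rw [Hfun_flowD]; exact hX.2 i h h'⟩

theorem chartPt_flowD (t : ℂ) (X : MA g) : chartPt (flowD t X) = chartPt X := by
  refine Prod.ext ?_ (Prod.ext ?_ (Hfun_flowD g t X)) <;> funext i <;> simp [chartPt, flowD_apply]
  ring

/-- Every point of `S̃` is obtained by the flow of `E` from the point with the same chart
coordinates in the image of `sec`. -/
theorem flowD_sec_chartPt {X : MA g} (hX : X ∈ Stil g) :
    flowD (-X (Fin.last g) 0) (sec (chartPt X)) = X := by
  have h1 : sec (chartPt (flowD (X (Fin.last g) 0) X)) = flowD (X (Fin.last g) 0) X :=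
    sec_chartPt (flowD_mem _ hX) (by rw [flowD_apply, last_two_of_mem hX]; simp)
  rw [chartPt_flowD] at h1
  rw [h1, flowD_flowD, neg_add_cancel, flowD_zero]

/-- The section of `S̃ → Ñ` defined by the chart. -/
def secS (y : Chart g) : Stil g := ⟨sec y, sec_mem y⟩

theorem proj_eq_of_eq_flowD {X Y : Stil g} (t : ℂ) (h : (Y : MA g) = flowD t X) : proj Y = proj X :=
  (Quotient.sound (s := leafSetoid g) (a := X) (b := Y) ⟨t, h⟩).symm

theorem proj_secS_chartPt (X : Stil g) : proj (secS (chartPt (X : MA g))) = proj X := by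
  exact (proj_eq_of_eq_flowD (X := secS (chartPt (X : MA g))) (-(X : MA g) (Fin.last g) 0)
    (flowD_sec_chartPt X.2).symm).symm

theorem chartPt_eq_of_proj_eq {X Y : Stil g} (h : proj X = proj Y) :
    chartPt (X : MA g) = chartPt (Y : MA g) := by
  obtain ⟨t, ht⟩ : ∃ t : ℂ, (Y : MA g) = flowD t X := Quotient.exact h
  rw [ht, chartPt_flowD]

theorem exists_flowD_of_proj_eq {X Y : Stil g} (h : proj X = proj Y) :
    ∃ t : ℂ, (Y : MA g) = flowD t X :=
  Quotient.exact h

/-! ### Differentiability of the chart -/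

theorem differentiable_apply (i : Fin (g + 1)) (a : Fin 3) :
    Differentiable ℂ fun X : MA g => X i a := by
  fun_prop

theorem differentiable_chartPt : Differentiable ℂ (chartPt : MA g → Chart g) := by
  refine Differentiable.prodMk ?_ (Differentiable.prodMk ?_ (differentiable_Hfun g))
  · rw [differentiable_pi]; intro i; exact differentiable_apply _ _
  · rw [differentiable_pi]; intro i; fun_prop

theorem fderiv_chartPt (X V : MA g) : fderiv ℂ chartPt X V =
    (fun i => V i.castSucc 2,
      fun i => X (Fin.last g) 2 * V i.castSucc 0 + X i.castSucc 0 * V (Fin.last g) 2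
        - (X (Fin.last g) 0 * V i.castSucc 2 + X i.castSucc 2 * V (Fin.last g) 0),
      fderiv ℂ (Hfun g) X V) := by
  have ha : ∀ (i : Fin (g + 1)) (a : Fin 3), HasFDerivAt (fun X : MA g => X i a)
      ((ContinuousLinearMap.proj (R := ℂ) (φ := fun _ => ℂ) a).comp
      (ContinuousLinearMap.proj (R := ℂ) (φ := fun _ : Fin (g + 1) => Fin 3 → ℂ) i)) X := fun i a =>
    ContinuousLinearMap.hasFDerivAt ((ContinuousLinearMap.proj (R := ℂ) (φ := fun _ => ℂ) a).comp
      (ContinuousLinearMap.proj (R := ℂ) (φ := fun _ : Fin (g + 1) => Fin 3 → ℂ) i))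
  have h1 : HasFDerivAt (fun X : MA g => fun i : Fin g => X i.castSucc 2) _ X :=
    hasFDerivAt_pi.2 fun i => ha i.castSucc 2
  have h2 : HasFDerivAt (fun X : MA g => fun i : Fin g =>
      X (Fin.last g) 2 * X i.castSucc 0 - X (Fin.last g) 0 * X i.castSucc 2) _ X :=
    hasFDerivAt_pi.2 fun i => ((ha (Fin.last g) 2).mul (ha i.castSucc 0)).sub
      ((ha (Fin.last g) 0).mul (ha i.castSucc 2))
  have h3 := h1.prodMk (h2.prodMk (differentiable_Hfun g X).hasFDerivAt)
  have h4 : fderiv ℂ (chartPt : MA g → Chart g) X = _ := h3.fderiv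
  rw [h4]
  rfl

theorem differentiable_coeff_lowPoly {E : Type*} [NormedAddCommGroup E] [NormedSpace ℂ E]
    {a : E → Fin g → ℂ} (ha : Differentiable ℂ a) (k : ℕ) :
    Differentiable ℂ fun y => (lowPoly (a y)).coeff k := by
  simp only [coeff_lowPoly]
  split_ifs
  · exact differentiable_pi.1 ha _
  · exact differentiable_const _

theorem differentiable_coeff_pC (k : ℕ) : Differentiable ℂ fun y : Chart g => (pC y).coeff k :=
  differentiable_coeff_lowPoly (by fun_prop) k

theorem differentiable_coeff_rC (k : ℕ) : Differentiable ℂ fun y : Chart g => (rC y).coeff k := by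
  simp only [rC, Polynomial.coeff_add]
  exact (differentiable_const _).add (differentiable_coeff_lowPoly (by fun_prop) k)

theorem differentiable_coeff_qC (k : ℕ) : Differentiable ℂ fun y : Chart g => (qC y).coeff k := by
  intro y₀
  refine differentiableAt_coeff_divByMonic (2 * g
    + 2) (fun y => ?_) rC_monic natDegree_rC (fun k => ?_)
    (fun k => differentiable_coeff_rC k y₀) k
  · rw [degree_num]; exact_mod_cast Nat.lt_succ_self _
  · simp only [Polynomial.coeff_add, Polynomial.coeff_sub, Polynomial.coeff_C_mul]
    rw [show (fun y : Chart g => (Polynomial.X ^ (2 * g + 1) : ℂ[X]).coeff k + (y.2.2 * (Polynomial.X ^ g : ℂ[X]).coeff k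
      - (pC y ^ 2).coeff k)) = fun y => (Polynomial.X ^ (2 * g + 1) :
        ℂ[X]).coeff k + (y.2.2 * (Polynomial.X ^ g : ℂ[X]).coeff k
      - ∑ x ∈ Finset.HasAntidiagonal.antidiagonal k, (pC y).coeff x.1 * (pC y).coeff x.2) from
      funext fun y => by rw [sq, Polynomial.coeff_mul]]
    refine (differentiableAt_const _).add (DifferentiableAt.sub ?_ (DifferentiableAt.fun_sum fun x _ =>
      (differentiable_coeff_pC _ y₀).mul (differentiable_coeff_pC _ y₀)))
    fun_prop

theorem differentiable_sec : Differentiable ℂ (sec : Chart g → MA g) := by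
  rw [differentiable_pi]; intro i
  rw [differentiable_pi]; intro a
  fin_cases a
  · exact differentiable_coeff_pC _
  · exact differentiable_coeff_qC _
  · exact differentiable_coeff_rC _

theorem differentiable_flowD {E : Type*} [NormedAddCommGroup E] [NormedSpace ℂ E] {t : E → ℂ}
    {X : E → MA g} (ht : Differentiable ℂ t) (hX : Differentiable ℂ X) :
    Differentiable ℂ fun y => flowD (t y) (X y) := by
  have h : ∀ i a, Differentiable ℂ fun y => X y i a := fun i a =>
    differentiable_pi.1 (differentiable_pi.1 hX i) a
  rw [differentiable_pi]; intro i
  rw [differentiable_pi]; intro a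
  simp only [flowD_apply]
  fin_cases a
  · exact (h i 0).sub (ht.mul (h i 2))
  · exact ((h i 1).add (((differentiable_const _).mul ht).mul (h i 0))).sub ((ht.pow 2).mul (h i 2))
  · exact h i 2

theorem continuous_secS : Continuous (secS : Chart g → Stil g) :=
  differentiable_sec.continuous.subtype_mk _

/-- The chart as a homeomorphism. -/
def chartN (g : ℕ) : Ntil g ≃ₜ Chart g where
  toFun := Quotient.lift (fun X : Stil g => chartPt (X : MA g)) (by
    rintro X Y ⟨t, h⟩
    show chartPt (X : MA g) = chartPt (Y : MA g)
    rw [h, chartPt_flowD])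
  invFun y := proj (secS y)
  left_inv := by
    rintro ⟨X⟩
    exact proj_secS_chartPt X
  right_inv y := chartPt_sec y
  continuous_toFun := Continuous.quotient_lift
    (differentiable_chartPt.continuous.comp continuous_subtype_val) _
  continuous_invFun := continuous_quotient_mk'.comp continuous_secS

theorem chartN_proj (X : Stil g) : chartN g (proj X) = chartPt (X : MA g) := rfl

/-! ### Prolongations in the chart -/

theorem genD_apply (X : MA g) (i : Fin (g + 1)) : genD X i = ![-X i 2, 2 * X i 0, 0] := by
  ext a
  fin_cases a <;> simp [genD, slCoord, slMat, matA, Ring.lie_def]; ring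

theorem fderiv_chartPt_genD (X : MA g) : fderiv ℂ chartPt X (genD X) = 0 := by
  rw [fderiv_chartPt, fderiv_Hfun_genD]
  refine Prod.ext ?_ (Prod.ext ?_ rfl) <;> funext i <;> simp [genD_apply]
  ring

theorem fderiv_entry (X v : MA g) (i : Fin (g + 1)) (a : Fin 3) :
    fderiv ℂ (fun X : MA g => X i a) X v = v i a := by
  have h : HasFDerivAt (fun X : MA g => X i a) ((ContinuousLinearMap.proj (R := ℂ) (φ := fun _ => ℂ) a).comp
      (ContinuousLinearMap.proj (R := ℂ) (φ := fun _ : Fin (g + 1) => Fin 3 → ℂ) i)) X :=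
    ContinuousLinearMap.hasFDerivAt ((ContinuousLinearMap.proj (R := ℂ) (φ := fun _ => ℂ) a).comp
      (ContinuousLinearMap.proj (R := ℂ) (φ := fun _ : Fin (g + 1) => Fin 3 → ℂ) i))
  rw [h.fderiv]; rfl

theorem tanS_last_two {X v : MA g} (hv : v ∈ tanS X) : v (Fin.last g) 2 = 0 := by
  have h := fderiv_Hfun_of_mem_tanS hv (i := 2 * g + 1) (by omega)
  rwa [show (Hfun (2 * g + 1) : MA g → ℂ) = fun X => X (Fin.last g) 2 from funext Hfun_top,
    fderiv_entry] at h

/-- A tangent vector of `S̃` is determined by its image in the chart and by the variation of the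
coefficient of `λ^g` in the `(1,1)` entry, which moves along `E`. -/
theorem eq_zero_of_fderiv_chartPt {X w : MA g} (hX : X ∈ Stil g) (hw : w ∈ tanS X)
    (hc : fderiv ℂ chartPt X w = 0) (h0 : w (Fin.last g) 0 = 0) : w = 0 := by
  have hr := last_two_of_mem hX
  rw [fderiv_chartPt] at hc
  have h2 := tanS_last_two hw
  have c2 : ∀ i, w i 2 = 0 := fun i => by
    refine Fin.lastCases h2 (fun i => ?_) i
    exact congrFun (congrArg Prod.fst hc) i
  have c0 : ∀ i, w i 0 = 0 := fun i => by
    refine Fin.lastCases h0 (fun i => ?_) i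
    have := congrFun (congrArg (fun y => y.2.1) hc) i
    simpa [c2, h0, hr] using this
  have v0 : vPoly w 0 = 0 := by simp [vPoly, c0]
  have v2 : vPoly w 2 = 0 := by simp [vPoly, c2]
  have v1 : vPoly w 1 = 0 := by
    by_contra hne
    have hg : (vPoly X 2).coeff g = 1 := rX_top hX
    have h := fderiv_Hfun (g + (vPoly w 1).natDegree) X w
    rw [v0, v2, mul_zero, mul_zero, zero_add, add_zero, rX,
      Polynomial.coeff_mul_add_eq_of_natDegree_le (natDegree_vPoly X 2) le_rfl, hg, one_mul] at h
    refine Polynomial.leadingCoeff_ne_zero.2 hne (h.symm.trans ?_)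
    rcases Nat.eq_zero_or_pos (vPoly w 1).natDegree with hd | hd
    · rw [hd]; exact congrArg (fun y => y.2.2) hc
    · exact fderiv_Hfun_of_mem_tanS hw (by omega)
  refine vPoly_injective fun a => ?_
  rw [show vPoly (0 : MA g) a = 0 by simp [vPoly]]
  fin_cases a
  · exact v0
  · exact v1
  · exact v2

/-- A retraction onto `S̃` that preserves the chart coordinates. -/
def retr (Y : MA g) : MA g := flowD (-Y (Fin.last g) 0) (sec (chartPt Y))

theorem retr_mem (Y : MA g) : retr Y ∈ Stil g := flowD_mem _ (sec_mem _)

theorem retr_of_mem {X : MA g} (hX : X ∈ Stil g) : retr X = X := flowD_sec_chartPt hX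

theorem chartPt_retr (Y : MA g) : chartPt (retr Y) = chartPt Y := by
  rw [retr, chartPt_flowD, chartPt_sec]

theorem retr_last (Y : MA g) : retr Y (Fin.last g) 0 = Y (Fin.last g) 0 := by
  rw [retr, flowD_apply, sec_last_two, sec_last_zero]; simp

theorem differentiable_retr : Differentiable ℂ (retr : MA g → MA g) :=
  differentiable_flowD (differentiable_apply _ _).neg (differentiable_sec.comp differentiable_chartPt)

/-- The derivative of the retraction is the identity on `T S̃`, as it preserves the chart
coordinates, the Hamiltonians that define `S̃` and the coefficient that moves along `E`. -/
theorem fderiv_retr {X v : MA g} (hX : X ∈ Stil g) (hv : v ∈ tanS X) : fderiv ℂ retr X v = v := by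
  rw [← sub_eq_zero]
  have hd : HasFDerivAt retr (fderiv ℂ retr X) X := (differentiable_retr X).hasFDerivAt
  have hcomp : ∀ {F : Type} [NormedAddCommGroup F] [NormedSpace ℂ F] (φ : MA g → F),
      DifferentiableAt ℂ φ X → fderiv ℂ (φ ∘ retr) X v = fderiv ℂ φ X (fderiv ℂ retr X v) := by
    intro F _ _ φ hφ
    have h1 : HasFDerivAt φ (fderiv ℂ φ X) (retr X) := by
      rw [retr_of_mem hX]; exact hφ.hasFDerivAt
    rw [(h1.comp X hd).fderiv]; rfl
  have hcst : ∀ i, g < i → fderiv ℂ (Hfun i) X (fderiv ℂ retr X v) = 0 := by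
    intro i hi
    rw [← hcomp _ (differentiable_Hfun i X)]
    have : (Hfun i ∘ retr : MA g → ℂ) = fun _ => if i = 2 * g + 1 then 1 else 0 :=
      funext fun Y => Hfun_of_mem (retr_mem Y) hi
    rw [this]; simp
  refine eq_zero_of_fderiv_chartPt hX ?_ ?_ ?_
  · rw [mem_tanS]
    intro i hi _
    rw [map_sub, hcst i (by omega), fderiv_Hfun_of_mem_tanS hv (by omega), sub_zero]
  · rw [map_sub, ← hcomp _ (differentiable_chartPt X)]
    rw [show (chartPt ∘ retr : MA g → Chart g) = chartPt from funext chartPt_retr, sub_self]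
  · have e : (fun Y : MA g => Y (Fin.last g) 0) ∘ retr = fun Y => Y (Fin.last g) 0 :=
      funext retr_last
    have h1 := hcomp (fun Y : MA g => Y (Fin.last g) 0) (differentiable_apply _ _ X)
    rw [e, fderiv_entry, fderiv_entry] at h1
    exact sub_eq_zero.2 h1.symm

/-- A function on `Ñ` in the chart. -/
def hat (f : Ntil g → ℂ) (y : Chart g) : ℂ := f (proj (secS y))

theorem hat_chartPt (f : Ntil g → ℂ) (X : Stil g) : hat f (chartPt (X : MA g)) = f (proj X) :=
  congrArg f (proj_secS_chartPt X)

theorem IsProlong.hat_differentiableAt {f : Ntil g → ℂ} {X : Stil g} {F : MA g → ℂ}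
    (h : IsProlong f X F) :
    ∀ᶠ y in 𝓝 (chartPt (X : MA g)), DifferentiableAt ℂ (hat f) y := by
  obtain ⟨h1, h2⟩ := h
  -- the section through `X`
  set t : ℂ := -(X : MA g) (Fin.last g) 0
  have hσd : Differentiable ℂ fun y : Chart g => flowD t (sec y) :=
    differentiable_flowD (differentiable_const _) differentiable_sec
  have hσX : flowD t (sec (chartPt (X : MA g))) = X := flowD_sec_chartPt X.2
  have c1 : Filter.Tendsto (fun y : Chart g => flowD t (sec y)) (𝓝 (chartPt (X : MA g))) (𝓝 (X : MA g)) := by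
    have := hσd.continuous.tendsto (chartPt (X : MA g))
    rwa [hσX] at this
  have c2 : Filter.Tendsto (fun y : Chart g => (⟨flowD t (sec y),
    flowD_mem t (sec_mem y)⟩ : Stil g))
      (𝓝 (chartPt (X : MA g))) (𝓝 X) := tendsto_subtype_rng.2 c1
  have e : ∀ᶠ y in 𝓝 (chartPt (X : MA g)), hat f y = F (flowD t (sec y)) := by
    filter_upwards [c2.eventually h2] with y hy
    rw [hy, hat]
    exact congrArg f (proj_eq_of_eq_flowD (X := secS y) t rfl).symm
  filter_upwards [e.eventually_nhds, c1.eventually h1] with y hy hy'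
  exact (hy'.1.comp y (hσd y)).congr_of_eventuallyEq hy

theorem IsProlong.fderiv_eq {f : Ntil g → ℂ} {X : Stil g} {F : MA g → ℂ} (h : IsProlong f X F)
    {v : MA g} (hv : v ∈ tanS (X : MA g)) :
    fderiv ℂ F X v = fderiv ℂ (hat f) (chartPt (X : MA g)) (fderiv ℂ chartPt (X : MA g) v) := by
  have hf := h.hat_differentiableAt.self_of_nhds
  have hF := h.1.self_of_nhds.1
  have c1 : Filter.Tendsto (fun Y : MA g => (⟨retr Y,
    retr_mem Y⟩ : Stil g)) (𝓝 (X : MA g)) (𝓝 X) := by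
    refine tendsto_subtype_rng.2 ?_
    have := (differentiable_retr (g := g)).continuous.tendsto (X : MA g)
    rwa [retr_of_mem X.2] at this
  have e : F ∘ retr =ᶠ[𝓝 (X : MA g)] hat f ∘ chartPt := by
    filter_upwards [c1.eventually h.2] with Y hY
    show F (retr Y) = hat f (chartPt Y)
    rw [hY, ← chartPt_retr]
    exact (hat_chartPt f ⟨retr Y, retr_mem Y⟩).symm
  have h1 : HasFDerivAt F (fderiv ℂ F X) (retr (X : MA g)) := by
    rw [retr_of_mem X.2]; exact hF.hasFDerivAt
  have h2 := (h1.comp _ (differentiable_retr (X : MA g)).hasFDerivAt).fderiv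
  have h3 := (hf.hasFDerivAt.comp (X : MA g) (differentiable_chartPt (X : MA g)).hasFDerivAt).fderiv
  rw [e.fderiv_eq, h3] at h2
  have h4 := congrArg (fun L : MA g →L[ℂ] ℂ => L v) h2
  simp only [ContinuousLinearMap.comp_apply] at h4
  rw [fderiv_retr X.2 hv] at h4
  exact h4.symm

theorem isProlong_hat {f : Ntil g → ℂ} {X : Stil g}
    (h : ∀ᶠ y in 𝓝 (chartPt (X : MA g)), DifferentiableAt ℂ (hat f) y) :
    IsProlong f X (hat f ∘ chartPt) := by
  refine ⟨?_, Filter.Eventually.of_forall fun Y => hat_chartPt f Y⟩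
  filter_upwards [differentiable_chartPt.continuous.tendsto (X : MA g) h] with Y hY
  have h1 := hY.hasFDerivAt.comp Y (differentiable_chartPt Y).hasFDerivAt
  refine ⟨h1.differentiableAt, ?_⟩
  rw [h1.fderiv, ContinuousLinearMap.comp_apply, fderiv_chartPt_genD, map_zero]

theorem exists_isProlong_iff {f : Ntil g → ℂ} {X : Stil g} : (∃ F, IsProlong f X F) ↔
    ∀ᶠ y in 𝓝 (chartPt (X : MA g)), DifferentiableAt ℂ (hat f) y :=
  ⟨fun ⟨_, h⟩ => h.hat_differentiableAt, fun h => ⟨_, isProlong_hat h⟩⟩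

theorem IsProlong.isProlong_hat {f : Ntil g → ℂ} {X : Stil g} {F : MA g → ℂ} (h : IsProlong f X F) :
    IsProlong f X (hat f ∘ chartPt) := StationaryKdV.isProlong_hat h.hat_differentiableAt

theorem isProlong_HN (i : ℕ) (X : Stil g) : IsProlong (HN i) X (Hfun i) :=
  ⟨Filter.Eventually.of_forall fun Y => ⟨differentiable_Hfun i Y, fderiv_Hfun_genD i Y⟩,
    Filter.Eventually.of_forall fun _ => rfl⟩

/-! ### Reduction of the vector field `Z` -/

/-- The direction of the coordinate `H_g` in the chart. -/
def eH (g : ℕ) : Chart g := (0, 0, 1)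

theorem fderiv_chartPt_zVec (X : MA g) : fderiv ℂ chartPt X (zVec g) = X (Fin.last g) 2 • eH g := by
  have hz : ∀ i, zVec g i 0 = 0 ∧ zVec g i 2 = 0 := fun i => by
    rw [zVec]
    by_cases h : i = 0
    · subst h; simp [slCoord, matA]
    · rw [Pi.single_eq_of_ne h]; exact ⟨rfl, rfl⟩
  rw [fderiv_chartPt, fderiv_Hfun_zVec]
  refine Prod.ext ?_ (Prod.ext ?_ ?_)
  · funext i; simp [hz, eH]
  · funext i; simp [hz, eH]
  · simp [eH, rX, coeff_vPoly, Fin.last]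

theorem IsProlong.fderiv_zVec {f : Ntil g → ℂ} {X : Stil g} {F : MA g → ℂ} (h : IsProlong f X F) :
    fderiv ℂ F X (zVec g) = fderiv ℂ (hat f) (chartPt (X : MA g)) (eH g) := by
  rw [h.fderiv_eq (zVec_mem_tanS _), fderiv_chartPt_zVec, last_two_of_mem X.2, one_smul]

theorem redZ_proj {f : Ntil g → ℂ} {X : Stil g} {F : MA g → ℂ} (h : IsProlong f X F) :
    redZ f (proj X) = fderiv ℂ F (X : MA g) (zVec g) := by
  have hc : ∃ c : ℂ, ∃ (X' : Stil g) (F : MA g → ℂ),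
      proj X' = proj X ∧ IsProlong f X' F ∧ c = fderiv ℂ F X' (zVec g) := ⟨_, X, F, rfl, h, rfl⟩
  rw [redZ, dif_pos hc]
  obtain ⟨X', F', hX, hF, he⟩ := hc.choose_spec
  rw [he, hF.fderiv_zVec, h.fderiv_zVec, chartPt_eq_of_proj_eq hX]

theorem redZ_eq {f : Ntil g → ℂ} {X : Stil g} (h : ∃ F, IsProlong f X F) :
    redZ f (proj X) = fderiv ℂ (hat f) (chartPt (X : MA g)) (eH g) := by
  obtain ⟨F, h⟩ := h
  rw [redZ_proj h, h.fderiv_zVec]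

/-- A local function is holomorphic on an open set when it is so in the chart. -/
theorem HolOn.hat_differentiableAt {f : Ntil g → ℂ} {W : Set (Ntil g)} (hf : HolOn f W)
    {y : Chart g}
    (hy : proj (secS y) ∈ W) : ∀ᶠ y' in 𝓝 y, DifferentiableAt ℂ (hat f) y' := by
  obtain ⟨F, hF⟩ := hf _ hy
  have := hF.hat_differentiableAt
  rwa [show chartPt ((secS y : Stil g) : MA g) = y from chartPt_sec y] at this

theorem continuous_proj_secS : Continuous fun y : Chart g => proj (secS y) :=
    (chartN g).symm.continuous

theorem eventually_mem {W : Set (Ntil g)} (hW : IsOpen W) {X : Stil g} (hX : proj X ∈ W) :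
    ∀ᶠ y in 𝓝 (chartPt (X : MA g)), proj (secS y) ∈ W := by
  refine continuous_proj_secS.continuousAt.eventually (hW.mem_nhds ?_)
  show proj (secS (chartPt (X : MA g))) ∈ W
  rwa [proj_secS_chartPt]

theorem holOn_of_hat {f : Ntil g → ℂ} {W : Set (Ntil g)} (hW : IsOpen W)
    (h : ∀ y, proj (secS y) ∈ W → DifferentiableAt ℂ (hat f) y) : HolOn f W := fun _ hX =>
  exists_isProlong_iff.2 ((eventually_mem hW hX).mono h)

theorem holOn_redZ {f : Ntil g → ℂ} {W : Set (Ntil g)} (hW : IsOpen W) (hf : HolOn f W) :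
    HolOn (redZ f) W := by
  refine holOn_of_hat hW fun y hy => ?_
  refine (differentiableAt_fderiv_apply (hf.hat_differentiableAt hy) (eH g)).congr_of_eventuallyEq ?_
  filter_upwards [continuous_proj_secS.continuousAt.eventually (hW.mem_nhds hy)] with y' hy'
  rw [hat, redZ_eq (hf _ hy')]
  rw [show chartPt ((secS y' : Stil g) : MA g) = y' from chartPt_sec y']

theorem proj_surjective (n : Ntil g) : ∃ X : Stil g, proj X = n := Quotient.exists_rep n

theorem redZ_HN (n : Ntil g) : redZ (HN g) n = 1 := by
  obtain ⟨X, rfl⟩ := proj_surjective n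
  rw [redZ_proj (isProlong_HN g X), fderiv_Hfun_zVec_self X.2]

/-! ### Reduction of the Poisson pencil -/

/-- The value of the tensor `a P_1 + b P_0` on two covectors. -/
def brk (a b : ℂ) (X W W' : MA g) : ℂ := pair W (a • P1 X W' + b • P0 X W')

theorem brk_eq (a b : ℂ) (X W W' : MA g) :
    brk a b X W W' = a * pair W (P1 X W') + b * pair W (P0 X W') := by
  rw [brk, pair_add_right, pair_smul_right, pair_smul_right]

theorem bracket_eq (a b : ℂ) (F G : MA g → ℂ) (X : MA g) :
    bracket a b F G X = brk a b X (grad F X) (grad G X) := rfl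

theorem brk_skew (a b : ℂ) (X W W' : MA g) : brk a b X W W' = -brk a b X W' W := by
  rw [brk_eq, brk_eq, pair_P0_skew, pair_P1_skew]; ring

theorem P1_mem_tanS {X W : MA g} (hW : W ∈ annih X) : P1 X W ∈ tanS X := mem_tanS.2 fun i hi _ => by
  obtain ⟨m, rfl⟩ : ∃ m, i = m + 1 := ⟨i - 1, by omega⟩
  rw [← pair_grad, pair_P1_skew, P1_grad_Hfun]
  rcases (show g ≤ m by omega).eq_or_lt with rfl | hm
  · rw [P0_grad_Hfun_self, mem_annih.1 hW, neg_zero]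
  · rw [P0_grad_Hfun_of_lt hm, pair_zero_right, neg_zero]

/-- On covectors that annihilate `E`, the pencil depends only on the restrictions to `T S̃`. -/
theorem brk_congr {a b : ℂ} {X W₁ W₂ W₁' W₂' : MA g} (h₁ : W₁' ∈ annih X) (h₂ : W₂ ∈ annih X)
    (h : ∀ v ∈ tanS X, pair W₁ v = pair W₂ v) (h' : ∀ v ∈ tanS X, pair W₁' v = pair W₂' v) :
    brk a b X W₁ W₁' = brk a b X W₂ W₂' := by
  have key : ∀ {U U' V : MA g}, V ∈ annih X → (∀ v ∈ tanS X, pair U v = pair U' v) →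
      brk a b X U V = brk a b X U' V := fun {U U' V} hV hU =>
    hU _ (Submodule.add_mem _ (Submodule.smul_mem _ _ (P1_mem_tanS hV))
      (Submodule.smul_mem _ _ (P0_mem_tanS X V)))
  rw [key h₁ h, brk_skew, key h₂ h', ← brk_skew]

theorem grad_mem_annih {F : MA g → ℂ} {X : MA g} (h : fderiv ℂ F X (genD X) = 0) :
    grad F X ∈ annih X := by
  rw [mem_annih, pair_grad, h]

theorem IsProlong.grad_mem {f : Ntil g → ℂ} {X : Stil g} {F : MA g → ℂ} (h : IsProlong f X F) :
    grad F X ∈ annih (X : MA g) := grad_mem_annih h.1.self_of_nhds.2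

theorem IsProlong.bracket_congr {a b : ℂ} {f k : Ntil g → ℂ} {X : Stil g} {F F' K K' : MA g → ℂ}
    (hF : IsProlong f X F) (hF' : IsProlong f X F') (hK : IsProlong k X K)
      (hK' : IsProlong k X K') :
    bracket a b F K (X : MA g) = bracket a b F' K' (X : MA g) :=
  brk_congr hK.grad_mem hF'.grad_mem
    (fun v hv => by rw [pair_grad, pair_grad, hF.fderiv_eq hv, hF'.fderiv_eq hv])
    (fun v hv => by rw [pair_grad, pair_grad, hK.fderiv_eq hv, hK'.fderiv_eq hv])

/-- The flow of `E` as a linear map. -/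
def flowL (g : ℕ) (t : ℂ) : MA g →ₗ[ℂ] MA g where
  toFun := flowD t
  map_add' X Y := by
    funext i a
    simp only [Pi.add_apply, flowD_apply]
    fin_cases a <;> simp <;> ring
  map_smul' c X := by
    funext i a
    simp only [Pi.smul_apply, flowD_apply, RingHom.id_apply]
    fin_cases a <;> simp <;> ring

theorem expA_neg_mul (t : ℂ) : expA (-t) * expA t = 1 := by
  rw [expA_mul, neg_add_cancel, expA_zero]

theorem conj_mul_conj (t : ℂ) (M N : Matrix (Fin 2) (Fin 2) ℂ) :
    expA t * M * expA (-t) * (expA t * N * expA (-t)) = expA t * (M * N) * expA (-t) := by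
  calc _ = expA t * M * (expA (-t) * expA t) * N * expA (-t) := by simp only [Matrix.mul_assoc]
    _ = _ := by rw [expA_neg_mul, Matrix.mul_one]; simp only [Matrix.mul_assoc]

theorem lie_conj (t : ℂ) (M N : Matrix (Fin 2) (Fin 2) ℂ) :
    ⁅expA t * M * expA (-t), expA t * N * expA (-t)⁆ = expA t * ⁅M, N⁆ * expA (-t) := by
  rw [Ring.lie_def, Ring.lie_def, conj_mul_conj, conj_mul_conj, Matrix.mul_sub, Matrix.sub_mul]

theorem pair_flowD (t : ℂ) (W V : MA g) : pair (flowD t W) (flowD t V) = pair W V := by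
  refine Finset.sum_congr rfl fun i _ => ?_
  rw [slMat_flowD, slMat_flowD, conj_mul_conj, Matrix.trace_mul_comm, ← Matrix.mul_assoc,
    expA_neg_mul, Matrix.one_mul]

theorem P0_flowD (t : ℂ) (X W : MA g) : P0 (flowD t X) (flowD t W) = flowD t (P0 X W) := by
  funext i
  simp only [P0, flowD]
  rw [slMat_slCoord (trace_sum_lie _ _ _), Finset.mul_sum, Finset.sum_mul]
  congr 1
  refine Finset.sum_congr rfl fun j _ => ?_
  rw [← lie_conj, ← coefMat_flowD]
  congr 1
  exact slMat_flowD t W j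

theorem P1_flowD (t : ℂ) (X W : MA g) : P1 (flowD t X) (flowD t W) = flowD t (P1 X W) := by
  have hl : ∀ (k : ℕ) (j : Fin (g + 1)), ⁅coefMat (flowD t X) k, slMat (flowD t W j)⁆
      = expA t * ⁅coefMat X k, slMat (W j)⁆ * expA (-t) := fun k j => by
    rw [coefMat_flowD, slMat_flowD, lie_conj]
  funext i
  conv_rhs => rw [flowD]
  simp only [P1, hl]
  split_ifs with h
  · rw [slMat_slCoord (by rw [Matrix.trace_neg, trace_lie, neg_zero]), Matrix.mul_neg,
      Matrix.neg_mul]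
  · rw [slMat_slCoord, Finset.mul_sum, Finset.sum_mul]
    · congr 1
      refine Finset.sum_congr rfl fun j _ => ?_
      split_ifs <;> simp
    · rw [Matrix.trace_sum]
      refine Finset.sum_eq_zero fun j _ => ?_
      split_ifs
      · exact Matrix.trace_zero _ _
      · exact trace_lie _ _

theorem brk_flowD (a b t : ℂ) (X W W' : MA g) :
    brk a b (flowD t X) (flowD t W) (flowD t W') = brk a b X W W' := by
  rw [brk_eq, brk_eq, P0_flowD, P1_flowD, pair_flowD, pair_flowD]

theorem grad_flowD {F : MA g → ℂ} (t : ℂ) {X : MA g} (hF : ∀ Y, F (flowD t Y) = F Y)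
    (hd : DifferentiableAt ℂ F (flowD t X)) : grad F (flowD t X) = flowD t (grad F X) := by
  have h1 : HasFDerivAt (fun Y : MA g => flowD t Y) (LinearMap.toContinuousLinearMap (flowL g t)) X :=
    (LinearMap.toContinuousLinearMap (flowL g t)).hasFDerivAt
  have h2 := (hd.hasFDerivAt.comp X h1).fderiv
  rw [show F ∘ (fun Y : MA g => flowD t Y) = F from funext hF] at h2
  rw [← sub_eq_zero]
  refine eq_zero_of_pair' fun V => ?_
  have hV : V = flowD t (flowD (-t) V) := by rw [flowD_flowD, add_neg_cancel, flowD_zero]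
  rw [pair_sub_left]
  conv_lhs => rw [hV]
  rw [pair_flowD, pair_grad, pair_grad, h2, sub_eq_zero]
  rfl

theorem bracket_hat_flowD (a b t : ℂ) {f k : Ntil g → ℂ} {X : MA g}
    (hf : DifferentiableAt ℂ (hat f) (chartPt X)) (hk : DifferentiableAt ℂ (hat k) (chartPt X)) :
    bracket a b (hat f ∘ chartPt) (hat k ∘ chartPt) (flowD t X)
      = bracket a b (hat f ∘ chartPt) (hat k ∘ chartPt) X := by
  have key : ∀ φ : Chart g → ℂ, DifferentiableAt ℂ φ (chartPt X) →
      grad (φ ∘ chartPt) (flowD t X) = flowD t (grad (φ ∘ chartPt) X) := fun φ hφ => by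
    refine grad_flowD t (fun Y => congrArg φ (chartPt_flowD t Y)) ?_
    refine DifferentiableAt.comp _ ?_ (differentiable_chartPt _)
    rwa [chartPt_flowD]
  rw [bracket_eq, bracket_eq, key _ hf, key _ hk, brk_flowD]

theorem redBracket_proj {a b : ℂ} {f k : Ntil g → ℂ} {X : Stil g} {F K : MA g → ℂ}
    (hF : IsProlong f X F) (hK : IsProlong k X K) :
    redBracket a b f k (proj X) = bracket a b F K (X : MA g) := by
  have hc : ∃ c : ℂ, ∃ (X' : Stil g) (F K : MA g → ℂ),
      proj X' = proj X ∧ IsProlong f X' F ∧ IsProlong k X' K ∧ c = bracket a b F K X' :=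
    ⟨_, X, F, K, rfl, hF, hK, rfl⟩
  rw [redBracket, dif_pos hc]
  obtain ⟨X', F', K', hX, hF', hK', he⟩ := hc.choose_spec
  rw [he, hF.bracket_congr hF.isProlong_hat hK hK.isProlong_hat,
    hF'.bracket_congr hF'.isProlong_hat hK' hK'.isProlong_hat]
  obtain ⟨t, ht⟩ := exists_flowD_of_proj_eq hX
  rw [ht, bracket_hat_flowD a b t hF'.hat_differentiableAt.self_of_nhds
    hK'.hat_differentiableAt.self_of_nhds]

theorem isProlong_secS {f : Ntil g → ℂ} {y : Chart g}
    (h : ∀ᶠ y' in 𝓝 y, DifferentiableAt ℂ (hat f) y') :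
    IsProlong f (secS y) (hat f ∘ chartPt) := by
  refine isProlong_hat ?_
  rwa [show chartPt ((secS y : Stil g) : MA g) = y from chartPt_sec y]

theorem HolOn.isProlong_secS {f : Ntil g → ℂ} {W : Set (Ntil g)} (hf : HolOn f W) {y : Chart g}
    (hy : proj (secS y) ∈ W) : IsProlong f (secS y) (hat f ∘ chartPt) :=
  StationaryKdV.isProlong_secS (hf.hat_differentiableAt hy)

theorem hat_redBracket {a b : ℂ} {f k : Ntil g → ℂ} {W : Set (Ntil g)} (hf : HolOn f W)
    (hk : HolOn k W)
    {y : Chart g} (hy : proj (secS y) ∈ W) : hat (redBracket a b f k) y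
      = brk a b (sec y) (grad (hat f ∘ chartPt) (sec y)) (grad (hat k ∘ chartPt) (sec y)) :=
  redBracket_proj (hf.isProlong_secS hy) (hk.isProlong_secS hy)

theorem differentiableAt_brk {E : Type*} [NormedAddCommGroup E] [NormedSpace ℂ E] (a b : ℂ)
    {X W W' : E → MA g} {y : E} (hX : DifferentiableAt ℂ X y) (hW : DifferentiableAt ℂ W y)
    (hW' : DifferentiableAt ℂ W' y) :
      DifferentiableAt ℂ (fun y => brk a b (X y) (W y) (W' y)) y := by
  have hc : ∀ {X : E → MA g}, DifferentiableAt ℂ X y → ∀ i a, DifferentiableAt ℂ (fun y => X y i a) y :=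
    fun h i a => differentiableAt_pi.1 (differentiableAt_pi.1 h i) a
  have hs : ∀ {X : E → MA g}, DifferentiableAt ℂ X y → ∀ i (a b : Fin 2),
      DifferentiableAt ℂ (fun y => slMat (X y i) a b) y := fun h i a b => by
    fin_cases a <;> fin_cases b
    · exact hc h i 0
    · exact hc h i 2
    · exact hc h i 1
    · exact (hc h i 0).neg
  have hm : ∀ (k : ℕ) (a b : Fin 2), DifferentiableAt ℂ (fun y => coefMat (X y) k a b) y :=
    fun k a b => by
    unfold coefMat
    split_ifs
    · exact hs hX _ a b
    · exact differentiableAt_const _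
    · exact differentiableAt_const _
  have ht : ∀ (k : ℕ) (i j : Fin (g + 1)),
      DifferentiableAt ℂ (fun y => (slMat (W y i) * ⁅coefMat (X y) k, slMat (W' y j)⁆).trace) y :=
        by
    intro k i j
    simp only [Ring.lie_def, Matrix.trace_fin_two, Matrix.mul_apply, Matrix.sub_apply,
      Fin.sum_univ_two]
    have h1 := hs hW i
    have h2 := hm k
    have h3 := hs hW' j
    fun_prop
  simp only [brk_eq, pair_P0, pair_P1]
  refine ((differentiableAt_const _).mul ?_).add ((differentiableAt_const _).mul ?_)
  · exact DifferentiableAt.fun_sum fun i _ => DifferentiableAt.fun_sum fun j _ =>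
      (differentiableAt_const _).mul (ht _ i j)
  · exact DifferentiableAt.fun_sum fun i _ => DifferentiableAt.fun_sum fun j _ => ht _ i j

theorem eventually_differentiableAt_comp_chartPt {φ : Chart g → ℂ} {X : MA g}
    (h : ∀ᶠ y in 𝓝 (chartPt X), DifferentiableAt ℂ φ y) :
    ∀ᶠ Y in 𝓝 X, DifferentiableAt ℂ (φ ∘ chartPt) Y :=
  (differentiable_chartPt.continuous.continuousAt.eventually h).mono fun Y hY =>
    DifferentiableAt.comp Y hY (differentiable_chartPt Y)

theorem differentiableAt_grad {F : MA g → ℂ} {X : MA g} (h : ∀ᶠ Y in 𝓝 X, DifferentiableAt ℂ F Y) :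
    DifferentiableAt ℂ (grad F) X := by
  rw [differentiableAt_pi]; intro i
  rw [differentiableAt_pi]; intro a
  fin_cases a
  · have h1 := (differentiableAt_fderiv_apply h (Pi.single i (Pi.single 0 1))).mul_const (2⁻¹ : ℂ)
    simp only [← div_eq_mul_inv] at h1
    exact h1
  · exact differentiableAt_fderiv_apply h _
  · exact differentiableAt_fderiv_apply h _

theorem differentiableAt_grad_sec {f : Ntil g → ℂ} {y : Chart g}
    (h : ∀ᶠ y' in 𝓝 y, DifferentiableAt ℂ (hat f) y') :
    DifferentiableAt ℂ (fun y => grad (hat f ∘ chartPt) (sec y)) y := by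
  refine DifferentiableAt.comp (g := grad (hat f ∘ chartPt)) y
    (differentiableAt_grad (eventually_differentiableAt_comp_chartPt ?_)) (differentiable_sec y)
  rwa [chartPt_sec]

theorem holOn_redBracket (a b : ℂ) {f k : Ntil g → ℂ} {W : Set (Ntil g)} (hW : IsOpen W)
    (hf : HolOn f W)
    (hk : HolOn k W) : HolOn (redBracket a b f k) W := by
  refine holOn_of_hat hW fun y hy => ?_
  refine (differentiableAt_brk a b (differentiable_sec y)
    (differentiableAt_grad_sec (hf.hat_differentiableAt hy))
    (differentiableAt_grad_sec (hk.hat_differentiableAt hy))).congr_of_eventuallyEq ?_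
  filter_upwards [continuous_proj_secS.continuousAt.eventually (hW.mem_nhds hy)] with y' hy'
  exact hat_redBracket hf hk hy'

/-! ### Functions invariant along `Z` -/

theorem coefMat_add_zVec (X : MA g) (t : ℂ) {k : ℕ} (hk : k ≠ 0) :
    coefMat (X + t • zVec g) k = coefMat X k := by
  unfold coefMat
  split_ifs with h
  · congr 1
    rw [Pi.add_apply, Pi.smul_apply, zVec, Pi.single_eq_of_ne (Fin.ne_of_val_ne hk),
      smul_zero, add_zero]
  all_goals rfl

theorem P0_add_zVec (X W : MA g) (t : ℂ) : P0 (X + t • zVec g) W = P0 X W := by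
  funext i
  simp only [P0]
  congr 1
  exact Finset.sum_congr rfl fun j _ => by rw [coefMat_add_zVec X t (by omega)]

/-- The tensors `P_0` and `P_1` on covectors that annihilate `Z` are invariant along `Z`. -/
theorem brk_add_zVec (a b t : ℂ) {X W W' : MA g} (hW : pair W (zVec g) = 0)
    (hW' : pair W' (zVec g) = 0) :
    brk a b (X + t • zVec g) W W' = brk a b X W W' := by
  have hz : ∀ {W : MA g}, pair W (zVec g) = 0 → W 0 2 = 0 := fun {W} hW => by
    rw [pair_eq, Finset.sum_eq_single 0] at hW
    · simpa [zVec, slCoord, matA] using hW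
    · intro i _ hi; simp [zVec, hi]
    · simp
  have h0 : slMat ((X + t • zVec g) 0) = slMat (X 0) + t • matA := by
    rw [Pi.add_apply, slMat_add, Pi.smul_apply, slMat_smul, zVec, Pi.single_eq_same, slMat_slCoord]
    simp [matA, Matrix.trace_fin_two]
  have e : pair W (P1 (X + t • zVec g) W') = pair W (P1 X W') := by
    rw [pair_P1, pair_P1]
    refine Finset.sum_congr rfl fun i _ => Finset.sum_congr rfl fun j _ => ?_
    by_cases hij : (i : ℕ) + j = 0
    · obtain rfl : i = 0 := Fin.ext (by simp only [Fin.val_zero]; omega)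
      obtain rfl : j = 0 := Fin.ext (by simp only [Fin.val_zero]; omega)
      congr 1
      have hc : ∀ Y : MA g, coefMat Y ((0 : Fin (g + 1)) + (0 : Fin (g + 1)) : ℕ) = slMat (Y 0) :=
        fun Y => coefMat_fin Y 0
      rw [hc, hc, h0]
      simp [slMat, matA, hz hW, hz hW', Ring.lie_def, Matrix.trace_fin_two]
    · rw [coefMat_add_zVec X t hij]
  rw [brk_eq, brk_eq, P0_add_zVec, e]

/-- A function whose derivative along `v` vanishes near `X` has the same gradient at the points
`X + t v`, for `t` small. -/
theorem eventually_grad_add_eq {F : MA g → ℂ} {X v : MA g}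
    (h : ∀ᶠ Y in 𝓝 X, DifferentiableAt ℂ F Y ∧ fderiv ℂ F Y v = 0) :
    ∀ᶠ t : ℂ in 𝓝 0, grad F (X + t • v) = grad F X := by
  obtain ⟨ε, hε, hB⟩ := Metric.eventually_nhds_iff_ball.1 h
  have h1 : ∀ᶠ t : ℂ in 𝓝 0, X + t • v ∈ Metric.ball X ε := by
    refine ContinuousAt.eventually_mem (by fun_prop) ?_
    rw [zero_smul, add_zero]
    exact Metric.ball_mem_nhds X hε
  filter_upwards [h1] with t ht
  have h2 : (fun Y => F (Y + t • v)) =ᶠ[𝓝 X] F := by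
    have h3 : ∀ᶠ Y in 𝓝 X, Y + t • v ∈ Metric.ball X ε :=
      ContinuousAt.eventually_mem (by fun_prop) (Metric.isOpen_ball.mem_nhds ht)
    filter_upwards [h3, Metric.ball_mem_nhds X hε] with Y hY hY'
    -- on the segment from `Y` to `Y + t v`, inside the ball, the derivative vanishes
    have hseg : ∀ s ∈ Set.Icc (0 : ℝ) 1, Y + (s : ℂ) • (t • v) ∈ Metric.ball X ε := by
      intro s hs
      have := (convex_ball X ε).add_smul_sub_mem hY' hY hs
      rwa [add_sub_cancel_left] at this
    have hder : ∀ s ∈ Set.Icc (0 : ℝ) 1,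
        HasDerivAt (fun s : ℝ => F (Y + (s : ℂ) • (t • v))) 0 s := by
      intro s hs
      obtain ⟨hd, hz⟩ := hB _ (hseg s hs)
      have hl : HasDerivAt (fun s : ℝ => Y + (s : ℂ) • (t • v)) ((1 : ℂ) • (t • v)) s :=
        (Complex.ofRealCLM.hasDerivAt.smul_const (t • v)).const_add Y
      have := (hd.hasFDerivAt.restrictScalars ℝ).comp_hasDerivAt s hl
      rw [show (fderiv ℂ F (Y + (s : ℂ) • (t • v))).restrictScalars ℝ ((1 : ℂ) • (t • v)) = 0 by
        rw [ContinuousLinearMap.coe_restrictScalars', one_smul, map_smul, hz, smul_zero]] at this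
      exact this
    have := (convex_Icc (0 : ℝ) 1).is_const_of_fderivWithin_eq_zero (𝕜 := ℝ)
      (f := fun s : ℝ => F (Y + (s : ℂ) • (t • v)))
      (fun s hs => (hder s hs).differentiableAt.differentiableWithinAt)
      (fun s hs => by
        ext
        rw [fderivWithin_eq_fderiv ((uniqueDiffOn_Icc one_pos) s hs) (hder s hs).differentiableAt,
          (hder s hs).hasFDerivAt.fderiv]; simp) (Set.right_mem_Icc.2 zero_le_one)
      (Set.left_mem_Icc.2 zero_le_one)
    simpa using this
  have h4 : fderiv ℂ F (X + t • v) = fderiv ℂ F X := by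
    rw [← h2.fderiv_eq, fderiv_comp_add_right]
  funext i
  simp only [grad, h4]

/-- The section intertwines the coordinate direction of `H_g` with `Z`. -/
theorem sec_add_eH (y : Chart g) (t : ℂ) : sec (y + t • eH g) = sec y + t • zVec g := by
  have hz : ∀ i, zVec g i 0 = 0 ∧ zVec g i 2 = 0 := fun i => by
    rw [zVec]
    by_cases h : i = 0
    · subst h; simp [slCoord, matA]
    · rw [Pi.single_eq_of_ne h]; exact ⟨rfl, rfl⟩
  have hp : pX (sec y + t • zVec g) = pX (sec y) := by
    rw [pX, vPoly_add, vPoly_smul, vPoly_zVec.1, mul_zero, add_zero]; rfl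
  have hr : rX (sec y + t • zVec g) = rX (sec y) := by
    rw [rX, vPoly_add, vPoly_smul, vPoly_zVec.2.2, mul_zero, add_zero]; rfl
  have hq : qX (sec y + t • zVec g) = qX (sec y) + Polynomial.C t := by
    rw [qX, vPoly_add, vPoly_smul, vPoly_zVec.2.1, mul_one, qX]; ring
  have hH : ∀ i, Hfun i (sec y + t • zVec g) = Hfun i (sec y) + t * (rC y).coeff i := fun i => by
    rw [Hfun_eq, Hfun_eq, hp, hq, hr, mul_add, ← add_assoc, Polynomial.coeff_add,
      mul_comm _ (Polynomial.C t),
      Polynomial.coeff_C_mul, rX_sec]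
  have hc : ∀ i, g < i → (rC y).coeff i = 0 := fun i hi =>
    Polynomial.coeff_eq_zero_of_natDegree_lt (by rwa [natDegree_rC])
  have hS : sec y + t • zVec g ∈ Stil g := by
    have := sec_mem y
    refine ⟨?_, fun i hi hi' => ?_⟩
    · rw [hH, hc _ (by omega), mul_zero, add_zero]; exact this.1
    · rw [hH, hc _ (by omega), mul_zero, add_zero]; exact this.2 i hi hi'
  rw [← sec_chartPt hS (by simp [hz, sec_last_zero])]
  congr 1
  have h1 := chartPt_sec y
  rw [Prod.ext_iff, Prod.ext_iff] at h1
  refine (Prod.ext ?_ (Prod.ext ?_ ?_)).symm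
  · refine Eq.trans ?_ (h1.1.trans (by simp [eH]))
    funext i; simp [chartPt, hz]
  · refine Eq.trans ?_ (h1.2.1.trans (by simp [eH]))
    funext i; simp [chartPt, hz]
  · refine (hH g).trans ?_
    rw [coeff_rC, if_pos rfl, dif_neg (lt_irrefl g), Hfun_sec y le_rfl, if_neg (by omega),
      if_pos rfl]
    simp [eH]

theorem redZ_redBracket (a b : ℂ) {f k : Ntil g → ℂ} {W : Set (Ntil g)} (hW : IsOpen W)
    (hf : HolOn f W)
    (hk : HolOn k W) (hf0 : ∀ n ∈ W, redZ f n = 0) (hk0 : ∀ n ∈ W, redZ k n = 0) {n : Ntil g}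
      (hn : n ∈ W) :
    redZ (redBracket a b f k) n = 0 := by
  obtain ⟨X, rfl⟩ := proj_surjective n
  set y := chartPt (X : MA g) with hy
  have hyW : proj (secS y) ∈ W := by rwa [hy, proj_secS_chartPt]
  have hB := holOn_redBracket a b hW hf hk
  rw [redZ_eq (hB X hn), ← hy]
  -- the prolongations constant along the leaves of `E` are constant along `Z` too
  have key : ∀ {f : Ntil g → ℂ}, HolOn f W → (∀ n ∈ W, redZ f n = 0) →
      ∀ᶠ Y in 𝓝 (sec y), DifferentiableAt ℂ (hat f ∘ chartPt) Y ∧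
        fderiv ℂ (hat f ∘ chartPt) Y (zVec g) = 0 := by
    intro f hf hf0
    have h1 : ∀ᶠ y' in 𝓝 (chartPt (sec y)), proj (secS y') ∈ W := by
      rw [chartPt_sec]; exact continuous_proj_secS.continuousAt.eventually (hW.mem_nhds hyW)
    filter_upwards [differentiable_chartPt.continuous.tendsto (sec y) h1] with Y hY
    have hd := (hf.hat_differentiableAt hY).self_of_nhds
    have h2 := hd.hasFDerivAt.comp Y (differentiable_chartPt Y).hasFDerivAt
    refine ⟨h2.differentiableAt, ?_⟩
    have h3 := redZ_eq (hf _ hY)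
    rw [hf0 _ hY, show chartPt ((secS (chartPt Y) : Stil g) : MA g)
      = chartPt Y from chartPt_sec _] at h3
    rw [h2.fderiv, ContinuousLinearMap.comp_apply, fderiv_chartPt_zVec, map_smul, ← h3, smul_zero]
  have h1 : ∀ᶠ t : ℂ in 𝓝 0, hat (redBracket a b f k) (y + t • eH g)
    = hat (redBracket a b f k) y := by
    have hc : ∀ᶠ t : ℂ in 𝓝 0, proj (secS (y + t • eH g)) ∈ W := by
      refine ContinuousAt.eventually_mem (f := fun t : ℂ => proj (secS (y + t • eH g)))
        (continuous_proj_secS.comp (by fun_prop)).continuousAt ?_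
      rw [zero_smul, add_zero]; exact hW.mem_nhds hyW
    filter_upwards [hc, eventually_grad_add_eq (key hf hf0), eventually_grad_add_eq (key hk hk0)]
      with t ht h2 h3
    rw [hat_redBracket hf hk ht, hat_redBracket hf hk hyW, sec_add_eH, h2, h3, brk_add_zVec]
    · rw [pair_grad]
      exact (key hf hf0).self_of_nhds.2
    · rw [pair_grad]
      exact (key hk hk0).self_of_nhds.2
  have hd := (hB.hat_differentiableAt hyW).self_of_nhds
  have h2 : HasDerivAt (fun t : ℂ => y + t • eH g) ((1 : ℂ) • eH g) 0 :=
    ((hasDerivAt_id (0 : ℂ)).smul_const (eH g)).const_add y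
  have h3 : HasFDerivAt (hat (redBracket a b f k)) (fderiv ℂ (hat (redBracket a b f k)) y)
      (y + (0 : ℂ) • eH g) := by rw [zero_smul, add_zero]; exact hd.hasFDerivAt
  have h4 := h3.comp_hasDerivAt (0 : ℂ) h2
  have h5 : HasDerivAt (hat (redBracket a b f k) ∘ fun t : ℂ => y + t • eH g) 0 0 :=
    (hasDerivAt_const (0 : ℂ) (hat (redBracket a b f k) y)).congr_of_eventuallyEq h1
  rw [one_smul] at h4
  exact h4.unique h5

/-! ### The phase space and the reduced manifold -/

theorem pX_VMA (h : ℕ → ℂ) : pX (VMA g h) = pPoly h (2 * g + 1) := by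
  ext k
  rw [pX, coeff_vPoly]
  split_ifs with hk
  · rfl
  · rw [coeff_pPoly_odd h g k (by omega)]

theorem rX_VMA (h : ℕ → ℂ) : rX (VMA g h) = qPoly h (2 * g + 1) := by
  ext k
  rw [rX, coeff_vPoly]
  split_ifs with hk
  · rfl
  · rw [coeff_qPoly_odd h g k (by omega), if_neg (by omega)]

theorem qX_VMA (h : ℕ → ℂ) : qX (VMA g h) = VMat h (2 * g + 1) 1 0 := by
  ext k
  rw [qX, Polynomial.coeff_add, Polynomial.coeff_X_pow, coeff_vPoly]
  split_ifs with hk hk' hk'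
  · omega
  · rw [add_zero]; rfl
  · rw [coeff_VMat_10 h g k (by omega), if_pos hk', zero_add]
  · rw [coeff_VMat_10 h g k (by omega), if_neg hk', zero_add]

theorem laxPoly_VMA (h : ℕ → ℂ) : laxPoly (VMA g h) = VMat h (2 * g + 1) := by
  rw [laxPoly_eq, pX_VMA, rX_VMA, qX_VMA, ← VMat_00, ← VMat_01, ← VMat_trace]
  exact (Matrix.eta_fin_two _).symm

theorem VMA_mem {h : ℕ → ℂ} (hh : h ∈ KdVPhase g) : VMA g h ∈ Stil g := by
  have key : ∀ k, g < k → Hfun k (VMA g h) = if k = 2 * g + 1 then 1 else 0 := fun k hk => by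
    rw [Hfun_eq, pX_VMA, rX_VMA, qX_VMA, coeff_det_of_mem hh hk]
  exact ⟨by rw [key _ (by omega), if_pos rfl], fun i hi hi' => by rw [key _ (by omega),
    if_neg (by omega)]⟩

theorem sec_chartPt_VMA {h : ℕ → ℂ} (hh : h ∈ KdVPhase g) : sec (chartPt (VMA g h)) = VMA g h :=
  sec_chartPt (VMA_mem hh) (coeff_pPoly_odd h g g le_rfl)

/-- The point of the phase space with given chart coordinates: the solution of the Riccati equation
`r h² + 2 p h = q`. -/
def phaseOf (y : Chart g) : ℕ → ℂ := riccSol g (pC y) (qC y) (rC y)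

theorem phaseOf_spec (y : Chart g) : phaseOf y ∈ KdVPhase g ∧ pPoly (phaseOf y) (2 * g + 1) = pC y ∧
    qPoly (phaseOf y) (2 * g + 1) = rC y ∧ VMat (phaseOf y) (2 * g + 1) 1 0 = qC y := by
  have hr1 : (rC y).coeff g = 1 := by rw [coeff_rC, if_pos rfl, dif_neg (lt_irrefl g), add_zero]
  refine mem_of_riccati (natDegree_rC y).le hr1 (natDegree_pC y) (fun k hk => ?_) ?_
  · rw [coeff_det_C y hk.le, if_neg (show ¬ k = g by omega), add_zero]
  · have := riccati_riccSol (natDegree_rC y).le hr1 (fun k hk => coeff_pC y hk) (fun k hk => coeff_qC y hk)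
    rw [riccati] at this
    rw [phaseOf]
    linear_combination this

theorem VMA_phaseOf (y : Chart g) : VMA g (phaseOf y) = sec y := by
  obtain ⟨-, h1, h2, h3⟩ := phaseOf_spec y
  funext i
  simp only [VMA, VMat_00, VMat_01, h1, h2, h3, sec]

theorem phaseOf_chartPt {h : ℕ → ℂ} (hh : h ∈ KdVPhase g) : phaseOf (chartPt (VMA g h)) = h := by
  have hs := sec_chartPt_VMA hh
  rw [phaseOf, ← pX_sec, ← qX_sec, ← rX_sec, hs, pX_VMA, rX_VMA, qX_VMA]
  refine (eq_riccSol (natDegree_qPoly_odd h g) ?_ (fun k hk => coeff_pPoly_odd h g k hk) ?_).symm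
  · rw [coeff_qPoly_odd h g g le_rfl, if_pos rfl]
  · have := riccati_of_mem hh
    rw [riccati]
    linear_combination this

/-- Extension by zero of the coordinates `h_1, …, h_{2g+1}`. -/
def extZ (x : Fin (2 * g + 1) → ℂ) (l : ℕ) : ℂ := if hl : l < 2 * g + 1 then x ⟨l, hl⟩ else 0

theorem differentiable_VMA_extZ :
    Differentiable ℂ fun x : Fin (2 * g + 1) → ℂ => VMA g (extZ x) := fun x₀ => by
  refine differentiableAt_VMA g fun i => ?_
  unfold extZ
  split_ifs
  · fun_prop
  · exact differentiableAt_const _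

theorem VMA_extZ (h : ℕ → ℂ) : VMA g (extZ fun l : Fin (2 * g + 1) => h l) = VMA g h :=
  VMA_congr fun i hi => by rw [extZ, dif_pos hi]

theorem differentiable_phaseOf (l : ℕ) :
    Differentiable ℂ fun y : Chart g => phaseOf y l := fun y₀ =>
  differentiableAt_riccSol (d := g + 1) (fun y => (natDegree_pC y).trans (by omega))
    (fun y => (natDegree_qC y).le) (fun y => (natDegree_rC y).le.trans (by omega))
    (fun k => differentiable_coeff_pC k y₀) (fun k => differentiable_coeff_qC k y₀)
    (fun k => differentiable_coeff_rC k y₀) l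

/-- The chart coordinates of the Lax matrix, as a homeomorphism of the phase space. -/
def phaseChart (g : ℕ) : KdVPhase g ≃ₜ Chart g where
  toFun h := chartPt (VMA g h)
  invFun y := ⟨phaseOf y, (phaseOf_spec y).1⟩
  left_inv h := Subtype.ext (phaseOf_chartPt h.2)
  right_inv y := by
    show chartPt (VMA g (phaseOf y)) = y
    rw [VMA_phaseOf, chartPt_sec]
  continuous_toFun := by
    refine differentiable_chartPt.continuous.comp ?_
    have h1 : Continuous fun h : KdVPhase g => fun l : Fin (2 * g + 1) => (h : ℕ → ℂ) l :=
      continuous_pi fun l => (continuous_apply (l : ℕ)).comp continuous_subtype_val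
    have h2 := (differentiable_VMA_extZ (g := g)).continuous.comp h1
    exact h2.congr fun h => VMA_extZ h
  continuous_invFun :=
    (continuous_pi fun l => (differentiable_phaseOf l).continuous).subtype_mk _

/-- The map `h ↦ [V^(2g+1)(h)]`. -/
def Phi (g : ℕ) : KdVPhase g ≃ₜ Ntil g := (phaseChart g).trans (chartN g).symm

theorem Phi_eq (h : KdVPhase g) : Phi g h = proj ⟨VMA g h, VMA_mem h.2⟩ :=
  proj_secS_chartPt ⟨VMA g h, VMA_mem h.2⟩

theorem Phi_eq_secS (h : KdVPhase g) : Phi g h = proj (secS (chartPt (VMA g h))) := rfl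

/-- The holomorphic functions of `Ñ` are the holomorphic functions of `h_1, …, h_{2g+1}`. -/
theorem isProlong_iff_phase (f : Ntil g → ℂ) (h₀ : KdVPhase g) :
    (∀ X : Stil g, proj X = Phi g h₀ → ∃ F, IsProlong f X F) ↔
      ∃ φ : (Fin (2 * g + 1) → ℂ) → ℂ,
        (∀ᶠ y in 𝓝 (fun l : Fin (2 * g + 1) => (h₀ : ℕ → ℂ) l), DifferentiableAt ℂ φ y) ∧
        ∀ᶠ h : KdVPhase g in 𝓝 h₀, f (Phi g h) = φ (fun l : Fin (2 * g + 1) => (h : ℕ → ℂ) l) := by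
  have hd : Differentiable ℂ fun x : Fin (2 * g + 1) → ℂ => chartPt (VMA g (extZ x)) :=
    differentiable_chartPt.comp differentiable_VMA_extZ
  have e : ∀ h : KdVPhase g, chartPt (VMA g (extZ fun l : Fin (2 * g + 1) => (h : ℕ → ℂ) l))
      = chartPt (VMA g h) := fun h => by rw [VMA_extZ]
  constructor
  · intro hf
    have h1 := exists_isProlong_iff.1 (hf _ (Phi_eq h₀).symm)
    refine ⟨fun x => hat f (chartPt (VMA g (extZ x))), ?_, Filter.Eventually.of_forall fun h => ?_⟩
    · have h2 := hd.continuous.continuousAt (x := fun l : Fin (2 * g + 1) => (h₀ : ℕ → ℂ) l)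
      rw [ContinuousAt, e] at h2
      filter_upwards [h2.eventually h1] with x hx
      exact DifferentiableAt.comp (g := hat f) x hx (hd x)
    · show f (Phi g h) = hat f (chartPt (VMA g (extZ _)))
      rw [VMA_extZ]; rfl
  · rintro ⟨φ, h1, h2⟩ X hX
    refine exists_isProlong_iff.2 ?_
    have hX' : chartPt (X : MA g) = phaseChart g h₀ := by
      rw [← chartN_proj, hX, Phi]; exact (chartN g).apply_symm_apply _
    have hs : (phaseChart g).symm (chartPt (X : MA g)) = h₀ := by
      rw [hX', Homeomorph.symm_apply_apply]
    have h3 := (phaseChart g).symm.continuous.continuousAt (x := chartPt (X : MA g))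
    rw [ContinuousAt, hs] at h3
    have hc : Differentiable ℂ fun y : Chart g => fun l : Fin (2 * g + 1) => phaseOf y l :=
      differentiable_pi.2 fun l => differentiable_phaseOf l
    have h4 := hc.continuous.continuousAt (x := chartPt (X : MA g))
    rw [ContinuousAt, show (fun l : Fin (2 * g + 1) => phaseOf (chartPt (X : MA g)) l)
      = fun l : Fin (2 * g + 1) => (h₀ : ℕ → ℂ) l from
      congrArg (fun h : KdVPhase g => fun l : Fin (2 * g + 1) => (h : ℕ → ℂ) l) hs] at h4
    have h5 : ∀ᶠ y in 𝓝 (chartPt (X : MA g)),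
        hat f y = φ (fun l : Fin (2 * g + 1) => phaseOf y l) := by
      filter_upwards [h3.eventually h2] with y hy
      refine Eq.trans ?_ hy
      rw [Phi_eq_secS]
      exact congrArg (hat f) ((phaseChart g).apply_symm_apply y).symm
    filter_upwards [h5.eventually_nhds, h4.eventually h1] with y hy hy'
    exact (hy'.comp y (hc y)).congr_of_eventuallyEq hy

theorem redZ_HN_Phi (h : KdVPhase g) (i : ℕ) :
    redZ (HN i) (Phi g h) = (VMat h (2 * g + 1) 0 1).coeff i := by
  rw [Phi_eq, redZ_proj (isProlong_HN i _), fderiv_Hfun_zVec, rX_VMA, VMat_01]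

/-! ### The flows -/

theorem coeff_mul_range (p q : ℂ[X]) (k : ℕ) :
    (p * q).coeff k = ∑ n ∈ Finset.range (k + 1), p.coeff n * q.coeff (k - n) := by
  rw [Polynomial.coeff_mul, Finset.Nat.sum_antidiagonal_eq_sum_range_succ_mk]

/-- The coefficient of index `m + 1 + n` of `V^(2g+1)` is the one of index `n` of
`V^(2i+1)`, where `i = g - 1 - m`, up to a multiple of `A` when `n = 0`; hence the flows on the
phase space are, modulo `E`, the flows of `P_0 dH_m`. -/
theorem hasDerivAt_VMA {h : ℕ → ℂ} (hh : h ∈ KdVPhase g) {i : ℕ} (hi : i < g) :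
    HasDerivAt (fun t : ℂ => VMA g (h + t • cs2Field (2 * i + 1) h))
      (P0 (VMA g h) (grad (Hfun (g - 1 - i)) (VMA g h))
        + (HSer h (2 * i + 1)).coeff 1 • genD (VMA g h)) 0 := by
  obtain ⟨hp, hr, hq⟩ := lax_equation hh i
  set η := (HSer h (2 * i + 1)).coeff 1 with hη
  set X := VMA g h with hX
  set a := pPoly h (2 * i + 1) with ha
  set b := qPoly h (2 * i + 1) with hb
  set c := VMat h (2 * i + 1) 1 0 - Polynomial.C η with hc
  have hc' : VMat h (2 * i + 1) 1 0 = c + Polynomial.C η := by rw [hc]; ring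
  set n₀ := g - 1 - i with hn₀
  have hgi : 2 * g + 1 = 2 * i + 1 + 2 * (n₀ + 1) := by omega
  -- the truncation of `λ^(-n₀-1) V^(2g+1)` to its polynomial part is `V^(2i+1) - η A`
  have hcm : ∀ n, coefMat X (n₀ + 1 + n) = !![a.coeff n, b.coeff n; c.coeff n, -a.coeff n] := by
    intro n
    have e1 := coeff_pPoly_add h (2 * i + 1) (n₀ + 1) n
    have e2 := coeff_qPoly_add h (2 * i + 1) (n₀ + 1) n
    have e3 := coeff_VMat_10_add h (2 * i + 1) n₀ n
    rw [← hgi] at e1 e2 e3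
    rw [coefMat_eq, pX_VMA, rX_VMA, qX_VMA, add_comm (n₀ + 1) n, e1, e2, e3, hc,
      Polynomial.coeff_sub,
      Polynomial.coeff_C]
  have hP : ∀ k : Fin (g + 1), P0 X (grad (Hfun n₀) X) k =
      ![(b * qX X - rX X * c).coeff k, (2 * (c * pX X - a * qX X)).coeff k,
        (2 * (a * rX X - b * pX X)).coeff k] := by
    intro k
    rw [P0_grad_Hfun]
    simp only [hcm, coefMat_eq X ((k : ℕ) - _)]
    have e2 : ∀ p : ℂ[X], (2 * p).coeff k = 2 * p.coeff k := fun p => by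
      rw [show (2 : ℂ[X]) = Polynomial.C 2 from rfl, Polynomial.coeff_C_mul]
    rw [mul_comm (rX X) c, e2, e2]
    simp only [Polynomial.coeff_sub, coeff_mul_range, ← Finset.sum_sub_distrib, Finset.mul_sum]
    ext e
    fin_cases e
    · change (∑ n ∈ Finset.range ((k : ℕ) + 1), _ : Matrix (Fin 2) (Fin 2) ℂ) 0 0 = _
      rw [Matrix.sum_apply]
      refine Finset.sum_congr rfl fun n _ => ?_
      simp [Ring.lie_def]; ring
    · change (∑ n ∈ Finset.range ((k : ℕ) + 1), _ : Matrix (Fin 2) (Fin 2) ℂ) 1 0 = _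
      rw [Matrix.sum_apply]
      refine Finset.sum_congr rfl fun n _ => ?_
      simp [Ring.lie_def]; ring
    · change (∑ n ∈ Finset.range ((k : ℕ) + 1), _ : Matrix (Fin 2) (Fin 2) ℂ) 0 1 = _
      rw [Matrix.sum_apply]
      refine Finset.sum_congr rfl fun n _ => ?_
      simp [Ring.lie_def]; ring
  -- the correction `η [A, X]` is tangent to `E`
  have hv : ∀ (k : Fin (g + 1)) (e : Fin 3) , (P0 X (grad (Hfun n₀) X) + η • genD X) k e =
      (![(b * VMat h (2 * g + 1) 1 0 - qPoly h (2 * g + 1) * VMat h (2 * i + 1) 1 0).coeff k,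
        (2 * (VMat h (2 * i + 1) 1 0 * pPoly h (2 * g + 1) - a * VMat h (2 * g + 1) 1 0)).coeff k,
        (2 * (a * qPoly h (2 * g + 1) - b * pPoly h (2 * g + 1))).coeff k] : Fin 3 → ℂ) e := by
    intro k e
    have hx0 : X k 0 = (pX X).coeff k := (coeff_vPoly_fin X 0 k).symm
    have hx2 : X k 2 = (rX X).coeff k := (coeff_vPoly_fin X 2 k).symm
    rw [Pi.add_apply, hP, Pi.smul_apply, genD_apply, hc', ← qX_VMA, ← rX_VMA, ← pX_VMA, ← hX]
    fin_cases e
    · simp [mul_add, hx2]; ring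
    · simp [add_mul, hx0]; ring
    · simp
  refine hasDerivAt_pi.2 fun k => hasDerivAt_pi.2 fun e => ?_
  rw [hv]
  fin_cases e
  · exact hp k
  · exact hq k
  · exact hr k

theorem flow_eq_redBracket (h : KdVPhase g) {i : ℕ} (hi : i < g) (f : Ntil g → ℂ) (X : Stil g)
    (F : MA g → ℂ) (hX : (X : MA g) = VMA g h) (hF : IsProlong f X F) :
    fderiv ℂ F (X : MA g) (P0 (VMA g h) (grad (Hfun (g - 1 - i)) (VMA g h))
        + (HSer h (2 * i + 1)).coeff 1 • genD (VMA g h))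
          = redBracket 0 1 f (HN (g - 1 - i)) (Phi g h) ∧
    fderiv ℂ F (X : MA g) (P0 (VMA g h) (grad (Hfun (g - 1 - i)) (VMA g h))
        + (HSer h (2 * i + 1)).coeff 1 • genD (VMA g h))
          = redBracket 1 0 f (HN (g - i)) (Phi g h) := by
  have hP : Phi g h = proj X := by
    rw [Phi_eq]; congr 1; exact Subtype.ext hX.symm
  rw [hP, ← hX, map_add, map_smul, hF.1.self_of_nhds.2, smul_zero, add_zero,
    redBracket_proj hF (isProlong_HN _ X), redBracket_proj hF (isProlong_HN _ X), bracket_eq,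
      bracket_eq,
    brk_eq, brk_eq, show g - i = g - 1 - i + 1 by omega, P1_grad_Hfun]
  simp only [pair_grad]
  simp

/-! ### Polynomials with simple roots and their coefficients -/

theorem eval_lowPoly (c : Fin g → ℂ) (x : ℂ) :
    (lowPoly c).eval x = ∑ i : Fin g, c i * x ^ (i : ℕ) := by
  simp [lowPoly, Polynomial.eval_finsetSum]

theorem eval_derivative_lowPoly (c : Fin g → ℂ) (x : ℂ) :
    (lowPoly c).derivative.eval x = ∑ i : Fin g, c i * ((i : ℕ) * x ^ ((i : ℕ) - 1)) := by
  simp [lowPoly, Polynomial.eval_finsetSum, Polynomial.derivative_X_pow]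

theorem lowPoly_injective {c c' : Fin g → ℂ} (h : lowPoly c = lowPoly c') : c = c' := by
  funext i
  have := congrArg (fun p => Polynomial.coeff p i) h
  simpa [coeff_lowPoly] using this

theorem lowPoly_sub (c c' : Fin g → ℂ) : lowPoly (c - c') = lowPoly c - lowPoly c' := by
  simp [lowPoly, sub_mul]

theorem lowPoly_zero : lowPoly (0 : Fin g → ℂ) = 0 := by simp [lowPoly]

theorem eq_zero_of_eval_lowPoly {c a : Fin g → ℂ} (ha : Function.Injective a)
    (h : ∀ j, (lowPoly c).eval (a j) = 0) : c = 0 := by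
  refine lowPoly_injective ?_
  rw [lowPoly_zero]
  refine Polynomial.eq_zero_of_degree_lt_of_eval_index_eq_zero (Finset.univ : Finset (Fin g)) ha.injOn ?_
    fun i _ => h i
  simpa using degree_lowPoly c

theorem eq_of_eval_lowPoly {c c' a : Fin g → ℂ} (ha : Function.Injective a)
    (h : ∀ j, (lowPoly c).eval (a j) = (lowPoly c').eval (a j)) : c = c' :=
  sub_eq_zero.1 (eq_zero_of_eval_lowPoly ha fun j => by
    rw [lowPoly_sub, Polynomial.eval_sub, h, sub_self])

theorem exists_eval_lowPoly {a : Fin g → ℂ} (ha : Function.Injective a) (b : Fin g → ℂ) :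
    ∃ c : Fin g → ℂ, ∀ j, (lowPoly c).eval (a j) = b j := by
  have hd := Matrix.det_vandermonde_ne_zero_iff.2 ha
  refine ⟨(Matrix.vandermonde a)⁻¹.mulVec b, fun j => ?_⟩
  have h1 : (Matrix.vandermonde a).mulVec ((Matrix.vandermonde a)⁻¹.mulVec b) = b := by
    rw [Matrix.mulVec_mulVec, Matrix.mul_nonsing_inv _ (isUnit_iff_ne_zero.2 hd), Matrix.one_mulVec]
  rw [eval_lowPoly]
  refine Eq.trans ?_ (congrFun h1 j)
  exact Finset.sum_congr rfl fun i _ => mul_comm _ _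

section
variable {E : Type*} [NormedAddCommGroup E] [NormedSpace ℂ E]

/-- The derivative of the value at a variable point of a polynomial with variable coefficients. -/
theorem hasFDerivAt_eval_lowPoly {c : E → Fin g → ℂ} {c' : E →L[ℂ] Fin g → ℂ} {x : E → ℂ}
    {x' : E →L[ℂ] ℂ}
    {y : E} (hc : HasFDerivAt c c' y) (hx : HasFDerivAt x x' y) :
    ∃ L : E →L[ℂ] ℂ, HasFDerivAt (fun y => (lowPoly (c y)).eval (x y)) L y ∧
      ∀ v, L v = (lowPoly (c' v)).eval (x y) + (lowPoly (c y)).derivative.eval (x y) * x' v := by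
  simp only [eval_lowPoly, eval_derivative_lowPoly]
  refine ⟨_, HasFDerivAt.fun_sum fun i _ => (hasFDerivAt_pi'.1 hc i).mul (hx.pow (i : ℕ)),
    fun v => ?_⟩
  rw [_root_.sum_apply, Finset.sum_mul, ← Finset.sum_add_distrib]
  refine Finset.sum_congr rfl fun i _ => ?_
  simp
  ring

theorem differentiableAt_eval_lowPoly {c : E → Fin g → ℂ} {x : E → ℂ} {y : E}
    (hc : DifferentiableAt ℂ c y)
    (hx : DifferentiableAt ℂ x y) : DifferentiableAt ℂ (fun y => (lowPoly (c y)).eval (x y)) y :=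
  (hasFDerivAt_eval_lowPoly hc.hasFDerivAt hx.hasFDerivAt).choose_spec.1.differentiableAt

/-- The derivative of a root of a monic polynomial with variable coefficients. -/
theorem eval_lowPoly_fderiv_of_root {c : E → Fin g → ℂ} {c' : E →L[ℂ] Fin g → ℂ} {x : E → ℂ}
    {x' : E →L[ℂ] ℂ} {y : E} (hc : HasFDerivAt c c' y) (hx : HasFDerivAt x x' y)
    (h : ∀ᶠ y' in 𝓝 y, (Polynomial.X ^ g + lowPoly (c y')).eval (x y') = 0) (v : E) :
    (lowPoly (c' v)).eval (x y) + (Polynomial.X ^ g + lowPoly (c y)).derivative.eval (x y)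
      * x' v = 0 := by
  obtain ⟨L, hL, hLv⟩ := hasFDerivAt_eval_lowPoly hc hx
  have h1 := (hx.pow g).add hL
  have h2 : HasFDerivAt (fun y' => x y' ^ g + (lowPoly (c y')).eval (x y')) (0 : E →L[ℂ] ℂ) y := by
    refine (hasFDerivAt_const (0 : ℂ) y).congr_of_eventuallyEq ?_
    filter_upwards [h] with y' hy'
    simpa using hy'
  have h3 := congrArg (fun L : E →L[ℂ] ℂ => L v) (h1.unique h2)
  simp only [_root_.add_apply, hLv] at h3
  simp [Polynomial.derivative_X_pow] at h3 ⊢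
  linear_combination h3

end

/-- The coefficients of index `< g` of the monic polynomial with roots `a_1, …, a_g`. -/
def rootCoef (a : Fin g → ℂ) (i : Fin g) : ℂ := (∏ j, (Polynomial.X - Polynomial.C (a j))).coeff i

theorem prod_X_sub_C_eq (a : Fin g → ℂ) :
    ∏ j, (Polynomial.X - Polynomial.C (a j)) = Polynomial.X ^ g + lowPoly (rootCoef a) := by
  have hm : (∏ j, (Polynomial.X - Polynomial.C (a j))).Monic :=
    Polynomial.monic_prod_of_monic _ _ fun j _ => Polynomial.monic_X_sub_C _
  have hd : (∏ j, (Polynomial.X - Polynomial.C (a j))).natDegree = g := by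
    rw [Polynomial.natDegree_prod_of_monic _ _ fun j _ => Polynomial.monic_X_sub_C _]
    simp
  ext k
  rw [Polynomial.coeff_add, Polynomial.coeff_X_pow, coeff_lowPoly]
  rcases lt_trichotomy k g with hk | rfl | hk
  · rw [if_neg hk.ne, dif_pos hk, zero_add]; rfl
  · rw [if_pos rfl, dif_neg (lt_irrefl _), add_zero]
    have h1 := hm.coeff_natDegree
    rwa [hd] at h1
  · rw [if_neg hk.ne', dif_neg (by omega), add_zero,
      Polynomial.coeff_eq_zero_of_natDegree_lt (by omega)]

theorem eval_prod_X_sub_C (a : Fin g → ℂ) (j : Fin g) :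
    (∏ j, (Polynomial.X - Polynomial.C (a j))).eval (a j) = 0 := by
  rw [Polynomial.eval_prod]
  exact Finset.prod_eq_zero (Finset.mem_univ j) (by simp)

theorem eval_derivative_prod_ne_zero {a : Fin g → ℂ} (ha : Function.Injective a) (j : Fin g) :
    (∏ j, (Polynomial.X - Polynomial.C (a j))).derivative.eval (a j) ≠ 0 := by
  rw [← Finset.mul_prod_erase _ _ (Finset.mem_univ j), Polynomial.derivative_mul]
  simp only [Polynomial.derivative_sub, Polynomial.derivative_X, Polynomial.derivative_C,
    sub_zero, one_mul,
    Polynomial.eval_add, Polynomial.eval_mul, Polynomial.eval_sub, Polynomial.eval_X,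
      Polynomial.eval_C,
    sub_self, zero_mul, add_zero, Polynomial.eval_prod]
  exact Finset.prod_ne_zero_iff.2 fun i hi => sub_ne_zero.2 fun h =>
    Finset.ne_of_mem_erase hi (ha h).symm

theorem contDiff_rootCoef : ContDiff ℂ 1 (rootCoef : (Fin g → ℂ) → Fin g → ℂ) := by
  have key : ∀ (s : Finset (Fin g)) (k : ℕ),
      ContDiff ℂ 1 fun a : Fin g → ℂ => (∏ j ∈ s, (Polynomial.X - Polynomial.C (a j))).coeff k := by
    intro s
    induction s using Finset.induction_on with
    | empty => intro k; simpa using contDiff_const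
    | insert j s hj ih =>
      intro k
      simp only [Finset.prod_insert hj, sub_mul, Polynomial.coeff_sub, Polynomial.coeff_C_mul]
      refine ContDiff.sub ?_ ((contDiff_apply ℂ ℂ j).mul (ih k))
      cases k with
      | zero => simpa using contDiff_const
      | succ k => simpa using ih k
  exact contDiff_pi.2 fun i => key _ _

theorem isOpen_injective : IsOpen {a : Fin g → ℂ | Function.Injective a} := by
  have : {a : Fin g → ℂ | Function.Injective a} = ⋂ i, ⋂ j, {a | a i = a j → i = j} := by
    ext a; simp [Function.Injective]
  rw [this]
  refine isOpen_iInter_of_finite fun i => isOpen_iInter_of_finite fun j => ?_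
  by_cases h : i = j
  · simp [h]
  · simp only [h, imp_false]
    exact isOpen_ne_fun (continuous_apply i) (continuous_apply j)

/-- The derivative of the coefficients with respect to the roots is invertible where the roots are
distinct. -/
theorem exists_fderiv_rootCoef_equiv {a : Fin g → ℂ} (ha : Function.Injective a) :
    ∃ L : (Fin g → ℂ) ≃L[ℂ] (Fin g → ℂ), (L : (Fin g → ℂ) →L[ℂ] (Fin g → ℂ))
      = fderiv ℂ rootCoef a := by
  have hd := ((contDiff_rootCoef (g := g)).differentiable one_ne_zero a).hasFDerivAt
  have hinj : Function.Injective (fderiv ℂ rootCoef a : (Fin g → ℂ) →ₗ[ℂ] (Fin g → ℂ)) := by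
    rw [injective_iff_map_eq_zero]
    intro v hv
    have hv : fderiv ℂ rootCoef a v = 0 := hv
    funext j
    have h1 := eval_lowPoly_fderiv_of_root hd
      ((ContinuousLinearMap.proj (R := ℂ) (φ := fun _ : Fin g => ℂ) j).hasFDerivAt (x := a))
      (Filter.Eventually.of_forall fun a => by
        rw [← prod_X_sub_C_eq]; exact eval_prod_X_sub_C a j) v
    rw [hv, lowPoly_zero, Polynomial.eval_zero, zero_add, ← prod_X_sub_C_eq] at h1
    exact (mul_eq_zero.1 h1).resolve_left (eval_derivative_prod_ne_zero ha j)
  refine ⟨(LinearEquiv.ofInjectiveEndo _ hinj).toContinuousLinearEquiv, ?_⟩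
  ext v : 1
  rfl

/-- The roots are local holomorphic functions of the coefficients, where they are distinct. -/
theorem exists_roots_section {a₀ : Fin g → ℂ} (h₀ : Function.Injective a₀) :
    ∃ (U : Set (Fin g → ℂ)) (ρ : (Fin g → ℂ) → Fin g → ℂ), IsOpen U ∧ a₀ ∈ U ∧
      (∀ a ∈ U, Function.Injective a) ∧ IsOpen (rootCoef '' U) ∧ (∀ a ∈ U, ρ (rootCoef a) = a) ∧
      ∀ a ∈ U, DifferentiableAt ℂ ρ (rootCoef a) := by
  have hstr : ∀ a : Fin g → ℂ, HasStrictFDerivAt rootCoef (fderiv ℂ rootCoef a) a := fun a =>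
    (contDiff_rootCoef (g := g)).contDiffAt.hasStrictFDerivAt one_ne_zero
  obtain ⟨L, hL⟩ := exists_fderiv_rootCoef_equiv h₀
  have h1 := hstr a₀
  rw [← hL] at h1
  set e := h1.toOpenPartialHomeomorph with he
  refine ⟨e.source ∩ {a | Function.Injective a}, e.symm, e.open_source.inter isOpen_injective,
    ⟨h1.mem_toOpenPartialHomeomorph_source, h₀⟩, fun a ha => ha.2, ?_, fun a ha => e.left_inv ha.1,
    fun a ha => ?_⟩
  · exact e.isOpen_image_of_subset_source (e.open_source.inter isOpen_injective) Set.inter_subset_left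
  · obtain ⟨L', hL'⟩ := exists_fderiv_rootCoef_equiv ha.2
    have h2 := (hstr a).hasFDerivAt
    rw [← hL'] at h2
    have hs : e.symm (rootCoef a) = a := e.left_inv ha.1
    refine (e.hasFDerivAt_symm (f' := L') (e.map_source ha.1) ?_).differentiableAt
    rw [show e.symm (e a) = a from hs]
    exact h2

theorem exists_ofFn_eq {α : Type*} {s : Multiset α} {n : ℕ} (h : s.card = n) :
    ∃ a : Fin n → α, Multiset.ofList (List.ofFn a) = s := by
  obtain ⟨l, rfl⟩ := Quotient.exists_rep s
  subst h
  exact ⟨l.get, congrArg _ (List.ofFn_get l)⟩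

theorem exists_eq_prod (y : Chart g) : ∃ a : Fin g → ℂ, rootCoef a = y.1 ∧
    ((rC y).roots.Nodup → Function.Injective a) := by
  have hc : (rC y).roots.card = g := by
    refine Eq.trans ?_ (natDegree_rC y)
    exact (IsAlgClosed.splits (rC y)).natDegree_eq_card_roots.symm
  obtain ⟨a, ha⟩ := exists_ofFn_eq hc
  refine ⟨a, ?_, fun h => ?_⟩
  · have h1 := (IsAlgClosed.splits (rC y)).eq_prod_roots_of_monic (rC_monic y)
    rw [← ha] at h1
    have h2 : rC y = ∏ j, (Polynomial.X - Polynomial.C (a j)) := by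
      rw [h1, Multiset.map_coe, Multiset.prod_coe, List.map_ofFn, List.prod_ofFn]; rfl
    rw [prod_X_sub_C_eq, rC] at h2
    exact (lowPoly_injective (add_left_cancel h2)).symm
  · rw [← ha, Multiset.coe_nodup, List.nodup_ofFn] at h
    exact h

theorem rC_eq_prod {y : Chart g} {a : Fin g → ℂ} (h : rootCoef a = y.1) :
    rC y = ∏ j, (Polynomial.X - Polynomial.C (a j)) := by
  rw [prod_X_sub_C_eq, h, rC]

theorem roots_nodup_of_injective {y : Chart g} {a : Fin g → ℂ} (h : rootCoef a = y.1)
    (ha : Function.Injective a) : (rC y).roots.Nodup := by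
  rw [rC_eq_prod h, Polynomial.roots_prod _ _ (Finset.prod_ne_zero_iff.2 fun j _ => Polynomial.X_sub_C_ne_zero _)]
  simp only [Polynomial.roots_X_sub_C, Multiset.bind_singleton]
  exact Finset.univ.nodup.map ha

theorem eventually_injective_perturb (a : Fin g → ℂ) :
    ∀ᶠ ε : ℂ in 𝓝[≠] 0, Function.Injective fun j : Fin g => a j + ε * (j : ℕ) := by
  have key : ∀ i j : Fin g, ∀ᶠ ε : ℂ in 𝓝[≠] 0, a i + ε * (i : ℕ) = a j + ε * (j : ℕ) → i = j := by
    intro i j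
    by_cases hij : i = j
    · exact Filter.Eventually.of_forall fun _ _ => hij
    by_cases h : a i = a j
    · filter_upwards [self_mem_nhdsWithin] with ε hε he
      rw [h, add_left_cancel_iff] at he
      exact Fin.ext (by exact_mod_cast mul_left_cancel₀ hε he)
    · have h1 : ∀ᶠ ε : ℂ in 𝓝 0, a i + ε * (i : ℕ) ≠ a j + ε * (j : ℕ) := by
        have hc : ContinuousAt (fun ε : ℂ => a i + ε * (i : ℕ) - (a j + ε * (j : ℕ))) 0 :=
          by fun_prop
        refine (hc.eventually_ne (y := 0) (by simpa [sub_eq_zero] using h)).mono fun ε hε =>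
          sub_ne_zero.1 hε
      exact (h1.filter_mono nhdsWithin_le_nhds).mono fun ε hε he => absurd he hε
  have h2 := Filter.eventually_all.2 fun i => Filter.eventually_all.2 (key i)
  exact h2.mono fun ε hε i j h => hε i j h

/-- The polynomials with simple roots are dense: the roots can be moved apart. -/
theorem dense_roots_nodup : Dense {y : Chart g | (rC y).roots.Nodup} := by
  intro y
  obtain ⟨a, ha, -⟩ := exists_eq_prod y
  have h1 : Filter.Tendsto (fun ε : ℂ => ((rootCoef fun j : Fin g => a j + ε * (j : ℕ),
    y.2) : Chart g))
      (𝓝[≠] 0) (𝓝 y) := by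
    have hc : Continuous fun ε : ℂ => ((rootCoef fun j : Fin g => a j + ε * (j : ℕ),
      y.2) : Chart g) :=
      ((contDiff_rootCoef (g := g)).continuous.comp (by fun_prop)).prodMk continuous_const
    have := hc.tendsto 0
    simp only [zero_mul, add_zero, ha] at this
    exact this.mono_left nhdsWithin_le_nhds
  refine mem_closure_of_tendsto h1 ?_
  filter_upwards [eventually_injective_perturb a] with ε hε
  exact roots_nodup_of_injective rfl hε

theorem dense_phase : Dense {h : KdVPhase g | (VMat h (2 * g + 1) 0 1).roots.Nodup} := by
  have h1 := (dense_roots_nodup (g := g)).preimage (phaseChart g).isOpenMap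
  refine h1.mono fun h hh => ?_
  have hh : (rC (chartPt (VMA g h))).roots.Nodup := hh
  rwa [← rX_sec, sec_chartPt_VMA h.2, rX_VMA] at hh

/-! ### The coordinates `λ_j`, `μ_j` -/

/-- `ρ` is a holomorphic choice, with values in the open set `U`, of the roots of the monic
polynomials of degree `g` with roots in `U`, which are simple. -/
structure IsRootSection (U : Set (Fin g → ℂ)) (ρ : (Fin g → ℂ) → Fin g → ℂ) : Prop where
  isOpen : IsOpen U
  injective : ∀ a ∈ U, Function.Injective a
  isOpen_image : IsOpen (rootCoef '' U)
  left_inv : ∀ a ∈ U, ρ (rootCoef a) = a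
  differentiableAt : ∀ a ∈ U, DifferentiableAt ℂ ρ (rootCoef a)

/-- The function `λ_j`. -/
def lamN (ρ : (Fin g → ℂ) → Fin g → ℂ) (j : Fin g) (n : Ntil g) : ℂ := ρ (chartN g n).1 j

/-- The function `μ_j`, the value of the `(2,2)` entry at `λ_j`. -/
def muN (ρ : (Fin g → ℂ) → Fin g → ℂ) (j : Fin g) (n : Ntil g) : ℂ :=
  -(pC (chartN g n)).eval (lamN ρ j n)

/-- The points of `Ñ` at which the `(1,2)` entry has its roots in `U`. -/
def domN (U : Set (Fin g → ℂ)) : Set (Ntil g) := {n | (chartN g n).1 ∈ rootCoef '' U}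

theorem HN_last (n : Ntil g) : HN g n = (chartN g n).2.2 := by
  obtain ⟨X, rfl⟩ := proj_surjective n; rfl

theorem chartN_secS (y : Chart g) : chartN g (proj (secS y)) = y := chartPt_sec y

theorem mem_domN_secS {U : Set (Fin g → ℂ)} {y : Chart g} :
    proj (secS y) ∈ domN U ↔ y.1 ∈ rootCoef '' U := by
  rw [domN, Set.mem_ofPred_eq, chartN_secS]

theorem hat_lamN (ρ : (Fin g → ℂ) → Fin g → ℂ) (j : Fin g) (y : Chart g) :
    hat (lamN ρ j) y = ρ y.1 j := by
  rw [hat, lamN, chartN_secS]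

theorem hat_muN (ρ : (Fin g → ℂ) → Fin g → ℂ) (j : Fin g) (y : Chart g) :
    hat (muN ρ j) y = -(lowPoly y.2.1).eval (ρ y.1 j) := by
  rw [hat, muN, lamN, chartN_secS, pC]

namespace IsRootSection

variable {U : Set (Fin g → ℂ)} {ρ : (Fin g → ℂ) → Fin g → ℂ} (h : IsRootSection U ρ)
include h

theorem right_inv {c : Fin g → ℂ} (hc : c ∈ rootCoef '' U) : rootCoef (ρ c) = c ∧ ρ c ∈ U := by
  obtain ⟨a, ha, rfl⟩ := hc
  rw [h.left_inv a ha]; exact ⟨rfl, ha⟩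

theorem root_injective {c : Fin g → ℂ} (hc : c ∈ rootCoef '' U) : Function.Injective (ρ c) :=
  h.injective _ (h.right_inv hc).2

theorem rC_eq {y : Chart g} (hy : y.1 ∈ rootCoef '' U) :
    rC y = ∏ j, (Polynomial.X - Polynomial.C (ρ y.1 j)) := rC_eq_prod (h.right_inv hy).1

theorem eval_rC {y : Chart g} (hy : y.1 ∈ rootCoef '' U) (j : Fin g) :
    (rC y).eval (ρ y.1 j) = 0 := by
  rw [h.rC_eq hy, eval_prod_X_sub_C]

theorem derivative_rC_ne_zero {y : Chart g} (hy : y.1 ∈ rootCoef '' U) (j : Fin g) :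
    (rC y).derivative.eval (ρ y.1 j) ≠ 0 := by
  rw [h.rC_eq hy]; exact eval_derivative_prod_ne_zero (h.root_injective hy) j

theorem differentiableAt_root {y : Chart g} (hy : y.1 ∈ rootCoef '' U) (j : Fin g) :
    DifferentiableAt ℂ (fun y : Chart g => ρ y.1 j) y := by
  have h1 : DifferentiableAt ℂ ρ y.1 := by
    obtain ⟨a, ha, e⟩ := hy
    rw [← e]; exact h.differentiableAt a ha
  exact differentiableAt_pi.1 (DifferentiableAt.comp y h1 differentiableAt_fst) j

theorem eventually_mem_image {y : Chart g} (hy : y.1 ∈ rootCoef '' U) :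
    ∀ᶠ y' in 𝓝 y, y'.1 ∈ rootCoef '' U :=
  continuous_fst.continuousAt.eventually (h.isOpen_image.mem_nhds hy)

theorem differentiableAt_hat_lamN {y : Chart g} (hy : y.1 ∈ rootCoef '' U) (j : Fin g) :
    DifferentiableAt ℂ (hat (lamN ρ j)) y := by
  rw [show hat (lamN ρ j) = fun y => ρ y.1 j from funext (hat_lamN ρ j)]
  exact h.differentiableAt_root hy j

theorem differentiableAt_hat_muN {y : Chart g} (hy : y.1 ∈ rootCoef '' U) (j : Fin g) :
    DifferentiableAt ℂ (hat (muN ρ j)) y := by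
  rw [show hat (muN ρ j) = fun y => -(lowPoly y.2.1).eval (ρ y.1 j) from funext (hat_muN ρ j)]
  exact (differentiableAt_eval_lowPoly (by fun_prop) (h.differentiableAt_root hy j)).neg

theorem fderiv_hat_lamN {y : Chart g} (hy : y.1 ∈ rootCoef '' U) (j : Fin g) (w : Chart g) :
    (lowPoly w.1).eval (ρ y.1 j) + (rC y).derivative.eval (ρ y.1 j)
      * fderiv ℂ (hat (lamN ρ j)) y w = 0 := by
  have h1 := (h.differentiableAt_hat_lamN hy j).hasFDerivAt
  have h2 : HasFDerivAt (fun y : Chart g => y.1) (ContinuousLinearMap.fst ℂ _ _) y :=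
    hasFDerivAt_fst
  have h3 := eval_lowPoly_fderiv_of_root h2 h1 (by
    filter_upwards [h.eventually_mem_image hy] with y' hy'
    rw [hat_lamN]; exact h.eval_rC hy' j) w
  rwa [hat_lamN] at h3

theorem fderiv_hat_muN {y : Chart g} (hy : y.1 ∈ rootCoef '' U) (j : Fin g) (w : Chart g) :
    fderiv ℂ (hat (muN ρ j)) y w = -((lowPoly w.2.1).eval (ρ y.1 j)
      + (pC y).derivative.eval (ρ y.1 j) * fderiv ℂ (hat (lamN ρ j)) y w) := by
  have h1 := (h.differentiableAt_hat_lamN hy j).hasFDerivAt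
  have h2 : HasFDerivAt (fun y : Chart g => y.2.1)
      ((ContinuousLinearMap.fst ℂ _ _).comp (ContinuousLinearMap.snd ℂ _ _)) y :=
    hasFDerivAt_fst.comp y hasFDerivAt_snd
  obtain ⟨L, hL, hLv⟩ := hasFDerivAt_eval_lowPoly h2 h1
  have h3 := hL.fun_neg
  rw [show (fun y : Chart g => -(lowPoly y.2.1).eval (hat (lamN ρ j) y)) = hat (muN ρ j) from
    funext fun y => by rw [hat_muN, hat_lamN]] at h3
  rw [h3.fderiv, neg_apply, hLv, hat_lamN]
  rfl

theorem isOpen_domN : IsOpen (domN U) :=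
    h.isOpen_image.preimage (continuous_fst.comp (chartN g).continuous)

theorem holOn_lamN (j : Fin g) : HolOn (lamN ρ j) (domN U) :=
  holOn_of_hat h.isOpen_domN fun _ hy => h.differentiableAt_hat_lamN (mem_domN_secS.1 hy) j

theorem holOn_muN (j : Fin g) : HolOn (muN ρ j) (domN U) :=
  holOn_of_hat h.isOpen_domN fun _ hy => h.differentiableAt_hat_muN (mem_domN_secS.1 hy) j

/-- A tangent vector of `Ñ` that annihilates all `λ_j`, `μ_j` and `H_g` is zero. -/
theorem cls_eq_zero {X : Stil g} (hX : proj X ∈ domN U) {F G : Fin g → MA g → ℂ}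
    (hF : ∀ j, IsProlong (lamN ρ j) X (F j)) (hG : ∀ j, IsProlong (muN ρ j) X (G j))
    {v : MA g} (hv : v ∈ tanS (X : MA g)) (hFv : ∀ j, fderiv ℂ (F j) X v = 0)
    (hGv : ∀ j, fderiv ℂ (G j) X v = 0) (hH : fderiv ℂ (Hfun g) (X : MA g) v = 0) :
      cls (X : MA g) v = 0 := by
  have hy : (chartPt (X : MA g)).1 ∈ rootCoef '' U := hX
  set w := fderiv ℂ chartPt (X : MA g) v with hw
  have h1 : ∀ j, fderiv ℂ (hat (lamN ρ j)) (chartPt (X : MA g)) w = 0 := fun j => by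
    rw [hw, ← (hF j).fderiv_eq hv, hFv]
  have w1 : w.1 = 0 := eq_zero_of_eval_lowPoly (h.root_injective hy) fun j => by
    have := h.fderiv_hat_lamN hy j w
    rwa [h1, mul_zero, add_zero] at this
  have w2 : w.2.1 = 0 := eq_zero_of_eval_lowPoly (h.root_injective hy) fun j => by
    have := h.fderiv_hat_muN hy j w
    rw [h1, mul_zero, add_zero, hw, ← (hG j).fderiv_eq hv, hGv, ← hw] at this
    exact neg_eq_zero.1 this.symm
  have w3 : w.2.2 = 0 := by rw [hw, fderiv_chartPt]; exact hH
  have hw0 : w = 0 := Prod.ext w1 (Prod.ext w2 w3)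
  have h0 : v + v (Fin.last g) 0 • genD (X : MA g) = 0 := by
    refine eq_zero_of_fderiv_chartPt X.2 (Submodule.add_mem _ hv (Submodule.smul_mem _ _ (genD_mem_tanS _))) ?_ ?_
    · rw [map_add, map_smul, fderiv_chartPt_genD, smul_zero, add_zero, ← hw, hw0]
    · simp [genD_apply, last_two_of_mem X.2]
  exact StationaryKdV.cls_eq_zero.2 ⟨-v (Fin.last g) 0,
    by rw [neg_smul]; exact eq_neg_of_add_eq_zero_left h0⟩

/-- The point with given values of the `λ_j`, `μ_j` and `H_g`. -/
theorem exists_point {a : Fin g → ℂ} (ha : a ∈ U) (b : Fin g → ℂ) (c : ℂ) :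
    ∃ n ∈ domN U, (∀ j, lamN ρ j n = a j) ∧ (∀ j, muN ρ j n = b j) ∧ HN g n = c := by
  obtain ⟨p, hp⟩ := exists_eval_lowPoly (h.injective a ha) (fun j => -b j)
  refine ⟨proj (secS (rootCoef a, p, c)), mem_domN_secS.2 ⟨a, ha, rfl⟩, fun j => ?_,
    fun j => ?_, ?_⟩
  · exact (hat_lamN ρ j _).trans (by rw [h.left_inv a ha])
  · refine (hat_muN ρ j _).trans ?_
    simp only [h.left_inv a ha, hp, neg_neg]
  · exact congrArg (fun y : Chart g => y.2.2) (chartPt_sec (rootCoef a, p, c))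

theorem isCoordSystem : IsCoordSystem (lamN ρ) (muN ρ) (domN U) := by
  refine ⟨h.isOpen_domN, h.holOn_lamN, h.holOn_muN, ?_, ?_,
    fun X hX F G hF hG v hv hFv hGv hH => h.cls_eq_zero hX hF hG hv hFv hGv hH⟩
  · intro n hn n' hn' e
    simp only [Prod.mk.injEq] at e
    obtain ⟨e1, e2, e3⟩ := e
    have hr : ρ (chartN g n).1 = ρ (chartN g n').1 := e1
    have c1 : (chartN g n).1 = (chartN g n').1 := by
      rw [← (h.right_inv hn).1, hr, (h.right_inv hn').1]
    have c2 : (chartN g n).2.1 = (chartN g n').2.1 := by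
      refine eq_of_eval_lowPoly (h.root_injective hn) fun j => ?_
      have := congrFun e2 j
      simp only [muN, lamN, pC, neg_inj] at this
      rwa [← hr] at this
    rw [HN_last, HN_last] at e3
    exact (chartN g).injective (Prod.ext c1 (Prod.ext c2 e3))
  · convert h.isOpen.prod (isOpen_univ (X := (Fin g → ℂ) × ℂ)) using 1
    ext ⟨a, b, c⟩
    simp only [Set.mem_image, Prod.mk.injEq, Set.mem_prod, Set.mem_univ, and_true]
    constructor
    · rintro ⟨n, hn, rfl, -, -⟩
      exact (h.right_inv hn).2
    · intro ha
      obtain ⟨n, hn, e1, e2, e3⟩ := h.exists_point ha b c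
      exact ⟨n, hn, funext e1, funext e2, e3⟩

end IsRootSection

/-! ### The brackets of the coordinates -/

/-- The covector whose pairing with a tangent vector is the value of its `(1,2)` entry at `x`. -/
def covR (g : ℕ) (x : ℂ) : MA g := fun i => ![0, x ^ (i : ℕ), 0]

/-- The covector whose pairing with a tangent vector is the value of its `(1,1)` entry at `x`. -/
def covP (g : ℕ) (x : ℂ) : MA g := fun i => ![x ^ (i : ℕ) / 2, 0, 0]

theorem pair_covR (x : ℂ) (V : MA g) :
    pair (covR g x) V = ∑ i : Fin (g + 1), x ^ (i : ℕ) * V i 2 := by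
  rw [pair_eq]; exact Finset.sum_congr rfl fun i _ => by simp [covR]

theorem pair_covP (x : ℂ) (V : MA g) :
    pair (covP g x) V = ∑ i : Fin (g + 1), x ^ (i : ℕ) * V i 0 := by
  rw [pair_eq]; exact Finset.sum_congr rfl fun i _ => by
    show 2 * (x ^ (i : ℕ) / 2) * V i 0 + 0 * V i 1 + 0 * V i 2 = _
    ring

theorem lie_covR (M : Matrix (Fin 2) (Fin 2) ℂ) (x : ℂ) (j : Fin (g + 1)) :
    ⁅M, slMat (covR g x j)⁆ 0 1 = 0 := by
  rw [Ring.lie_def, Matrix.sub_apply, Matrix.mul_apply, Matrix.mul_apply, Fin.sum_univ_two,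
    Fin.sum_univ_two]
  simp [covR, slMat]

theorem lie_covP (M : Matrix (Fin 2) (Fin 2) ℂ) (x : ℂ) (j : Fin (g + 1)) :
    ⁅M, slMat (covP g x j)⁆ 0 0 = 0 ∧ ⁅M, slMat (covP g x j)⁆ 0 1 = -(x ^ (j : ℕ) * M 0 1) := by
  constructor <;> rw [Ring.lie_def, Matrix.sub_apply, Matrix.mul_apply, Matrix.mul_apply,
    Fin.sum_univ_two,
    Fin.sum_univ_two] <;> simp [covP, slMat] <;> ring

theorem P0_apply_two (X W : MA g) (i : Fin (g + 1)) :
    P0 X W i 2 = ∑ j : Fin (g + 1), ⁅coefMat X (i + j + 1), slMat (W j)⁆ 0 1 := by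
  change (∑ j : Fin (g + 1), _ : Matrix (Fin 2) (Fin 2) ℂ) 0 1 = _
  rw [Matrix.sum_apply]

theorem P0_apply_zero (X W : MA g) (i : Fin (g + 1)) :
    P0 X W i 0 = ∑ j : Fin (g + 1), ⁅coefMat X (i + j + 1), slMat (W j)⁆ 0 0 := by
  change (∑ j : Fin (g + 1), _ : Matrix (Fin 2) (Fin 2) ℂ) 0 0 = _
  rw [Matrix.sum_apply]

theorem P1_apply_two (X W : MA g) (i : Fin (g + 1)) : P1 X W i 2 =
    if i = 0 then -⁅coefMat X 0, slMat (W 0)⁆ 0 1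
    else ∑ j : Fin (g + 1), if j = 0 then 0 else ⁅coefMat X (i + j), slMat (W j)⁆ 0 1 := by
  rw [P1]
  split_ifs
  · rfl
  · change (∑ j : Fin (g + 1), _ : Matrix (Fin 2) (Fin 2) ℂ) 0 1 = _
    rw [Matrix.sum_apply]
    exact Finset.sum_congr rfl fun j _ => by split_ifs <;> rfl

theorem P1_apply_zero (X W : MA g) (i : Fin (g + 1)) : P1 X W i 0 =
    if i = 0 then -⁅coefMat X 0, slMat (W 0)⁆ 0 0
    else ∑ j : Fin (g + 1), if j = 0 then 0 else ⁅coefMat X (i + j), slMat (W j)⁆ 0 0 := by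
  rw [P1]
  split_ifs
  · rfl
  · change (∑ j : Fin (g + 1), _ : Matrix (Fin 2) (Fin 2) ℂ) 0 0 = _
    rw [Matrix.sum_apply]
    exact Finset.sum_congr rfl fun j _ => by split_ifs <;> rfl

theorem brk_covR_covR (a b : ℂ) (X : MA g) (x x' : ℂ) : brk a b X (covR g x) (covR g x') = 0 := by
  rw [brk_eq, pair_covR, pair_covR]
  simp [P0_apply_two, P1_apply_two, lie_covR]

theorem brk_covP_covP (a b : ℂ) (X : MA g) (x x' : ℂ) : brk a b X (covP g x) (covP g x') = 0 := by
  rw [brk_eq, pair_covP, pair_covP]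
  simp [P0_apply_zero, P1_apply_zero, lie_covP]

theorem coefMat_zero_one (X : MA g) (k : ℕ) : coefMat X k 0 1 = (rX X).coeff k := by
  rw [coefMat_eq]; rfl

theorem natDegree_rX (X : MA g) : (rX X).natDegree ≤ g := natDegree_vPoly X 2

theorem coeff_rX_of_lt (X : MA g) {k : ℕ} (hk : g < k) : (rX X).coeff k = 0 :=
  Polynomial.coeff_eq_zero_of_natDegree_lt ((natDegree_vPoly X 2).trans_lt hk)

/-- The coefficients of the quotient by a linear factor. -/
theorem coeff_divByMonic_eq_sum {r : ℂ[X]} {d : ℕ} (hr : r.natDegree ≤ d) (x : ℂ) (i : ℕ) :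
    (r /ₘ (Polynomial.X - Polynomial.C x)).coeff i
      = ∑ j ∈ Finset.range (d + 1), x ^ j * r.coeff (i + j + 1) := by
  have key : ∀ m, (r /ₘ (Polynomial.X - Polynomial.C x)).coeff i
      = ∑ j ∈ Finset.range m, x ^ j * r.coeff (i + j + 1)
        + x ^ m * (r /ₘ (Polynomial.X - Polynomial.C x)).coeff (i + m) := by
    intro m
    induction m with
    | zero => simp
    | succ m ih =>
      rw [ih, Finset.sum_range_succ, Polynomial.coeff_divByMonic_X_sub_C_rec r x (i + m),
        ← add_assoc i m 1, pow_succ]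
      ring
  rw [key (d + 1), Polynomial.coeff_eq_zero_of_natDegree_lt, mul_zero, add_zero]
  rw [Polynomial.natDegree_divByMonic _ (Polynomial.monic_X_sub_C x)]
  omega

theorem P0_covP (X : MA g) (x : ℂ) (i : Fin (g + 1)) :
    P0 X (covP g x) i 2 = -(rX X /ₘ (Polynomial.X - Polynomial.C x)).coeff i := by
  rw [P0_apply_two, coeff_divByMonic_eq_sum (natDegree_rX X),
    ← Fin.sum_univ_eq_sum_range (fun j => x ^ j * (rX X).coeff (i + j + 1)),
      ← Finset.sum_neg_distrib]
  exact Finset.sum_congr rfl fun j _ => by rw [(lie_covP _ x j).2, coefMat_zero_one]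

/-- On the covector `covP g x`, the `(1,2)` entries of `P_1` and `x P_0` agree when `x` is a root of
the `(1,2)` entry of `X`. -/
theorem P1_covP {X : MA g} {x : ℂ} (hx : (rX X).eval x = 0) (i : Fin (g + 1)) :
    P1 X (covP g x) i 2 = x * P0 X (covP g x) i 2 := by
  have h0 : ∀ (m : ℕ), (rX X /ₘ (Polynomial.X - Polynomial.C x)).coeff m = (rX X).coeff (m + 1)
      + x * (rX X /ₘ (Polynomial.X - Polynomial.C x)).coeff (m + 1) :=
    Polynomial.coeff_divByMonic_X_sub_C_rec (rX X) x
  have hmul : (Polynomial.X - Polynomial.C x) * (rX X /ₘ (Polynomial.X - Polynomial.C x)) = rX X :=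
    Polynomial.mul_divByMonic_eq_iff_isRoot.2 hx
  rw [P0_covP, P1_apply_two]
  split_ifs with hi
  · subst hi
    rw [(lie_covP _ x 0).2, coefMat_zero_one]
    have h1 := congrArg (fun p => Polynomial.coeff p 0) hmul
    simp only [sub_mul, Polynomial.coeff_sub, Polynomial.mul_coeff_zero,
      Polynomial.coeff_X_zero, zero_mul,
      Polynomial.coeff_C_zero, zero_sub] at h1
    simp [← h1]
  · obtain ⟨k, hk⟩ : ∃ k : ℕ, (i : ℕ) = k + 1 := ⟨(i : ℕ) - 1, by
      have : (i : ℕ) ≠ 0 := fun h => hi (Fin.ext h)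
      omega⟩
    have h1 : ∀ j : Fin (g + 1), (if j = 0 then 0 else ⁅coefMat X (i + j), slMat (covP g x j)⁆ 0 1)
        = -(if j = 0 then 0 else x ^ (j : ℕ) * (rX X).coeff (i + j)) := fun j => by
      split_ifs
      · simp
      · rw [(lie_covP _ x j).2, coefMat_zero_one]
    rw [Finset.sum_congr rfl fun j _ => h1 j, Finset.sum_neg_distrib, mul_neg, neg_inj,
      Fin.sum_univ_succ,
      coeff_divByMonic_eq_sum (natDegree_rX X), Finset.sum_range_succ,
      coeff_rX_of_lt X (show g < (i : ℕ) + g + 1 by omega), mul_zero, add_zero, Finset.mul_sum,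
      ← Fin.sum_univ_eq_sum_range (fun j => x * (x ^ j * (rX X).coeff (i + j + 1)))]
    simp only [Fin.succ_ne_zero, if_false, if_true, zero_add, Fin.val_succ]
    exact Finset.sum_congr rfl fun j _ => by rw [pow_succ]; ring_nf

/-- The bracket of the values of the `(1,2)` and `(1,1)` entries at two roots of the `(1,2)` entry.
-/
theorem brk_covR_covP (a b : ℂ) {X : MA g} {x x' : ℂ} (hx : (rX X).eval x = 0)
    (hx' : (rX X).eval x' = 0) :
    brk a b X (covR g x) (covP g x')
      = -((a * x + b) * if x = x' then (rX X).derivative.eval x else 0) := by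
  have hmul : (Polynomial.X - Polynomial.C x')
    * (rX X /ₘ (Polynomial.X - Polynomial.C x')) = rX X :=
    Polynomial.mul_divByMonic_eq_iff_isRoot.2 hx'
  -- the bracket is the value at `x` of the quotient of the `(1,2)` entry by `λ - x'`
  have h0 : pair (covR g x) (P0 X (covP g x'))
    = -(if x = x' then (rX X).derivative.eval x else 0) := by
    have h1 : pair (covR g x) (P0 X (covP g x'))
      = -(rX X /ₘ (Polynomial.X - Polynomial.C x')).eval x := by
      rw [pair_covR, Polynomial.eval_eq_sum_range' (n := g + 1), ← Finset.sum_neg_distrib,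
        ← Fin.sum_univ_eq_sum_range (fun j => -((rX X /ₘ (Polynomial.X - Polynomial.C x')).coeff j * x ^ j))]
      · exact Finset.sum_congr rfl fun j _ => by rw [P0_covP]; ring
      · rw [Polynomial.natDegree_divByMonic _ (Polynomial.monic_X_sub_C x')]
        have := natDegree_rX X
        omega
    rw [h1]
    split_ifs with h
    · subst h
      conv_rhs => rw [← hmul]
      simp [Polynomial.derivative_mul]
    · have h2 := congrArg (Polynomial.eval x) hmul
      rw [hx, Polynomial.eval_mul] at h2
      rw [(mul_eq_zero.1 h2).resolve_left (by simpa [sub_eq_zero] using h)]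
  have h1 : pair (covR g x) (P1 X (covP g x')) = x' * pair (covR g x) (P0 X (covP g x')) := by
    rw [pair_covR, pair_covR, Finset.mul_sum]
    exact Finset.sum_congr rfl fun i _ => by rw [P1_covP hx']; ring
  rw [brk_eq, h1, h0]
  split_ifs with h
  · rw [h]; ring
  · ring

/-- The tensor `a P_1 + b P_0` as a bilinear form on covectors. -/
def brkB (a b : ℂ) (X : MA g) : LinearMap.BilinForm ℂ (MA g) :=
  (pairB g).compl₂ (a • P1Lin X + b • P0Lin X)

theorem brkB_apply (a b : ℂ) (X W W' : MA g) : brkB a b X W W' = brk a b X W W' := rfl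

namespace IsRootSection

variable {U : Set (Fin g → ℂ)} {ρ : (Fin g → ℂ) → Fin g → ℂ} (h : IsRootSection U ρ)
include h

/-- The covector representing `dλ_j` at a point of the section. -/
theorem fderiv_lam_eq_pair {y : Chart g} (hy : y.1 ∈ rootCoef '' U) (j : Fin g) {v : MA g}
    (hv : v ∈ tanS (sec y)) : fderiv ℂ (hat (lamN ρ j)) y (fderiv ℂ chartPt (sec y) v)
      = pair (-((rC y).derivative.eval (ρ y.1 j))⁻¹ • covR g (ρ y.1 j)) v := by
  have h1 := h.fderiv_hat_lamN hy j (fderiv ℂ chartPt (sec y) v)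
  have hd := h.derivative_rC_ne_zero hy j
  have h2 : (lowPoly (fderiv ℂ chartPt (sec y) v).1).eval (ρ y.1 j)
    = pair (covR g (ρ y.1 j)) v := by
    rw [pair_covR, eval_lowPoly, fderiv_chartPt, Fin.sum_univ_castSucc, tanS_last_two hv,
      mul_zero, add_zero]
    exact Finset.sum_congr rfl fun i _ => mul_comm _ _
  rw [h2] at h1
  rw [pair_smul_left]
  field_simp
  linear_combination h1

/-- The covector representing `dμ_j` at a point of the section. -/
theorem fderiv_mu_eq_pair {y : Chart g} (hy : y.1 ∈ rootCoef '' U) (j : Fin g) {v : MA g}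
    (hv : v ∈ tanS (sec y)) : fderiv ℂ (hat (muN ρ j)) y (fderiv ℂ chartPt (sec y) v)
      = pair (-covP g (ρ y.1 j) + ((pC y).derivative.eval (ρ y.1 j) *
        ((rC y).derivative.eval (ρ y.1 j))⁻¹) • covR g (ρ y.1 j)) v := by
  have h2 : (lowPoly (fderiv ℂ chartPt (sec y) v).2.1).eval (ρ y.1 j)
    = pair (covP g (ρ y.1 j)) v := by
    have h3 := h.eval_rC hy j
    rw [rC, Polynomial.eval_add, Polynomial.eval_pow, Polynomial.eval_X, eval_lowPoly] at h3
    have h4 : ∀ i : Fin g, sec y i.castSucc 2 = y.1 i := fun i =>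
      congrFun (congrArg Prod.fst (chartPt_sec y)) i
    rw [pair_covP, eval_lowPoly, fderiv_chartPt, Fin.sum_univ_castSucc]
    simp only [tanS_last_two hv, sec_last_zero, sec_last_two, h4, mul_zero, zero_mul, one_mul,
      add_zero, zero_add,
      sub_mul, Finset.sum_sub_distrib]
    simp only [Fin.val_castSucc, Fin.val_last]
    rw [show ∑ i : Fin g, y.1 i * v (Fin.last g) 0 * ρ y.1 j ^ (i : ℕ)
      = v (Fin.last g) 0 * ∑ i : Fin g, y.1 i * ρ y.1 j ^ (i : ℕ) by
        rw [Finset.mul_sum]; exact Finset.sum_congr rfl fun i _ => by ring,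
      show ∑ i : Fin g, v i.castSucc 0 * ρ y.1 j ^ (i : ℕ) = ∑ i : Fin g, ρ y.1 j ^ (i : ℕ)
        * v i.castSucc 0 from
        Finset.sum_congr rfl fun i _ => mul_comm _ _]
    linear_combination (-v (Fin.last g) 0) * h3
  rw [h.fderiv_hat_muN hy, h2, h.fderiv_lam_eq_pair hy j hv, pair_add_left, pair_smul_left,
    pair_smul_left,
    pair_neg_left]
  ring

end IsRootSection

/-! ### Darboux–Nijenhuis coordinates -/

theorem brk_congr_tanS {a b : ℂ} {X W₁ W₂ W₁' W₂' : MA g} (h₁ : W₁ ∈ annih X) (h₁' : W₁' ∈ annih X)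
    (h : ∀ v ∈ tanS X, pair W₁ v = pair W₂ v) (h' : ∀ v ∈ tanS X, pair W₁' v = pair W₂' v) :
    brk a b X W₁ W₁' = brk a b X W₂ W₂' :=
  brk_congr h₁' (by rw [mem_annih, ← h _ (genD_mem_tanS X)]; exact h₁) h h'

/-- The bracket of two local functions is computed at the point of the section, from covectors that
represent their differentials there. -/
theorem bracket_eq_brk_sec {a b : ℂ} {f k : Ntil g → ℂ} {X : Stil g} {F K : MA g → ℂ} {W W' : MA g}
    (hF : IsProlong f X F) (hK : IsProlong k X K)
    (hW : ∀ v ∈ tanS (sec (chartPt (X : MA g))), fderiv ℂ (hat f) (chartPt (X : MA g))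
      (fderiv ℂ chartPt (sec (chartPt (X : MA g))) v) = pair W v)
    (hW' : ∀ v ∈ tanS (sec (chartPt (X : MA g))), fderiv ℂ (hat k) (chartPt (X : MA g))
      (fderiv ℂ chartPt (sec (chartPt (X : MA g))) v) = pair W' v) :
    brk a b X (grad F X) (grad K X) = brk a b (sec (chartPt (X : MA g))) W W' := by
  have h1 := isProlong_secS hF.hat_differentiableAt
  have h2 := isProlong_secS hK.hat_differentiableAt
  rw [← bracket_eq, ← redBracket_proj hF hK, ← proj_secS_chartPt X, redBracket_proj h1 h2,
    bracket_eq]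
  have hc : chartPt ((secS (chartPt (X : MA g)) : Stil g) : MA g) = chartPt (X : MA g) :=
    chartPt_sec _
  refine brk_congr_tanS h1.grad_mem h2.grad_mem (fun v hv => ?_) fun v hv => ?_
  · rw [pair_grad, h1.fderiv_eq hv, hc]; exact hW v hv
  · rw [pair_grad, h2.fderiv_eq hv, hc]; exact hW' v hv

theorem dLeaf_ham {f : Ntil g → ℂ} {X : Stil g} {F : MA g → ℂ} (hF : IsProlong f X F)
    (W : annih (X : MA g)) : dLeaf hF (ham (X : MA g) W) = pair (grad F X) (P0 X W.1) :=
  (pair_grad F X _).symm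

/-- The differential of a local function, as a covector. -/
def dCov {f : Ntil g → ℂ} {X : Stil g} {F : MA g → ℂ} (hF : IsProlong f X F) : annih (X : MA g) :=
  ⟨grad F X, hF.grad_mem⟩

theorem leafForm_ham {f : Ntil g → ℂ} {X : Stil g} {F : MA g → ℂ} (hF : IsProlong f X F)
    {ω : LinearMap.BilinForm ℂ (leafT (X : MA g))} (hω : IsLeafForm (X : MA g) ω)
      (u : leafT (X : MA g)) :
    ω (ham (X : MA g) (dCov hF)) u = dLeaf hF u := by
  obtain ⟨W, rfl⟩ := hamL_surjective (X : MA g) u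
  rw [hamL_apply, hω, dLeaf_ham]; rfl

theorem dLeaf_ham_dCov {f k : Ntil g → ℂ} {X : Stil g} {F K : MA g → ℂ} (hF : IsProlong f X F)
    (hK : IsProlong k X K) :
    dLeaf hF (ham (X : MA g) (dCov hK)) = brk 0 1 (X : MA g) (grad F X) (grad K X) := by
  rw [dLeaf_ham, brk_eq, zero_mul, zero_add, one_mul]; rfl

theorem dLeaf_nijenhuis_ham {f k : Ntil g → ℂ} {X : Stil g} {F K : MA g → ℂ} (hF : IsProlong f X F)
    (hK : IsProlong k X K) {ω : LinearMap.BilinForm ℂ (leafT (X : MA g))}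
    {N : Module.End ℂ (leafT (X : MA g))} (hω : IsLeafForm (X : MA g) ω)
      (hN : IsNijenhuis (X : MA g) ω N)
    (hFz : pair (grad F X) (zVec g) = 0) (hKz : pair (grad K X) (zVec g) = 0) :
    dLeaf hF (N (ham (X : MA g) (dCov hK))) = brk 1 0 (X : MA g) (grad F X) (grad K X) := by
  rw [← leafForm_ham hF hω, hN (dCov hF) (dCov hK) hFz hKz, brk_eq, zero_mul, add_zero,
    one_mul]; rfl

namespace IsRootSection

variable {U : Set (Fin g → ℂ)} {ρ : (Fin g → ℂ) → Fin g → ℂ} (h : IsRootSection U ρ)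
  {X : Stil g} (hX : proj X ∈ domN U) {F G : Fin g → MA g → ℂ}
  (hF : ∀ j, IsProlong (lamN ρ j) X (F j)) (hG : ∀ j, IsProlong (muN ρ j) X (G j))
include h hX

theorem eval_rX_sec (j : Fin g) : (rX (sec (chartPt (X : MA g)))).eval (lamN ρ j (proj X)) = 0 := by
  rw [rX_sec]; exact h.eval_rC hX j

include hF in
theorem brk_lam_lam (a b : ℂ) (i j : Fin g) : brk a b X (grad (F i) X) (grad (F j) X) = 0 := by
  rw [bracket_eq_brk_sec (hF i) (hF j) (fun v hv => h.fderiv_lam_eq_pair hX i hv)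
    (fun v hv => h.fderiv_lam_eq_pair hX j hv)]
  simp only [← brkB_apply, map_smul, LinearMap.smul_apply]
  rw [brkB_apply, brk_covR_covR, smul_zero, smul_zero]

include hF hG

theorem brk_lam_mu (a b : ℂ) (i j : Fin g) : brk a b X (grad (F i) X) (grad (G j) X)
    = if i = j then -(a * lamN ρ i (proj X) + b) else 0 := by
  have hy : (chartPt (X : MA g)).1 ∈ rootCoef '' U := hX
  have hd := h.derivative_rC_ne_zero hy i
  rw [bracket_eq_brk_sec (hF i) (hG j) (fun v hv => h.fderiv_lam_eq_pair hy i hv)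
    (fun v hv => h.fderiv_mu_eq_pair hy j hv)]
  simp only [← brkB_apply, map_smul, map_add, map_neg, LinearMap.smul_apply, smul_eq_mul]
  rw [brkB_apply, brkB_apply, brk_covR_covR]
  have hi : (rX (sec (chartPt (X : MA g)))).eval (ρ (chartPt (X : MA g)).1 i) = 0 :=
    h.eval_rX_sec hX i
  have hj : (rX (sec (chartPt (X : MA g)))).eval (ρ (chartPt (X : MA g)).1 j) = 0 :=
    h.eval_rX_sec hX j
  rw [brk_covR_covP a b hi hj, rX_sec]
  simp only [(h.root_injective hy).eq_iff]
  split_ifs with hij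
  · rw [show lamN ρ i (proj X) = ρ (chartPt (X : MA g)).1 i from rfl]
    field_simp
    ring
  · ring

omit hF in
theorem brk_mu_mu (a b : ℂ) (i j : Fin g) : brk a b X (grad (G i) X) (grad (G j) X) = 0 := by
  have hy : (chartPt (X : MA g)).1 ∈ rootCoef '' U := hX
  rw [bracket_eq_brk_sec (hG i) (hG j) (fun v hv => h.fderiv_mu_eq_pair hy i hv)
    (fun v hv => h.fderiv_mu_eq_pair hy j hv)]
  simp only [← brkB_apply, map_smul, map_add, map_neg, LinearMap.smul_apply, LinearMap.add_apply,
    LinearMap.neg_apply, smul_eq_mul]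
  simp only [brkB_apply, brk_covR_covR, brk_covP_covP]
  have hi : (rX (sec (chartPt (X : MA g)))).eval (ρ (chartPt (X : MA g)).1 i) = 0 :=
    h.eval_rX_sec hX i
  have hj : (rX (sec (chartPt (X : MA g)))).eval (ρ (chartPt (X : MA g)).1 j) = 0 :=
    h.eval_rX_sec hX j
  rw [brk_skew a b _ (covP g _) (covR g _), brk_covR_covP a b hi hj,
    brk_covR_covP a b hj hi, rX_sec]
  simp only [(h.root_injective hy).eq_iff]
  split_ifs with h1 h2 h2
  · subst h1; ring
  · exact absurd h1.symm h2
  · exact absurd h2.symm h1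
  · ring

omit hG in
theorem pair_lam_zVec (j : Fin g) : pair (grad (F j) X) (zVec g) = 0 := by
  have hy : (chartPt (X : MA g)).1 ∈ rootCoef '' U := hX
  rw [pair_grad, (hF j).fderiv_zVec]
  have h1 := h.fderiv_hat_lamN hy j (eH g)
  rw [show (eH g).1 = 0 from rfl, lowPoly_zero, Polynomial.eval_zero, zero_add] at h1
  exact (mul_eq_zero.1 h1).resolve_left (h.derivative_rC_ne_zero hy j)

theorem pair_mu_zVec (j : Fin g) : pair (grad (G j) X) (zVec g) = 0 := by
  have hy : (chartPt (X : MA g)).1 ∈ rootCoef '' U := hX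
  have h0 := h.pair_lam_zVec hX hF j
  rw [pair_grad, (hF j).fderiv_zVec] at h0
  rw [pair_grad, (hG j).fderiv_zVec]
  have h1 := h.fderiv_hat_muN hy j (eH g)
  rw [show (eH g).2.1 = 0 from rfl, lowPoly_zero, Polynomial.eval_zero, zero_add] at h1
  rw [h1, h0, mul_zero, neg_zero]

/-- A tangent vector of a leaf that annihilates all `λ_j`, `μ_j` is zero. -/
theorem leaf_eq_zero {u : leafT (X : MA g)} (h1 : ∀ j, dLeaf (hF j) u = 0)
    (h2 : ∀ j, dLeaf (hG j) u = 0) :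
    u = 0 := by
  obtain ⟨u, hu⟩ := u
  have hu' := hu
  rw [leafT_eq] at hu'
  obtain ⟨v, ⟨hv, hv'⟩, rfl⟩ := hu'
  exact Subtype.ext (h.cls_eq_zero hX hF hG hv h1 h2 hv')

/-- The expansion of a tangent vector of a leaf in the Hamiltonian vectors of the `λ_j`, `μ_j`. -/
theorem leaf_expansion (u : leafT (X : MA g)) :
    u = ∑ j, (dLeaf (hG j) u • ham (X : MA g) (dCov (hF j))
    - dLeaf (hF j) u • ham (X : MA g) (dCov (hG j))) := by
  have e1 : ∀ i j, dLeaf (hF i) (ham (X : MA g) (dCov (hF j))) = 0 := fun i j => by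
    rw [dLeaf_ham_dCov, h.brk_lam_lam hX hF]
  have e2 : ∀ i j, dLeaf (hF i) (ham (X : MA g) (dCov (hG j))) = if i = j then -1 else 0 :=
    fun i j => by
    rw [dLeaf_ham_dCov, h.brk_lam_mu hX hF hG, zero_mul, zero_add]
  have e3 : ∀ i j, dLeaf (hG i) (ham (X : MA g) (dCov (hG j))) = 0 := fun i j => by
    rw [dLeaf_ham_dCov, h.brk_mu_mu hX hG]
  have e4 : ∀ i j, dLeaf (hG i) (ham (X : MA g) (dCov (hF j))) = if i = j then 1 else 0 :=
    fun i j => by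
    rw [dLeaf_ham_dCov, brk_skew, h.brk_lam_mu hX hF hG, zero_mul, zero_add]
    simp only [eq_comm (a := j)]
    split_ifs <;> simp
  rw [← sub_eq_zero]
  refine h.leaf_eq_zero hX hF hG (fun i => ?_) fun i => ?_
  · simp only [map_sub, map_sum, map_smul, e1, e2, smul_eq_mul]
    simp
  · simp only [map_sub, map_sum, map_smul, e3, e4, smul_eq_mul]
    simp

theorem leaf_linearMap_ext {M : Type*} [AddCommGroup M] [Module ℂ M]
    {φ ψ : leafT (X : MA g) →ₗ[ℂ] M}
    (h1 : ∀ j, φ (ham (X : MA g) (dCov (hF j))) = ψ (ham (X : MA g) (dCov (hF j))))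
    (h2 : ∀ j, φ (ham (X : MA g) (dCov (hG j))) = ψ (ham (X : MA g) (dCov (hG j)))) : φ = ψ := by
  ext u
  rw [h.leaf_expansion hX hF hG u]
  simp only [map_sub, map_sum, map_smul, h1, h2]

theorem leafForm_eq {ω : LinearMap.BilinForm ℂ (leafT (X : MA g))} (hω : IsLeafForm (X : MA g) ω)
    (u v : leafT (X : MA g)) :
    ω u v = ∑ j, (dLeaf (hG j) u * dLeaf (hF j) v - dLeaf (hF j) u * dLeaf (hG j) v) := by
  conv_lhs => rw [h.leaf_expansion hX hF hG u]
  simp only [map_sum, map_sub, map_smul, LinearMap.sum_apply, LinearMap.sub_apply,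
    LinearMap.smul_apply,
    leafForm_ham _ hω, smul_eq_mul]

variable {ω : LinearMap.BilinForm ℂ (leafT (X : MA g))} {N : Module.End ℂ (leafT (X : MA g))}
  (hω : IsLeafForm (X : MA g) ω) (hN : IsNijenhuis (X : MA g) ω N)
include hω hN

theorem dLeaf_lam_nijenhuis (j : Fin g) (u : leafT (X : MA g)) :
    dLeaf (hF j) (N u) = lamN ρ j (proj X) * dLeaf (hF j) u := by
  have hzF := h.pair_lam_zVec hX hF
  have hzG := h.pair_mu_zVec hX hF hG
  have key : dLeaf (hF j) ∘ₗ N = lamN ρ j (proj X) • dLeaf (hF j) := by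
    refine h.leaf_linearMap_ext hX hF hG (fun k => ?_) fun k => ?_
    · rw [LinearMap.comp_apply, dLeaf_nijenhuis_ham _ _ hω hN (hzF j) (hzF k), LinearMap.smul_apply,
        dLeaf_ham_dCov, h.brk_lam_lam hX hF, h.brk_lam_lam hX hF, smul_zero]
    · rw [LinearMap.comp_apply, dLeaf_nijenhuis_ham _ _ hω hN (hzF j) (hzG k), LinearMap.smul_apply,
        dLeaf_ham_dCov, h.brk_lam_mu hX hF hG, h.brk_lam_mu hX hF hG]
      simp
  exact LinearMap.congr_fun key u

theorem dLeaf_mu_nijenhuis (j : Fin g) (u : leafT (X : MA g)) :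
    dLeaf (hG j) (N u) = lamN ρ j (proj X) * dLeaf (hG j) u := by
  have hzF := h.pair_lam_zVec hX hF
  have hzG := h.pair_mu_zVec hX hF hG
  have key : dLeaf (hG j) ∘ₗ N = lamN ρ j (proj X) • dLeaf (hG j) := by
    refine h.leaf_linearMap_ext hX hF hG (fun k => ?_) fun k => ?_
    · rw [LinearMap.comp_apply, dLeaf_nijenhuis_ham _ _ hω hN (hzG j) (hzF k), LinearMap.smul_apply,
        dLeaf_ham_dCov, brk_skew, h.brk_lam_mu hX hF hG, brk_skew, h.brk_lam_mu hX hF hG]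
      split_ifs with hkj
      · subst hkj; simp
      · simp
    · rw [LinearMap.comp_apply, dLeaf_nijenhuis_ham _ _ hω hN (hzG j) (hzG k), LinearMap.smul_apply,
        dLeaf_ham_dCov, h.brk_mu_mu hX hG, h.brk_mu_mu hX hG, smul_zero]
  exact LinearMap.congr_fun key u

/-- The minimal polynomial of the Nijenhuis tensor: the differentials of the coordinates are
eigenvectors of the transposed tensor, which span. -/
theorem minpoly_nijenhuis : minpoly ℂ N = ∏ j, (Polynomial.X - Polynomial.C (lamN ρ j (proj X))) :=
    by
  have hm : (∏ j, (Polynomial.X - Polynomial.C (lamN ρ j (proj X)))).Monic :=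
    Polynomial.monic_prod_of_monic _ _ fun j _ => Polynomial.monic_X_sub_C _
  -- a polynomial in `N` acts on an eigenvector of `N*` by its value at the eigenvalue
  have aux : ∀ (j : Fin g) (d : leafT (X : MA g) →ₗ[ℂ] ℂ), (∀ u, d (N u)
    = lamN ρ j (proj X) * d u) →
      ∀ (q : ℂ[X]) u, d (Polynomial.aeval N q u) = q.eval (lamN ρ j (proj X)) * d u := by
    intro j d hd q
    induction q using Polynomial.induction_on with
    | C a => intro u; simp
    | add p q hp hq => intro u; simp [hp, hq, add_mul]
    | monomial n a ih =>
      intro u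
      rw [pow_succ, ← mul_assoc, map_mul, Polynomial.aeval_X, Module.End.mul_apply, ih, hd]
      simp only [Polynomial.eval_mul, Polynomial.eval_X, Polynomial.eval_C, Polynomial.eval_pow]
      ring
  have hroot : Polynomial.aeval N (∏ j, (Polynomial.X - Polynomial.C (lamN ρ j (proj X)))) = 0 := by
    ext1 u
    refine h.leaf_eq_zero hX hF hG (fun j => ?_) fun j => ?_
    · rw [aux j _ (h.dLeaf_lam_nijenhuis hX hF hG hω hN j),
        eval_prod_X_sub_C (fun j => lamN ρ j (proj X)), zero_mul]
    · rw [aux j _ (h.dLeaf_mu_nijenhuis hX hF hG hω hN j),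
        eval_prod_X_sub_C (fun j => lamN ρ j (proj X)), zero_mul]
  have hint : IsIntegral ℂ N := ⟨_, hm, by rw [← Polynomial.aeval_def]; exact hroot⟩
  refine Polynomial.eq_of_monic_of_associated (minpoly.monic hint) hm
    (associated_of_dvd_dvd (minpoly.dvd _ _ hroot) ?_)
  refine Finset.prod_dvd_of_coprime (fun i _ j _ hij => ?_) fun j _ => ?_
  · exact Polynomial.isCoprime_X_sub_C_of_isUnit_sub
      (sub_ne_zero.2 fun e => hij (h.root_injective hX e)).isUnit
  · rw [Polynomial.dvd_iff_isRoot]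
    have h1 := aux j _ (h.dLeaf_lam_nijenhuis hX hF hG hω hN j) (minpoly ℂ N) (ham (X : MA g) (dCov (hG j)))
    have h2 : Polynomial.aeval N (minpoly ℂ N) = 0 := minpoly.aeval ℂ N
    rw [h2, LinearMap.zero_apply, map_zero, dLeaf_ham_dCov, h.brk_lam_mu hX hF hG, if_pos rfl] at h1
    exact (mul_eq_zero.1 h1.symm).resolve_right (by simp)

end IsRootSection

theorem IsRootSection.isDarbouxNijenhuisAt {U : Set (Fin g → ℂ)} {ρ : (Fin g → ℂ) → Fin g → ℂ}
    (h : IsRootSection U ρ) {X : Stil g} (hX : proj X ∈ domN U) :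
    IsDarbouxNijenhuisAt (lamN ρ) (muN ρ) X := fun _ _ hF hG _ _ hω hN =>
  ⟨h.leafForm_eq hX hF hG hω, h.dLeaf_lam_nijenhuis hX hF hG hω hN,
    h.dLeaf_mu_nijenhuis hX hF hG hω hN⟩

/-! ### Separation of variables -/

/-- The right-hand side of the separated equation `η² = ξ^(2g+1) + c ξ^g + ∑ α_i ξ^i`. -/
@[irreducible] def sepCurve (c t : ℂ) (α : Fin g → ℂ) :
  ℂ := t ^ (2 * g + 1) + c * t ^ g + (lowPoly α).eval t

/-- The branch of the square root of `sepCurve` which is equal to `m` where `sepCurve` is `m²`. -/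
def sepRoot (c m t : ℂ) (α : Fin g → ℂ) : ℂ := m * (sepCurve c t α / m ^ 2) ^ (((2 : ℕ) : ℂ)⁻¹)

theorem sepRoot_sq {c m t : ℂ} {α : Fin g → ℂ} (hm : m ≠ 0) :
    sepRoot c m t α ^ 2 = sepCurve c t α := by
  rw [sepRoot, mul_pow, Complex.cpow_nat_inv_pow _ two_ne_zero,
    mul_div_cancel₀ _ (pow_ne_zero 2 hm)]

theorem sepRoot_eq {c m t : ℂ} {α : Fin g → ℂ} (hm : m ≠ 0) (h : sepCurve c t α = m ^ 2) :
    sepRoot c m t α = m := by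
  rw [sepRoot, h, div_self (pow_ne_zero 2 hm), Complex.one_cpow, mul_one]

theorem continuous_sepCurve (c : ℂ) : Continuous fun p : ℂ × (Fin g → ℂ) => sepCurve c p.1 p.2 := by
  simp only [sepCurve, eval_lowPoly]
  fun_prop

theorem differentiable_sepCurve_left (c : ℂ) (α : Fin g → ℂ) :
    Differentiable ℂ fun t => sepCurve c t α := by
  simp only [sepCurve, eval_lowPoly]
  fun_prop

theorem differentiable_sepCurve_right (c t : ℂ) :
    Differentiable ℂ (sepCurve c t : (Fin g → ℂ) → ℂ) := by
  unfold sepCurve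
  simp only [eval_lowPoly]
  fun_prop

theorem differentiableAt_sepRoot {c m t : ℂ} {α : Fin g → ℂ}
    (h : sepCurve c t α / m ^ 2 ∈ Complex.slitPlane) : DifferentiableAt ℂ (sepRoot c m t) α := by
  have h0 : DifferentiableAt ℂ (fun α => sepCurve c t α) α := differentiable_sepCurve_right c t α
  have h1 : DifferentiableAt ℂ (fun α => sepCurve c t α / m ^ 2) α := by
    simpa only [div_eq_mul_inv] using h0.mul_const (m ^ 2)⁻¹
  exact (h1.cpow (differentiableAt_const _) h).const_mul m

/-- Near the given point the argument of the square root stays in the domain of the principal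
branch. -/
theorem exists_ball_sepCurve_slitPlane {l m α₀ : Fin g → ℂ} (c : ℂ) (hm : ∀ j, m j ≠ 0)
    (h : ∀ j, sepCurve c (l j) α₀ = m j ^ 2) {U : Set (Fin g → ℂ)} (hU : IsOpen U) (hl : l ∈ U) :
    ∃ ε > 0, Metric.ball l ε ⊆ U ∧ ∀ j, ∀ t ∈ Metric.ball (l j) ε, ∀ α ∈ Metric.ball α₀ ε,
      sepCurve c t α / m j ^ 2 ∈ Complex.slitPlane := by
  have hev : ∀ᶠ p : (Fin g → ℂ) × (Fin g → ℂ) in 𝓝 (l, α₀),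
      (∀ j, sepCurve c (p.1 j) p.2 / m j ^ 2 ∈ Complex.slitPlane) ∧ p.1 ∈ U := by
    refine Filter.Eventually.and (Filter.eventually_all.2 fun j => ?_) ?_
    · have h0 : Continuous (fun p : (Fin g → ℂ) × (Fin g → ℂ) => sepCurve c (p.1 j) p.2) := by
        have h2 : Continuous fun p : (Fin g → ℂ) × (Fin g → ℂ) => (p.1 j, p.2) := by fun_prop
        exact (continuous_sepCurve (g := g) c).comp h2
      have h1 : Continuous (fun p : (Fin g → ℂ) × (Fin g → ℂ) => sepCurve c (p.1 j) p.2 / m j ^ 2) := by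
        simp only [div_eq_mul_inv]; exact h0.mul continuous_const
      refine h1.continuousAt.eventually_mem (Complex.isOpen_slitPlane.mem_nhds ?_)
      show sepCurve c (l j) α₀ / m j ^ 2 ∈ _
      rw [h, div_self (pow_ne_zero 2 (hm j))]; exact Complex.one_mem_slitPlane
    · exact continuous_fst.continuousAt.eventually_mem (hU.mem_nhds hl)
  obtain ⟨ε, hε, hB⟩ := Metric.eventually_nhds_iff_ball.1 hev
  have hB' : ∀ ξ ∈ Metric.ball l ε, ∀ α ∈ Metric.ball α₀ ε,
      (∀ j, sepCurve c (ξ j) α / m j ^ 2 ∈ Complex.slitPlane) ∧ ξ ∈ U := fun ξ hξ α hα =>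
    hB (ξ, α) (by rw [← ball_prod_same]; exact ⟨hξ, hα⟩)
  refine ⟨ε, hε, fun ξ hξ => (hB' ξ hξ α₀ (Metric.mem_ball_self hε)).2, fun j t ht α hα => ?_⟩
  have h1 : Function.update l j t ∈ Metric.ball l ε := by
    rw [Metric.mem_ball, dist_pi_lt_iff hε]
    intro i
    by_cases hij : i = j
    · subst hij; simpa using ht
    · simpa [Function.update_of_ne hij] using hε
  simpa using (hB' _ h1 α hα).1 j

theorem exists_primitive_sepRoot {c l m ε : _} {α₀ α : Fin g → ℂ}
    (h : ∀ t ∈ Metric.ball (l : ℂ) ε, ∀ α ∈ Metric.ball α₀ ε,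
      sepCurve c t α / m ^ 2 ∈ Complex.slitPlane) :
    ∃ S : ℂ → ℂ, α ∈ Metric.ball α₀ ε → ∀ t ∈ Metric.ball l ε, HasDerivAt S (sepRoot c m t α) t :=
      by
  by_cases hα : α ∈ Metric.ball α₀ ε
  · have hd : DifferentiableOn ℂ (fun t => sepRoot c m t α) (Metric.ball l ε) := fun t ht =>
      ((((differentiable_sepCurve_left c α t).div_const _).cpow (differentiableAt_const _)
        (h t ht α hα)).const_mul m).differentiableWithinAt
    obtain ⟨S, hS⟩ := hd.isExactOn_ball
    exact ⟨S, fun _ => hS⟩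
  · exact ⟨0, fun h => absurd h hα⟩

theorem fderiv_sepRoot {c m t : ℂ} {α : Fin g → ℂ} (hm : m ≠ 0)
    (h : sepCurve c t α / m ^ 2 ∈ Complex.slitPlane) (i : Fin g) :
    sepRoot c m t α ≠ 0 ∧
      fderiv ℂ (sepRoot c m t) α (Pi.single i 1) = (2 * sepRoot c m t α)⁻¹ * t ^ (i : ℕ) := by
  have hs0 : sepRoot c m t α ≠ 0 := fun h0 => Complex.slitPlane_ne_zero h (by
    rw [← sepRoot_sq hm, h0]; simp)
  refine ⟨hs0, ?_⟩
  have h1 := (differentiableAt_sepRoot h).hasFDerivAt.pow 2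
  obtain ⟨L, hL, hLv⟩ := hasFDerivAt_eval_lowPoly (hasFDerivAt_id (𝕜 := ℂ) α)
    (hasFDerivAt_const (𝕜 := ℂ) t α)
  have h2 := hL.const_add (t ^ (2 * g + 1) + c * t ^ g)
  have h4 : HasFDerivAt (fun α => sepRoot c m t α ^ 2) L α := by
    simp only [sepRoot_sq hm, sepCurve]; exact h2
  have h5 := congrArg (fun L : (Fin g → ℂ) →L[ℂ] ℂ => L (Pi.single i 1)) (h1.unique h4)
  simp only [hLv] at h5
  have h6 : (lowPoly (Pi.single i 1 : Fin g → ℂ)).eval t = t ^ (i : ℕ) := by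
    rw [eval_lowPoly, Finset.sum_eq_single i]
    · simp
    · intro k _ hk; simp [hk]
    · simp
  have h7 : 2 * sepRoot c m t α * fderiv ℂ (sepRoot c m t) α (Pi.single i 1) = t ^ (i : ℕ) := by
    simpa [h6] using h5
  rw [← h7, inv_mul_cancel_left₀ (mul_ne_zero two_ne_zero hs0)]

/-- The nondegeneracy of the complete integral: the determinant is a Vandermonde determinant up to
the nonzero factors `(2 μ_j)⁻¹`. -/
theorem det_fderiv_sepRoot_ne_zero {c : ℂ} {m ξ α : Fin g → ℂ} (hm : ∀ j, m j ≠ 0)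
    (h : ∀ j, sepCurve c (ξ j) α / m j ^ 2 ∈ Complex.slitPlane) (hξ : Function.Injective ξ) :
    (Matrix.of fun j i : Fin g =>
      fderiv ℂ (sepRoot c (m j) (ξ j)) α (Pi.single i 1)).det ≠ 0 := by
  have h1 : (Matrix.of fun j i : Fin g => fderiv ℂ (sepRoot c (m j) (ξ j)) α (Pi.single i 1))
      = Matrix.of fun j i : Fin g =>
        (2 * sepRoot c (m j) (ξ j) α)⁻¹ * Matrix.vandermonde ξ j i := by
    ext j i; exact (fderiv_sepRoot (hm j) (h j) i).2
  rw [h1, Matrix.det_mul_column]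
  exact mul_ne_zero (Finset.prod_ne_zero_iff.2 fun j _ =>
      inv_ne_zero (mul_ne_zero two_ne_zero (fderiv_sepRoot (hm j) (h j) j).1))
    (Matrix.det_vandermonde_ne_zero_iff.2 hξ)

theorem det_eq_lowPoly (y : Chart g) : pC y ^ 2 + rC y * qC y = Polynomial.X ^ (2 * g + 1)
    + Polynomial.C y.2.2 * Polynomial.X ^ g + lowPoly fun i : Fin g => HN i (proj (secS y)) := by
  ext k
  simp only [Polynomial.coeff_add, Polynomial.coeff_C_mul, Polynomial.coeff_X_pow, coeff_lowPoly]
  rw [← Polynomial.coeff_add]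
  by_cases hk : k < g
  · rw [if_neg (by omega), if_neg (by omega), dif_pos hk, mul_zero, zero_add, zero_add,
      ← pX_sec, ← rX_sec,
      ← qX_sec, ← Hfun_eq]
    rfl
  · rw [coeff_det_C y (by omega), dif_neg hk, add_zero]
    simp

namespace IsRootSection

variable {U : Set (Fin g → ℂ)} {ρ : (Fin g → ℂ) → Fin g → ℂ} (h : IsRootSection U ρ)
include h

/-- The Stäckel separation relations: the value of `½ Tr X(λ)²` at `λ_j` is `μ_j²`. -/
theorem stackel {n : Ntil g} (hn : n ∈ domN U) (j : Fin g) :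
    (lowPoly fun i : Fin g => HN i n).eval (lamN ρ j n) = muN ρ j n ^ 2 - lamN ρ j n ^ (2 * g + 1)
      - HN g n * lamN ρ j n ^ g := by
  have h1 := congrArg (Polynomial.eval (lamN ρ j n)) (det_eq_lowPoly (chartN g n))
  have h2 : (rC (chartN g n)).eval (lamN ρ j n) = 0 := h.eval_rC hn j
  have h3 : proj (secS (chartN g n)) = n := (chartN g).symm_apply_apply n
  simp only [h3, Polynomial.eval_add, Polynomial.eval_mul, Polynomial.eval_pow, Polynomial.eval_X,
    Polynomial.eval_C, h2] at h1
  rw [HN_last, muN]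
  linear_combination -h1

/-- The separated complete integral: `∂S_j/∂ξ_j` is the branch `sepRoot` of the square root of the
separated curve that takes the value `μ_j` at the given point. -/
theorem isHJSeparableAt {n : Ntil g} (hn : n ∈ domN U) (hmu : ∀ j, muN ρ j n ≠ 0) :
    IsHJSeparableAt (lamN ρ) (muN ρ) (domN U) n := by
  have hst : ∀ j, sepCurve (HN g n) (lamN ρ j n) (fun i : Fin g => HN i n) = muN ρ j n ^ 2 :=
    fun j => by
    rw [sepCurve, h.stackel hn j]; ring
  obtain ⟨ε, hε, hU, hslit⟩ :=
    exists_ball_sepCurve_slitPlane (HN g n) hmu hst h.isOpen (h.right_inv hn).2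
  have hprim := fun j α => exists_primitive_sepRoot (hslit j) (α := α)
  choose S hS using hprim
  refine ⟨fun j t α => S j α t, fun j => sepRoot (HN g n) (muN ρ j n),
    Metric.ball (fun j => lamN ρ j n) ε, Metric.ball (fun i : Fin g => HN i n) ε,
      Metric.isOpen_ball,
    Metric.mem_ball_self hε, Metric.isOpen_ball, Metric.mem_ball_self hε,
    fun j => sepRoot_eq (hmu j) (hst j), fun ξ hξ α hα => ?_⟩
  have hξj : ∀ j, ξ j ∈ Metric.ball (lamN ρ j n) ε := fun j =>
    Metric.mem_ball.2 ((dist_le_pi_dist ξ _ j).trans_lt hξ)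
  have hξU := hU hξ
  have hinj := h.injective ξ hξU
  refine ⟨fun j => hS j α hα _ (hξj j),
    fun j => differentiableAt_sepRoot (hslit j _ (hξj j) α hα),
    det_fderiv_sepRoot_ne_zero hmu (fun j => hslit j _ (hξj j) α hα) hinj, ?_⟩
  obtain ⟨n', hn', e1, e2, e3⟩ := h.exists_point hξU
    (fun j => sepRoot (HN g n) (muN ρ j n) (ξ j) α) (HN g n)
  have e4 : (fun i : Fin g => HN i n') = α := eq_of_eval_lowPoly hinj fun j => by
    have h1 := h.stackel hn' j
    rw [e1, e2, e3, sepRoot_sq (hmu j), sepCurve] at h1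
    rw [h1]; ring
  exact ⟨n', hn', e3, fun j => ⟨e1 j, e2 j, congrFun e4 j⟩⟩

end IsRootSection

theorem exists_isRootSection {a₀ : Fin g → ℂ} (h₀ : Function.Injective a₀) :
    ∃ (U : Set (Fin g → ℂ)) (ρ : (Fin g → ℂ) → Fin g → ℂ), a₀ ∈ U ∧ IsRootSection U ρ := by
  obtain ⟨U, ρ, h1, h2, h3, h4, h5, h6⟩ := exists_roots_section h₀
  exact ⟨U, ρ, h2, h1, h3, h4, h5, h6⟩

theorem rC_chartPt_VMA {h : ℕ → ℂ} (hh : h ∈ KdVPhase g) :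
    rC (chartPt (VMA g h)) = VMat h (2 * g + 1) 0 1 := by
  rw [← rX_sec, sec_chartPt_VMA hh, rX_VMA, VMat_01]

theorem pC_chartPt_VMA {h : ℕ → ℂ} (hh : h ∈ KdVPhase g) :
    pC (chartPt (VMA g h)) = VMat h (2 * g + 1) 0 0 := by
  rw [← pX_sec, sec_chartPt_VMA hh, pX_VMA, VMat_00]

/-- The properties of the coordinates `λ_j`, `μ_j` in terms of the Lax matrix. -/
theorem IsRootSection.laxMatrix {U : Set (Fin g → ℂ)} {ρ : (Fin g → ℂ) → Fin g → ℂ}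
    (hU : IsRootSection U ρ)
    (h : KdVPhase g) (hh : Phi g h ∈ domN U) :
    Function.Injective (fun j => lamN ρ j (Phi g h)) ∧
    VMat h (2 * g + 1) 0 1 = ∏ j, (Polynomial.X - Polynomial.C (lamN ρ j (Phi g h))) ∧
    (∀ X : Stil g, proj X = Phi g h → ∀ ω N, IsLeafForm (X : MA g) ω →
      IsNijenhuis (X : MA g) ω N → minpoly ℂ N = VMat h (2 * g + 1) 0 1) ∧
    ∀ j : Fin g,
      muN ρ j (Phi g h) = (VMat h (2 * g + 1) 1 1).eval (lamN ρ j (Phi g h)) ∧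
      (muN ρ j (Phi g h) • (1 : Matrix (Fin 2) (Fin 2) ℂ) -
        (VMat h (2 * g + 1)).map (Polynomial.eval (lamN ρ j (Phi g h)))).det = 0 ∧
      ∑ i : Fin g, lamN ρ j (Phi g h) ^ (i : ℕ) * HN i (Phi g h) =
        muN ρ j (Phi g h) ^ 2 - lamN ρ j (Phi g h) ^ (2 * g + 1)
          - HN g (Phi g h) * lamN ρ j (Phi g h) ^ g := by
  have hch : chartN g (Phi g h) = chartPt (VMA g h) := chartN_secS _
  have hr : VMat h (2 * g + 1) 0 1 = ∏ j, (Polynomial.X - Polynomial.C (lamN ρ j (Phi g h))) := by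
    rw [← rC_chartPt_VMA h.2, ← hch]; exact hU.rC_eq hh
  refine ⟨hU.root_injective hh, hr, fun X hX ω N hω hN => ?_, fun j => ?_⟩
  · have hX' : proj X ∈ domN U := hX ▸ hh
    rw [hr, ← hX]
    obtain ⟨F, hF⟩ := Classical.axiom_of_choice fun j => hU.holOn_lamN j X hX'
    obtain ⟨G, hG⟩ := Classical.axiom_of_choice fun j => hU.holOn_muN j X hX'
    exact hU.minpoly_nijenhuis hX' hF hG hω hN
  · have hm : muN ρ j (Phi g h) = (VMat h (2 * g + 1) 1 1).eval (lamN ρ j (Phi g h)) := by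
      rw [muN, hch, pC_chartPt_VMA h.2, VMat_trace, Polynomial.eval_neg]
    refine ⟨hm, ?_, ?_⟩
    · have h0 : (VMat h (2 * g + 1) 0 1).eval (lamN ρ j (Phi g h)) = 0 := by
        rw [hr]; exact eval_prod_X_sub_C (fun j => lamN ρ j (Phi g h)) j
      rw [Matrix.det_fin_two]
      simp [Matrix.map_apply, h0, ← hm]
    · rw [← hU.stackel hh j, eval_lowPoly]
      exact Finset.sum_congr rfl fun i _ => mul_comm _ _

theorem exists_mem_domN (h₀ : KdVPhase g) (hr : (VMat h₀ (2 * g + 1) 0 1).roots.Nodup) :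
    ∃ (U : Set (Fin g → ℂ)) (ρ : (Fin g → ℂ) → Fin g → ℂ), IsRootSection U ρ
      ∧ Phi g h₀ ∈ domN U := by
  obtain ⟨a, ha, hinj⟩ := exists_eq_prod (chartPt (VMA g h₀))
  rw [rC_chartPt_VMA h₀.2] at hinj
  obtain ⟨U, ρ, haU, hU⟩ := exists_isRootSection (hinj hr)
  have h1 : chartN g (Phi g h₀) = chartPt (VMA g h₀) := chartN_secS _
  refine ⟨U, ρ, hU, a, haU, ?_⟩
  rw [h1, ha]

end

end StationaryKdV

open StationaryKdV
theorem mainTheorem8 (g : ℕ) :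
    -- the brackets of the pencil, the vector field `Z` and the functions `H_i` reduce to `Ñ`
    (∀ (a b : ℂ) (f k : Ntil g → ℂ) (X : Stil g) (F K : MA g → ℂ),
      IsProlong f X F → IsProlong k X K →
        redBracket a b f k (proj X) = bracket a b F K (X : MA g)) ∧
    (∀ (f : Ntil g → ℂ) (X : Stil g) (F : MA g → ℂ),
      IsProlong f X F → redZ f (proj X) = fderiv ℂ F (X : MA g) (zVec g)) ∧
    (∀ (f : Ntil g → ℂ) (W : Set (Ntil g)), IsOpen W → HolOn f W → HolOn (redZ f) W) ∧
    (∀ (i : ℕ) (X : Stil g), IsProlong (HN i) X (Hfun i)) ∧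
    -- `Z` is transversal to the symplectic leaves of the reduction of `P_0`, which are the level
    -- surfaces of `H_g`
    (∀ X : Stil g,
      leafT (X : MA g) = (tanS (X : MA g) ⊓
        LinearMap.ker (fderiv ℂ (Hfun g) (X : MA g)).toLinearMap).map (Submodule.mkQ _) ∧
      cls (X : MA g) (zVec g) ∉ leafT (X : MA g) ∧
      leafT (X : MA g) ⊔ Submodule.span ℂ {cls (X : MA g) (zVec g)} =
        (tanS (X : MA g)).map (Submodule.mkQ _)) ∧
    -- it is normalized
    (∀ n : Ntil g, redZ (HN g) n = 1) ∧
    -- the functions invariant along `Z` form a Poisson subalgebra for the whole pencil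
    (∀ (W : Set (Ntil g)) (f k : Ntil g → ℂ), IsOpen W → HolOn f W → HolOn k W →
      (∀ n ∈ W, redZ f n = 0) → (∀ n ∈ W, redZ k n = 0) →
      ∀ a b : ℂ, HolOn (redBracket a b f k) W ∧ ∀ n ∈ W, redZ (redBracket a b f k) n = 0) ∧
    -- the symplectic form and the Nijenhuis tensor on the leaves
    (∀ X : Stil g, (∃! ω, IsLeafForm (X : MA g) ω) ∧
      ∀ ω, IsLeafForm (X : MA g) ω → ∃! N, IsNijenhuis (X : MA g) ω N) ∧
    -- the Lax matrix identifies the phase space of `KdV_{2g+1}` with `Ñ`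
    ∃ Φ : KdVPhase g ≃ₜ Ntil g,
      (∀ h : KdVPhase g, laxPoly (VMA g h) = VMat h (2 * g + 1) ∧
        ∃ hS : VMA g h ∈ Stil g, Φ h = proj ⟨VMA g h, hS⟩) ∧
      (∀ (f : Ntil g → ℂ) (h₀ : KdVPhase g),
        (∀ X : Stil g, proj X = Φ h₀ → ∃ F, IsProlong f X F) ↔
          ∃ φ : (Fin (2 * g + 1) → ℂ) → ℂ,
            (∀ᶠ y in 𝓝 (fun l : Fin (2 * g + 1) => (h₀ : ℕ → ℂ) l), DifferentiableAt ℂ φ y) ∧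
            ∀ᶠ h : KdVPhase g in 𝓝 h₀,
              f (Φ h) = φ (fun l : Fin (2 * g + 1) => (h : ℕ → ℂ) l)) ∧
      -- the flows of `KdV_{2g+1}` are the bi-Hamiltonian flows of the functions `H_i` on `Ñ`
      (∀ (h : KdVPhase g) (i : ℕ), i < g → ∃ v : MA g,
        HasDerivAt (fun t : ℂ => VMA g ((h : ℕ → ℂ) + t • cs2Field (2 * i + 1) h)) v 0 ∧
        ∀ (f : Ntil g → ℂ) (X : Stil g) (F : MA g → ℂ), (X : MA g) = VMA g h → IsProlong f X F →
          fderiv ℂ F (X : MA g) v = redBracket 0 1 f (HN (g - 1 - i)) (Φ h) ∧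
          fderiv ℂ F (X : MA g) v = redBracket 1 0 f (HN (g - i)) (Φ h)) ∧
      -- `Z (H(λ))` is the `(1,2)` entry of `V^(2g+1)`
      (∀ (h : KdVPhase g) (i : ℕ), redZ (HN i) (Φ h) = (VMat h (2 * g + 1) 0 1).coeff i) ∧
      -- Darboux–Nijenhuis coordinates exist near every point where that entry has simple roots
      Dense {h : KdVPhase g | (VMat h (2 * g + 1) 0 1).roots.Nodup} ∧
      ∀ h₀ : KdVPhase g, (VMat h₀ (2 * g + 1) 0 1).roots.Nodup →
        ∃ (W : Set (Ntil g)) (lam mu : Fin g → Ntil g → ℂ),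
          Φ h₀ ∈ W ∧ IsCoordSystem lam mu W ∧
          (∀ X : Stil g, proj X ∈ W → IsDarbouxNijenhuisAt lam mu X) ∧
          (∀ h : KdVPhase g, Φ h ∈ W →
            -- the `λ_j` are the distinct roots of the `(1,2)` entry, the minimal polynomial of `N`
            Function.Injective (fun j => lam j (Φ h)) ∧
            VMat h (2 * g + 1) 0 1 =
              ∏ j, (Polynomial.X - Polynomial.C (lam j (Φ h))) ∧
            (∀ X : Stil g, proj X = Φ h → ∀ ω N, IsLeafForm (X : MA g) ω →
              IsNijenhuis (X : MA g) ω N → minpoly ℂ N = VMat h (2 * g + 1) 0 1) ∧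
            ∀ j : Fin g,
              -- `μ_j` is the value of the `(2,2)` entry at `λ_j`
              mu j (Φ h) = (VMat h (2 * g + 1) 1 1).eval (lam j (Φ h)) ∧
              -- `(λ_j, μ_j)` lies on the spectral curve
              (mu j (Φ h) • (1 : Matrix (Fin 2) (Fin 2) ℂ) -
                (VMat h (2 * g + 1)).map (Polynomial.eval (lam j (Φ h)))).det = 0 ∧
              -- Stäckel separation relations
              ∑ i : Fin g, lam j (Φ h) ^ (i : ℕ) * HN i (Φ h) =
                mu j (Φ h) ^ 2 - lam j (Φ h) ^ (2 * g + 1)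
                  - HN g (Φ h) * lam j (Φ h) ^ g) ∧
          -- separability of the Hamilton–Jacobi equations
          (∀ n ∈ W, (∀ j, mu j n ≠ 0) → IsHJSeparableAt lam mu W n) := by
  refine ⟨fun a b f k X F K hF hK => redBracket_proj hF hK, fun f X F hF => redZ_proj hF,
    fun f W hW hf => holOn_redZ hW hf, isProlong_HN,
    fun X => ⟨leafT_eq X.1, zVec_not_mem_leafT X.2, leafT_sup_zVec X.2⟩, redZ_HN,
    fun W f k hW hf hk hf0 hk0 a b => ⟨holOn_redBracket a b hW hf hk, fun n hn =>
      redZ_redBracket a b hW hf hk hf0 hk0 hn⟩,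
    fun X => ⟨existsUnique_leafForm X.1, fun ω hω => existsUnique_nijenhuis X.2 hω⟩,
    Phi g, fun h => ⟨laxPoly_VMA h, VMA_mem h.2, Phi_eq h⟩, isProlong_iff_phase,
    fun h i hi => ⟨_, hasDerivAt_VMA h.2 hi, fun f X F hX hF => flow_eq_redBracket h hi f X F hX hF⟩,
    redZ_HN_Phi, dense_phase, fun h₀ hr => ?_⟩
  obtain ⟨U, ρ, hU, hh⟩ := exists_mem_domN h₀ hr
  exact ⟨domN U, lamN ρ, muN ρ, hh, hU.isCoordSystem, fun X hX => hU.isDarbouxNijenhuisAt hX,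
    fun h hW => hU.laxMatrix h hW, fun n hn hmu => hU.isHJSeparableAt hn hmu⟩
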